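/- Let $m\ge 1$, let $V=\mathbb C^{2m+1}$ have standard basis $v_1,\dots,v_{2m+1}$, put $\bar v_i=v_{2m+2-i}$ and $\epsilon(i)=(-1)^{m+1-i}$, and let $\langle v_i,v_{2m+2-j}\rangle=2\Phi(v_i,v_{2m+2-j})=\epsilon(i)\delta_{ij}$. Let $\mathrm{Cl}(V)$ be the Clifford algebra with relations $vv'+v'v=2\Phi(v,v')$, let $W=\langle v_1,\dots,v_m\rangle$ and $V_{\mathrm{Spin}}=\bigwedge^\bullet W$ with basis $w_I=v_{i_1}\wedge\dots\wedge v_{i_k}$ for $I=\{i_1<\dots<i_k\}\subset\{1,\dots,m\}$. The algebra $\mathrm{Cl}(V)$ acts on $V_{\mathrm{Spin}}$ by $v_i\cdot w=v_i\wedge w$ and $\bar v_i\cdot w=\iota_{\langle \bar v_i,\cdot\rangle}w$ for $i\le m$, and $v_{m+1}\cdot w_I=\frac{(-1)^{|I|}}{\sqrt2}w_I$. Write $w_\lambda=w_I$ for the strict partition $\lambda$ with parts $m+1-i$, $i\in I$, and $\mathrm{PD}(\lambda)$ for the strict partition of the complement of $I$. Consider the following maps. * $\delta:V_{\mathrm{Spin}}\to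 V_{\mathrm{Spin}}^*$, $w_\lambda\mapsto(-1)^{|\lambda|}w^*_{\mathrm{PD}(\lambda)}$. * $\iota:\mathrm{Sym}^2(V_{\mathrm{Spin}})\to V_{\mathrm{Spin}}\otimes V_{\mathrm{Spin}}\to V_{\mathrm{Spin}}^*\otimes V_{\mathrm{Spin}}=\mathrm{End}(V_{\mathrm{Spin}})$, where the first map is $ab\mapsto\frac12(a\otimes b+b\otimes a)$ and the second is $\delta\otimes\mathrm{id}$. * $\kappa:\bigoplus_{k\equiv m\,(2),\,0\le k\le 2m+1}\bigwedge^kV\to\mathrm{End}(V_{\mathrm{Spin}})$: antisymmetrization $u_1\wedge\dots\wedge u_k\mapsto\frac1{k!}\sum_\sigma\mathrm{sgn}(\sigma)u_{\sigma(1)}\cdots u_{\sigma(k)}$ into $\mathrm{Cl}(V)$, followed by the action on $V_{\mathrm{Spin}}$. * $\mathrm{pr}$: the projection of $\bigoplus_{k\equiv m\,(2)}\bigwedge^kV$ onto $\bigwedge^mV$. * $c:\bigwedge^mV\to\bigwedge^{m+1}V^*$, $u_1\wedge\dots\wedge u_m\mapsto\Omega(u_1,\dots,u_m,\cdot)$,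 the contraction with $\Omega=(-1)^{m(m+1)/2}v_1^*\wedge\dots\wedge v_{2m+1}^*$. * $d:\bigwedge^{m+1}V^*\to\bigwedge^{m+1}V$, induced by the isomorphism $V^*\cong V$ given by $\langle\ ,\ \rangle$. Then $\delta,\kappa,c,d$ are isomorphisms, $\iota$ is injective, and $$\pi=d\circ c\circ\mathrm{pr}\circ\kappa^{-1}\circ\iota:\ \mathrm{Sym}^2(V_{\mathrm{Spin}})\longrightarrow\textstyle\bigwedge^{m+1}V$$ is surjective and equivariant under $\mathrm{Spin}(V)$ and under $\mathfrak{so}(V)$. For $2\le j\le m$ put $l=m+1-j$, and for $J\subset\{1,\dots,l\}$ put $s(J)=\sum_{i\in J}(l+1-i)$. Let $\rho_l^J$ be the partition obtained from $\rho_l=(l,l-1,\dots,1)$ by removing the $i$-th row for each $i\in J$, and let $\mu_l^J$ be obtained from $\mu_l=(m,m-1,\dots,m+1-l)$ by adding at the bottom a row of $l+1-i$ boxes for each $i\in J$. Define $\rho_{l,+}^J$ and $\mu_{l,+}^J$ in the same way, with $\rho_l$ replaced by $\rho_{l,+}=(l+1,l-1,\dots,1)$ and with rows of $l+1-i+\delta_{i,1}$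 boxes added to $\mu_l$. Put $w_\lambda=0$ if $\lambda$ is not a strict partition, and set $$\mathcal D_{(j)}=\sum_{J\subset\{1,\dots,l\}}(-1)^{s(J)}w_{\rho_l^J}w_{\mu_l^J},\qquad \mathcal N_{(j)}=\sum_{J\subset\{1,\dots,l\}}(-1)^{s(J)}w_{\rho_{l,+}^J}w_{\mu_{l,+}^J}$$ in $\mathrm{Sym}^2(V_{\mathrm{Spin}})$. Then for all $2\le j\le m$ the following hold. 1. $\iota(\mathcal D_{(j)})$ is the action on $V_{\mathrm{Spin}}$ of the following element of $\mathrm{Cl}(V)$, which is even if $m$ is even and odd if $m$ is odd: $$\frac{(-1)^{m(m+1)/2}}2\Big[2\,v_{\{1,\dots,m+1-j\}\cup\{2m+3-j,\dots,2m+1\}}+\sum_{I\subsetneq\{1,\dots,k\}}\Big(\prod_{i\in\{1,\dots,k\}\setminus I}(-1)^i\Big)v_{I\cup T\cup\bar I}\Big].$$ Here $v_S=v_{i_1}\cdots v_{i_r}$ for $S=\{i_1<\dots<i_r\}$, $\bar I=\{2m+2-i: i\in I\}$ and $k=\min(m+1-j,\,j-1)$; moreover $T=\{2m+3-j,\dots,m+j\}$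 if $j>\frac{m+1}2$ and $T=\{j,\dots,m+1-j\}$ if $j\le\frac{m+1}2$. 2. $\mathrm{pr}\,\kappa^{-1}\iota(\mathcal D_{(j)})=(-1)^{m(m+1)/2}\,v_1\wedge\dots\wedge v_{m+1-j}\wedge v_{2m+3-j}\wedge\dots\wedge v_{2m+1}$. 3. $\pi(\mathcal D_{(j)})=v_j\wedge v_{j+1}\wedge\dots\wedge v_{j+m}$ and $\pi(\mathcal N_{(j)})=v_{j-1}\wedge v_{j+1}\wedge\dots\wedge v_{j+m}$. -/

import Mathlib

open scoped TensorProduct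

noncomputable section

namespace SpinProj

/-! ### General multilinear algebra over `ℂ` -/

section General

variable {M N : Type} [AddCommGroup M] [Module ℂ M] [AddCommGroup N] [Module ℂ N]

/-- A bilinear map viewed as a multilinear map on `Fin 2`. -/
def bilinMulti (f : M →ₗ[ℂ] M →ₗ[ℂ] N) : MultilinearMap ℂ (fun _ : Fin 2 => M) N where
  toFun v := f (v 0) (v 1)
  map_update_add' v i x y := by
    fin_cases i <;> simp [Function.update]
  map_update_smul' v i c x := by
    fin_cases i <;> simp [Function.update]

theorem bilinMulti_perm (f : M →ₗ[ℂ] M →ₗ[ℂ] N) (hf : ∀ a b, f a b = f b a)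
    (e : Equiv.Perm (Fin 2)) (v : Fin 2 → M) :
    bilinMulti f v = bilinMulti f (fun i => v (e i)) := by
  change f (v 0) (v 1) = f (v (e 0)) (v (e 1))
  have h01 : e 0 ≠ e 1 := fun h => by simpa using e.injective h
  rcases Fin.exists_fin_two.mp ⟨e 0, rfl⟩ with h | h <;>
  rcases Fin.exists_fin_two.mp ⟨e 1, rfl⟩ with h' | h' <;> rw [h] at h01 ⊢ <;> rw [h'] at h01 ⊢
  · exact absurd rfl h01
  · exact hf _ _
  · exact absurd rfl h01

/-- The linear map `Sym² M → N` with `a · b ↦ f a b`, for a symmetric bilinear map `f`. -/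
def symLift (f : M →ₗ[ℂ] M →ₗ[ℂ] N) (hf : ∀ a b, f a b = f b a) : Sym[ℂ]^2 M →ₗ[ℂ] N where
  toFun := AddCon.lift _ (PiTensorProduct.lift (bilinMulti f)).toAddMonoidHom (by
    rw [AddCon.addConGen_le]
    intro x y h
    cases h with
    | perm e v =>
      rw [AddCon.ker_rel]
      simpa using bilinMulti_perm f hf e v)
  map_add' x y := map_add _ x y
  map_smul' r x := by
    induction x using AddCon.induction_on with
    | H x => exact map_smul (PiTensorProduct.lift (bilinMulti f)) r x

/-- The product `a · b` in `Sym² M`. -/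
def symMul (a b : M) : Sym[ℂ]^2 M := SymmetricPower.tprod ℂ ![a, b]

theorem symLift_symMul (f : M →ₗ[ℂ] M →ₗ[ℂ] N) (hf : ∀ a b, f a b = f b a) (a b : M) :
    symLift f hf (symMul a b) = f a b := by
  change PiTensorProduct.lift (bilinMulti f) (PiTensorProduct.tprod ℂ ![a, b]) = f a b
  rw [PiTensorProduct.lift.tprod]; rfl

theorem symMul_comm (a b : M) : symMul a b = symMul b a := by
  have h := SymmetricPower.tprod_equiv (R := ℂ) (Equiv.swap (0 : Fin 2) 1) ![a, b]
  unfold symMul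
  rw [← h]; congr 1; funext i; fin_cases i <;> simp

theorem update_pair_zero {M : Type} (a b z : M) : Function.update ![a, b] 0 z = ![z, b] := by
  funext i; fin_cases i <;> rfl

theorem update_pair_one {M : Type} (a b z : M) : Function.update ![a, b] 1 z = ![a, z] := by
  funext i; fin_cases i <;> rfl

/-- The product of `Sym² M` as a bilinear map. -/
def symMulB : M →ₗ[ℂ] M →ₗ[ℂ] Sym[ℂ]^2 M :=
  LinearMap.mk₂ ℂ symMul
    (fun a a' b => by
      have h := (SymmetricPower.tprod ℂ).map_update_add ![a, b] 0 a a'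
      rwa [update_pair_zero, update_pair_zero, update_pair_zero] at h)
    (fun c a b => by
      have h := (SymmetricPower.tprod ℂ).map_update_smul ![a, b] 0 c a
      rwa [update_pair_zero, update_pair_zero] at h)
    (fun a b b' => by
      have h := (SymmetricPower.tprod ℂ).map_update_add ![a, b] 1 b b'
      rwa [update_pair_one, update_pair_one, update_pair_one] at h)
    (fun c a b => by
      have h := (SymmetricPower.tprod ℂ).map_update_smul ![a, b] 1 c b
      rwa [update_pair_one, update_pair_one] at h)

/-- The action `a · b ↦ (T a) · (T b)` of a (group) element on `Sym²`. -/
def symMap (T : Module.End ℂ M) : Sym[ℂ]^2 M →ₗ[ℂ] Sym[ℂ]^2 M :=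
  symLift (symMulB.compl₁₂ T T) (fun _ _ => symMul_comm _ _)

/-- The action `a · b ↦ (T a) · b + a · (T b)` of a Lie algebra element on `Sym²`. -/
def symDer (T : Module.End ℂ M) : Sym[ℂ]^2 M →ₗ[ℂ] Sym[ℂ]^2 M :=
  symLift (symMulB.compl₁₂ T LinearMap.id + symMulB.compl₁₂ LinearMap.id T) (fun a b => by
    change symMul (T a) b + symMul a (T b) = symMul (T b) a + symMul b (T a)
    rw [symMul_comm (T a) b, symMul_comm a (T b), add_comm])

/-- The embedding `Sym² M → M ⊗ M`, `a · b ↦ ½ (a ⊗ b + b ⊗ a)`. -/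
def symToTensor : Sym[ℂ]^2 M →ₗ[ℂ] M ⊗[ℂ] M :=
  symLift ((1 / 2 : ℂ) • (TensorProduct.mk ℂ M M + (TensorProduct.mk ℂ M M).flip)) (fun a b => by
    simp [add_comm])

/-- The derivation action of `T` on `⋀ⁿ M`:
`u₁ ∧ ⋯ ∧ uₙ ↦ ∑ᵢ u₁ ∧ ⋯ ∧ T uᵢ ∧ ⋯ ∧ uₙ`. -/
def extDer (n : ℕ) (T : Module.End ℂ M) : ⋀[ℂ]^n M →ₗ[ℂ] ⋀[ℂ]^n M :=
  exteriorPower.alternatingMapLinearEquiv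
    { (∑ i : Fin n, (exteriorPower.ιMulti ℂ n).toMultilinearMap.compLinearMap
        (fun k => if k = i then T else LinearMap.id) : MultilinearMap ℂ (fun _ => M) _) with
      map_eq_zero_of_eq' := fun u a b hu hab => by
        have key : ∀ i : Fin n, (fun k => (if k = i then T else LinearMap.id) (u k)) =
            Function.update u i (T (u i)) := by
          intro i; funext k
          by_cases h : k = i
          · subst h; simp
          · simp [h]
        simp only [MultilinearMap.toFun_eq_coe, _root_.sum_apply,
          MultilinearMap.compLinearMap_apply, AlternatingMap.coe_multilinearMap, key]
        rw [← Finset.add_sum_erase _ _ (Finset.mem_univ a),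
          ← Finset.add_sum_erase _ _ (Finset.mem_erase.2 ⟨hab.symm, Finset.mem_univ b⟩),
          Finset.sum_eq_zero, add_zero]
        · have hs : Function.update u b (T (u b)) =
              Function.update u a (T (u a)) ∘ Equiv.swap a b := by
            funext k
            by_cases h1 : k = a
            · subst h1; simp [hab, hab.symm, hu]
            · by_cases h2 : k = b
              · subst h2; simp [hu]
              · simp [h1, h2, Equiv.swap_apply_of_ne_of_ne h1 h2]
          rw [hs, AlternatingMap.map_swap _ _ hab, add_neg_cancel]
        · intro i hi
          simp only [Finset.mem_erase, Finset.mem_univ, and_true] at hi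
          apply AlternatingMap.map_eq_zero_of_eq _ _ _ hab
          rw [Function.update_of_ne (Ne.symm hi.2), Function.update_of_ne (Ne.symm hi.1), hu] }

/-- Contraction of elements of `⋀ M*` by elements of `⋀ M`:
`(u₁ ∧ ⋯ ∧ u_k) ⌟ ω = ω(u₁, …, u_k, ⋯) = i_{u_k} ⋯ i_{u₁} ω`. -/
def contr : ExteriorAlgebra ℂ M →ₐ[ℂ]
    (Module.End ℂ (ExteriorAlgebra ℂ (Module.Dual ℂ M)))ᵐᵒᵖ :=
  ExteriorAlgebra.lift ℂ
    ⟨(MulOpposite.opLinearEquiv ℂ).toLinearMap ∘ₗ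
      (CliffordAlgebra.contractLeft (Q := (0 : QuadraticForm ℂ (Module.Dual ℂ M)))) ∘ₗ
        Module.Dual.eval ℂ M, fun v => by
      apply MulOpposite.unop_injective
      refine LinearMap.ext fun x => ?_
      exact CliffordAlgebra.contractLeft_contractLeft (Q := (0 : QuadraticForm ℂ (Module.Dual ℂ M)))
        (Module.Dual.eval ℂ M v) x⟩

theorem contr_ι_mul (v : M) (x : ExteriorAlgebra ℂ M)
    (ω : ExteriorAlgebra ℂ (Module.Dual ℂ M)) :
    (contr (ExteriorAlgebra.ι ℂ v * x)).unop ω = (contr x).unop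
      (CliffordAlgebra.contractLeft (Q := (0 : QuadraticForm ℂ (Module.Dual ℂ M)))
        (Module.Dual.eval ℂ M v) ω) := by
  rw [map_mul, contr, ExteriorAlgebra.lift_ι_apply]
  rfl

theorem contractLeft_mem (φ : Module.Dual ℂ M) (n : ℕ) (x : ExteriorAlgebra ℂ M)
    (hx : x ∈ ⋀[ℂ]^(n + 1) M) :
    CliffordAlgebra.contractLeft (Q := (0 : QuadraticForm ℂ M)) φ x ∈ ⋀[ℂ]^n M := by
  have main : ∀ (k : ℕ) (y : ExteriorAlgebra ℂ M), y ∈ ⋀[ℂ]^k M → ∀ n, k = n + 1 →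
      CliffordAlgebra.contractLeft (Q := (0 : QuadraticForm ℂ M)) φ y ∈ ⋀[ℂ]^n M := by
    intro k y hy
    induction hy using Submodule.pow_induction_on_left' with
    | algebraMap r => intro n h; omega
    | add x y i hx hy ihx ihy =>
      intro n h
      rw [map_add]; exact add_mem (ihx n h) (ihy n h)
    | mem_mul a ha i x hx ih =>
      intro n h
      obtain ⟨v, rfl⟩ := ha
      obtain rfl : i = n := by omega
      have e := CliffordAlgebra.contractLeft_ι_mul (Q := (0 : QuadraticForm ℂ M)) φ v x
      change CliffordAlgebra.contractLeft (Q := (0 : QuadraticForm ℂ M)) φ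
        (CliffordAlgebra.ι (0 : QuadraticForm ℂ M) v * x) ∈ _
      rw [e]
      refine sub_mem (Submodule.smul_mem _ _ hx) ?_
      cases i with
      | zero =>
        obtain ⟨r, rfl⟩ := Submodule.mem_one.1 (by simpa using hx)
        rw [CliffordAlgebra.contractLeft_algebraMap, mul_zero]
        exact zero_mem _
      | succ i =>
        change _ ∈ LinearMap.range (ExteriorAlgebra.ι ℂ) ^ (i + 1)
        rw [pow_succ']
        exact Submodule.mul_mem_mul ⟨v, rfl⟩ (ih i rfl)
  exact main _ x hx n rfl

theorem contr_mem (a b : ℕ) (x : ExteriorAlgebra ℂ M) (hx : x ∈ ⋀[ℂ]^a M)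
    (ω : ExteriorAlgebra ℂ (Module.Dual ℂ M)) (hω : ω ∈ ⋀[ℂ]^(a + b) (Module.Dual ℂ M)) :
    (contr x).unop ω ∈ ⋀[ℂ]^b (Module.Dual ℂ M) := by
  induction hx using Submodule.pow_induction_on_left' generalizing ω with
  | algebraMap r =>
    rw [AlgHom.commutes]
    have : (algebraMap ℂ (Module.End ℂ (ExteriorAlgebra ℂ (Module.Dual ℂ M)))ᵐᵒᵖ r).unop ω =
      r • ω := rfl
    rw [this]
    rw [zero_add] at hω
    exact Submodule.smul_mem _ _ hω
  | add x y i hx hy ihx ihy =>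
    rw [map_add, MulOpposite.unop_add, LinearMap.add_apply]
    exact add_mem (ihx ω hω) (ihy ω hω)
  | mem_mul v hv i x hx ih =>
    obtain ⟨v, rfl⟩ := hv
    rw [contr_ι_mul]
    apply ih
    apply contractLeft_mem
    rwa [show i + b + 1 = i.succ + b by omega]

/-- Contraction into a fixed form `ω ∈ ⋀^{a+b} M*`, as a linear map `⋀^a M → ⋀^b M*`. -/
def contrWith (a b : ℕ) {n : ℕ} (h : n = a + b) (ω : ⋀[ℂ]^n (Module.Dual ℂ M)) :
    ⋀[ℂ]^a M →ₗ[ℂ] ⋀[ℂ]^b (Module.Dual ℂ M) :=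
  LinearMap.codRestrict _
    (LinearMap.applyₗ (ω : ExteriorAlgebra ℂ (Module.Dual ℂ M)) ∘ₗ
      (MulOpposite.opLinearEquiv ℂ).symm.toLinearMap ∘ₗ contr.toLinearMap ∘ₗ (⋀[ℂ]^a M).subtype)
    (fun x => contr_mem a b (x : ExteriorAlgebra ℂ M) x.2 ω (h ▸ ω.2))

end General

/-! ### The quadratic space and its Clifford algebra -/

/-- `V = ℂ^{2m+1}`; the standard basis vector `v_i` (`1 ≤ i ≤ 2m+1`) has the index `i - 1`. -/
abbrev V (m : ℕ) : Type := Fin (2 * m + 1) → ℂ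

/-- The maximal isotropic subspace `W` spanned by `v_1, …, v_m`, in coordinates. -/
abbrev W (m : ℕ) : Type := Fin m → ℂ

/-- The basis vector `v_i`, with `1`-based index `i`. -/
def vec (m i : ℕ) : V m := fun k => if (k : ℕ) + 1 = i then 1 else 0

/-- The sign `ε(i) = (-1)^{m+1-i}`; the index `k` stands for `i = k + 1`. -/
def eps (m : ℕ) (k : Fin (2 * m + 1)) : ℂ := (-1) ^ (m + (k : ℕ))

/-- The symmetric bilinear form with `⟨v_i, v_{2m+2-j}⟩ = ε(i) δ_{ij}`; this is `2Φ`. -/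
def bil (m : ℕ) : LinearMap.BilinForm ℂ (V m) :=
  LinearMap.mk₂ ℂ (fun x y => ∑ k, eps m k * x k * y k.rev)
    (fun x x' y => by simp [mul_add, add_mul, Finset.sum_add_distrib])
    (fun c x y => by simp only [Pi.smul_apply, smul_eq_mul, Finset.mul_sum]; congr 1; ext; ring)
    (fun x y y' => by simp [mul_add, Finset.sum_add_distrib])
    (fun c x y => by simp only [Pi.smul_apply, smul_eq_mul, Finset.mul_sum]; congr 1; ext; ring)

/-- The quadratic form `v ↦ Φ(v, v) = ½⟨v, v⟩`; in `Cl(V)` one has `v v' + v' v = 2Φ(v, v')`. -/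
def quad (m : ℕ) : QuadraticForm ℂ (V m) := (1 / 2 : ℂ) • (bil m).toQuadraticMap

/-- The Clifford algebra `Cl(V)`. -/
abbrev Cl (m : ℕ) : Type := CliffordAlgebra (quad m)

/-- The inclusion `W ⊂ V`. -/
def inclW (m : ℕ) : W m →ₗ[ℂ] V m where
  toFun w k := if h : (k : ℕ) < m then w ⟨k, h⟩ else 0
  map_add' w w' := by ext k; by_cases h : (k : ℕ) < m <;> simp [h]
  map_smul' c w := by ext k; by_cases h : (k : ℕ) < m <;> simp [h]

/-- The coordinate projection `V → W`. -/
def projW (m : ℕ) : V m →ₗ[ℂ] W m :=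
  LinearMap.funLeft ℂ ℂ (Fin.castLE (by omega : m ≤ 2 * m + 1))

/-- The middle index, that of `v_{m+1}`. -/
def mid (m : ℕ) : Fin (2 * m + 1) := ⟨m, by omega⟩

/-! ### The spin representation -/

/-- `V_Spin = ⋀ W`. -/
abbrev VSpin (m : ℕ) : Type := ExteriorAlgebra ℂ (W m)

/-- The basis element `w_I = v_{i_1} ∧ ⋯ ∧ v_{i_k}`, `i_1 < ⋯ < i_k`, as part of a basis. -/
def wBasis (m : ℕ) : Module.Basis (Finset (Fin m)) ℂ (VSpin m) :=
  (Pi.basisFun ℂ (Fin m)).ExteriorAlgebra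

/-- The action of vectors on `V_Spin`: `v_i` (`i ≤ m`) acts by exterior multiplication,
`v̄_j` by insertion of the linear form `⟨v̄_j, ·⟩` on `W`, and
`v_{m+1}` by `w_I ↦ (-1)^{|I|} / √2 · w_I`. -/
def gamma (m : ℕ) : V m →ₗ[ℂ] Module.End ℂ (VSpin m) :=
  LinearMap.mul ℂ (VSpin m) ∘ₗ ExteriorAlgebra.ι ℂ ∘ₗ projW m +
  CliffordAlgebra.contractLeft (Q := (0 : QuadraticForm ℂ (W m))) ∘ₗ
    LinearMap.lcomp ℂ ℂ (inclW m) ∘ₗ bil m +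
  (LinearMap.proj (mid m) : V m →ₗ[ℂ] ℂ).smulRight
    ((1 / (Real.sqrt 2 : ℂ)) •
      (CliffordAlgebra.involute (Q := (0 : QuadraticForm ℂ (W m)))).toLinearMap)

theorem eps_rev (m : ℕ) (k : Fin (2 * m + 1)) : eps m k.rev = eps m k := by
  have h : (m + (k.rev : ℕ)) + (m + (k : ℕ)) = 2 * (2 * m) := by
    rw [Fin.val_rev]; omega
  have h2 : ((-1 : ℂ)) ^ (m + (k.rev : ℕ)) * (-1) ^ (m + (k : ℕ)) = 1 := by
    rw [← pow_add, h, pow_mul]; norm_num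
  unfold eps
  rcases neg_one_pow_eq_or ℂ (m + (k : ℕ)) with h3 | h3 <;> rw [h3] at h2 ⊢
  · simpa using h2
  · linear_combination -h2

theorem bil_apply (m : ℕ) (x y : V m) : bil m x y = ∑ k, eps m k * x k * y k.rev := rfl

theorem quad_apply (m : ℕ) (v : V m) : quad m v = 1 / 2 * ∑ k, eps m k * v k * v k.rev := rfl

theorem bil_proj (m : ℕ) (v : V m) :
    bil m v (inclW m (projW m v)) + v (mid m) * v (mid m) / 2 = quad m v := by
  set g : Fin (2 * m + 1) → ℂ := fun k => eps m k * v k * inclW m (projW m v) k.rev with hg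
  have h0 : ∀ k : Fin (2 * m + 1), inclW m (projW m v) k = if (k : ℕ) < m then v k else 0 := by
    intro k
    by_cases h : (k : ℕ) < m
    · simp only [inclW, projW, LinearMap.coe_mk, AddHom.coe_mk, h, dif_pos, if_pos]
      rfl
    · simp [inclW, h]
  have h1 : ∀ k, eps m k * v k * v k.rev =
      g k + g k.rev + if k = mid m then v (mid m) * v (mid m) else 0 := by
    intro k
    simp only [hg, h0, Fin.rev_rev, eps_rev]
    rcases lt_trichotomy (k : ℕ) m with h | h | h
    · have h' : ¬ (k.rev : ℕ) < m := by rw [Fin.val_rev]; omega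
      have h'' : k ≠ mid m := fun e => by rw [e] at h; exact lt_irrefl _ h
      rw [if_neg h', if_pos h, if_neg h'']; ring
    · have hk : k = mid m := Fin.ext h
      subst hk
      have hr : (mid m).rev = mid m := Fin.ext (by rw [Fin.val_rev]; simp only [mid]; omega)
      have he : eps m (mid m) = 1 := by
        simp only [eps, mid]; rw [← two_mul, pow_mul]; norm_num
      rw [hr, he]; simp [mid]
    · have h' : (k.rev : ℕ) < m := by rw [Fin.val_rev]; omega
      have h'' : k ≠ mid m := fun e => by rw [e] at h; exact lt_irrefl _ h
      rw [if_pos h', if_neg (by omega), if_neg h'']; ring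
  have h2 : ∑ k, g (Fin.rev k) = ∑ k, g k := Equiv.sum_comp Fin.revPerm g
  rw [quad_apply, bil_apply, Finset.sum_congr rfl (fun k _ => h1 k), Finset.sum_add_distrib,
    Finset.sum_add_distrib, h2]
  simp only [Finset.sum_ite_eq', Finset.mem_univ, if_true]
  change ∑ k, g k + _ = _
  ring

theorem contractLeft_involute (m : ℕ) (φ : Module.Dual ℂ (W m)) (x : VSpin m) :
    CliffordAlgebra.contractLeft (Q := (0 : QuadraticForm ℂ (W m))) φ
        (CliffordAlgebra.involute (Q := (0 : QuadraticForm ℂ (W m))) x) =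
      -CliffordAlgebra.involute (Q := (0 : QuadraticForm ℂ (W m)))
        (CliffordAlgebra.contractLeft (Q := (0 : QuadraticForm ℂ (W m))) φ x) := by
  induction x using CliffordAlgebra.left_induction with
  | algebraMap r => simp
  | add x y hx hy => simp only [map_add, hx, hy, neg_add]
  | ι_mul x w hx =>
    rw [map_mul, CliffordAlgebra.involute_ι, neg_mul, map_neg,
      CliffordAlgebra.contractLeft_ι_mul, CliffordAlgebra.contractLeft_ι_mul, hx, map_sub,
      map_smul, map_mul, CliffordAlgebra.involute_ι]
    simp

theorem gamma_apply (m : ℕ) (v : V m) (y : VSpin m) : gamma m v y =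
    CliffordAlgebra.ι (0 : QuadraticForm ℂ (W m)) (projW m v) * y +
      CliffordAlgebra.contractLeft (Q := (0 : QuadraticForm ℂ (W m)))
        ((bil m v).comp (inclW m)) y +
      (v (mid m) * (1 / (Real.sqrt 2 : ℂ))) •
        CliffordAlgebra.involute (Q := (0 : QuadraticForm ℂ (W m))) y := by
  simp only [gamma, LinearMap.add_apply, LinearMap.comp_apply, LinearMap.smulRight_apply,
    LinearMap.smul_apply, LinearMap.mul_apply', mul_smul]
  rfl

theorem gamma_sq (m : ℕ) (v : V m) :
    gamma m v * gamma m v = algebraMap ℂ (Module.End ℂ (VSpin m)) (quad m v) := by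
  refine LinearMap.ext fun x => ?_
  rw [Module.algebraMap_end_apply, ← bil_proj]
  have h2 : (Real.sqrt 2 : ℂ) * (Real.sqrt 2 : ℂ) = 2 := by
    rw [← Complex.ofReal_mul, Real.mul_self_sqrt (by norm_num)]; norm_num
  have h3 : (v (mid m) * (1 / (Real.sqrt 2 : ℂ))) * (v (mid m) * (1 / (Real.sqrt 2 : ℂ))) =
      v (mid m) * v (mid m) / 2 := by
    rw [← h2]; ring
  rw [Module.End.mul_apply, gamma_apply, gamma_apply]
  rw [← h3]
  generalize v (mid m) * (1 / (Real.sqrt 2 : ℂ)) = c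
  have h4 : ∀ y : VSpin m, CliffordAlgebra.ι (0 : QuadraticForm ℂ (W m)) (projW m v) *
      (CliffordAlgebra.ι (0 : QuadraticForm ℂ (W m)) (projW m v) * y) = 0 := by
    intro y
    rw [← mul_assoc, CliffordAlgebra.ι_sq_scalar]; simp
  simp only [mul_add, map_add, h4, CliffordAlgebra.contractLeft_ι_mul,
    CliffordAlgebra.contractLeft_contractLeft, map_mul, CliffordAlgebra.involute_ι, map_smul,
    contractLeft_involute, CliffordAlgebra.involute_involute, mul_smul_comm, smul_add, smul_smul,
    add_smul, neg_mul, smul_neg, LinearMap.comp_apply]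
  abel

/-- The action of the Clifford algebra on `V_Spin`. -/
def spinRep (m : ℕ) : Cl m →ₐ[ℂ] Module.End ℂ (VSpin m) :=
  CliffordAlgebra.lift (quad m) ⟨gamma m, gamma_sq m⟩

/-! ### The actions of `Spin(V)` and `so(V)` -/

theorem ι_injective (m : ℕ) : Function.Injective (CliffordAlgebra.ι (quad m)) := by
  intro x y h
  have h1 := congrArg (CliffordAlgebra.equivExterior (quad m)) h
  simp only [CliffordAlgebra.equivExterior, CliffordAlgebra.changeFormEquiv_apply,
    CliffordAlgebra.changeForm_ι] at h1
  exact (ExteriorAlgebra.ι_inj ℂ x y).1 h1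

theorem spin_conj_mem (m : ℕ) (g : spinGroup (quad m)) (v : V m) :
    (g : Cl m) * CliffordAlgebra.ι (quad m) v * star (g : Cl m) ∈
      LinearMap.range (CliffordAlgebra.ι (quad m)) := by
  have h := spinGroup.conjAct_smul_ι_mem_range_ι (x := spinGroup.toUnits g) g.2 v
  rwa [ConjAct.units_smul_def] at h

/-- The action of `g ∈ Spin(V)` on `V`, by `v ↦ g v g⁻¹` in `Cl(V)`. -/
def vecRep (m : ℕ) (g : spinGroup (quad m)) : Module.End ℂ (V m) :=
  (LinearEquiv.ofInjective (CliffordAlgebra.ι (quad m)) (ι_injective m)).symm.toLinearMap ∘ₗ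
    LinearMap.codRestrict (LinearMap.range (CliffordAlgebra.ι (quad m)))
      (LinearMap.mulRight ℂ (star (g : Cl m)) ∘ₗ LinearMap.mulLeft ℂ (g : Cl m) ∘ₗ
        CliffordAlgebra.ι (quad m))
      (spin_conj_mem m g)

theorem ι_vecRep (m : ℕ) (g : spinGroup (quad m)) (v : V m) :
    CliffordAlgebra.ι (quad m) (vecRep m g v) =
      (g : Cl m) * CliffordAlgebra.ι (quad m) v * star (g : Cl m) :=
  congrArg Subtype.val ((LinearEquiv.ofInjective _ (ι_injective m)).apply_symm_apply
    ⟨_, spin_conj_mem m g v⟩)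

/-- The identification `so(V) ≅ ⋀² V ⊂ Cl(V)`: with `v^k = ε(k) v̄_k` the basis dual to `v_k`
for `⟨ , ⟩`, it is `X ↦ ½ ∑_k (X v_k) v^k`; see `soToCl_bracket`. -/
def soToCl (m : ℕ) (X : Module.End ℂ (V m)) : Cl m :=
  (1 / 2 : ℂ) • ∑ k, CliffordAlgebra.ι (quad m) (X (Pi.single k 1)) *
    CliffordAlgebra.ι (quad m) (eps m k • Pi.single k.rev 1)

theorem eps_mul_self (m : ℕ) (k : Fin (2 * m + 1)) : eps m k * eps m k = 1 := by
  unfold eps; rw [← pow_add, ← two_mul, pow_mul]; norm_num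

theorem bil_symm (m : ℕ) (x y : V m) : bil m x y = bil m y x := by
  rw [bil_apply, bil_apply, ← Equiv.sum_comp Fin.revPerm]
  refine Finset.sum_congr rfl fun k _ => ?_
  simp only [Fin.revPerm_apply, Fin.rev_rev, eps_rev]; ring

theorem ι_anticomm (m : ℕ) (x y : V m) :
    CliffordAlgebra.ι (quad m) x * CliffordAlgebra.ι (quad m) y +
      CliffordAlgebra.ι (quad m) y * CliffordAlgebra.ι (quad m) x =
      algebraMap ℂ (Cl m) (bil m x y) := by
  rw [CliffordAlgebra.ι_mul_ι_add_swap]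
  congr 1
  have : ∀ z, quad m z = 1 / 2 * bil m z z := fun z => rfl
  rw [QuadraticMap.polar, this, this, this, LinearMap.map_add₂, map_add, map_add,
    bil_symm m y x]
  ring

theorem bil_dualVec (m : ℕ) (k : Fin (2 * m + 1)) (y : V m) :
    bil m (eps m k • Pi.single k.rev 1) y = y k := by
  rw [bil_apply, Finset.sum_eq_single k.rev]
  · simp [eps_rev, eps_mul_self]
  · intro l _ hl; simp [Pi.single_eq_of_ne hl]
  · simp

theorem soToCl_bracket (m : ℕ) (X : Module.End ℂ (V m))
    (hX : X ∈ skewAdjointLieSubalgebra (bil m)) (y : V m) :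
    soToCl m X * CliffordAlgebra.ι (quad m) y - CliffordAlgebra.ι (quad m) y * soToCl m X =
      CliffordAlgebra.ι (quad m) (X y) := by
  have hX' : ∀ a b, bil m (X a) b = -bil m a (X b) := by
    intro a b
    have h := (LinearMap.mem_skewAdjointSubmodule (B := bil m) X).1 hX a b
    rw [h, Pi.neg_apply, map_neg]
  have key : ∀ a b : V m,
      CliffordAlgebra.ι (quad m) a * CliffordAlgebra.ι (quad m) b * CliffordAlgebra.ι (quad m) y -
      CliffordAlgebra.ι (quad m) y * (CliffordAlgebra.ι (quad m) a * CliffordAlgebra.ι (quad m) b)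
      = CliffordAlgebra.ι (quad m) (bil m b y • a - bil m a y • b) := by
    intro a b
    have h1 := ι_anticomm m b y
    have h2 := ι_anticomm m a y
    rw [map_sub, map_smul, map_smul, Algebra.smul_def, Algebra.smul_def, ← h1, ← h2,
      h1, Algebra.commutes, ← h1]
    noncomm_ring
  have e1 : ∀ z : V m, ∑ k, z k • (Pi.single k 1 : V m) = z := fun z => by
    funext l; simp [Finset.sum_apply, Pi.single_apply]
  have e2 : ∀ z : V m, ∑ k, bil m (Pi.single k 1) z • (eps m k • (Pi.single k.rev 1 : V m)) = z := by
    intro z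
    have h : ∀ k, bil m (Pi.single k 1) z = eps m k * z k.rev := by
      intro k
      rw [bil_apply, Finset.sum_eq_single k]
      · simp
      · intro l _ hl; simp [Pi.single_eq_of_ne hl]
      · simp
    have : ∀ k, bil m (Pi.single k 1) z • (eps m k • (Pi.single k.rev 1 : V m)) =
        z k.rev • Pi.single k.rev 1 := by
      intro k
      rw [h, smul_smul, mul_right_comm, eps_mul_self, one_mul]
    rw [Finset.sum_congr rfl fun k _ => this k]
    exact (Equiv.sum_comp Fin.revPerm fun k => z k • (Pi.single k 1 : V m)).trans (e1 z)
  rw [soToCl, smul_mul_assoc, mul_smul_comm, Finset.sum_mul, Finset.mul_sum, ← smul_sub,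
    ← Finset.sum_sub_distrib, Finset.sum_congr rfl fun k _ => key _ _, ← map_sum, ← map_smul]
  congr 1
  simp only [bil_dualVec, Finset.sum_sub_distrib, hX', neg_smul, Finset.sum_neg_distrib]
  rw [e2, ← Finset.sum_congr rfl fun k _ => map_smul X (y k) (Pi.single k 1), ← map_sum, e1,
    sub_neg_eq_add, ← two_smul ℂ (X y), smul_smul]
  norm_num

/-! ### The projection `π : Sym² V_Spin → ⋀^{m+1} V` -/

/-- `δ : V_Spin → V_Spin*`, `w_λ ↦ (-1)^{|λ|} w*_{PD(λ)}`. Here `λ` is the strict partition with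
parts `m + 1 - i`, `i ∈ I`, and `PD(λ)` corresponds to the complement of `I`. -/
def delta (m : ℕ) : VSpin m →ₗ[ℂ] Module.Dual ℂ (VSpin m) :=
  (wBasis m).constr ℂ fun I => ((-1 : ℂ) ^ (∑ i ∈ I, (m - (i : ℕ)))) • (wBasis m).coord Iᶜ

/-- `Sym² V_Spin → V_Spin ⊗ V_Spin → V_Spin* ⊗ V_Spin = End(V_Spin)`. -/
def symToEnd (m : ℕ) : Sym[ℂ]^2 (VSpin m) →ₗ[ℂ] Module.End ℂ (VSpin m) :=
  dualTensorHom ℂ (VSpin m) (VSpin m) ∘ₗ TensorProduct.map (delta m) LinearMap.id ∘ₗ symToTensor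

/-- The antisymmetrization map `⋀^k V → Cl(V)`,
`u₁ ∧ ⋯ ∧ u_k ↦ (1/k!) ∑_σ sgn(σ) u_{σ(1)} ⋯ u_{σ(k)}`. -/
def antisym (m k : ℕ) : ⋀[ℂ]^k (V m) →ₗ[ℂ] Cl m :=
  exteriorPower.alternatingMapLinearEquiv ((1 / (k.factorial : ℂ)) •
    MultilinearMap.alternatization ((MultilinearMap.mkPiAlgebraFin ℂ k (Cl m)).compLinearMap
      fun _ => CliffordAlgebra.ι (quad m)))

/-- The degrees `0 ≤ k ≤ 2m + 1` of parity `p`. -/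
abbrev Deg (m p : ℕ) : Type := {k : Fin (2 * m + 2) // (k : ℕ) % 2 = p}

/-- `⋀^even V` for `p = 0` and `⋀^odd V` for `p = 1`. -/
abbrev WedgePar (m p : ℕ) : Type := (k : Deg m p) → ⋀[ℂ]^(k : ℕ) (V m)

/-- `κ_+` for `p = 0` and `κ_-` for `p = 1`: antisymmetrization into `Cl(V)`, followed by the
action on `V_Spin`. -/
def kappa (m p : ℕ) : WedgePar m p →ₗ[ℂ] Module.End ℂ (VSpin m) :=
  (spinRep m).toLinearMap ∘ₗ ∑ k : Deg m p, antisym m (k : ℕ) ∘ₗ LinearMap.proj k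

open Classical in
/-- The inverse of the isomorphism `κ_±`. -/
def kappaInv (m p : ℕ) : Module.End ℂ (VSpin m) →ₗ[ℂ] WedgePar m p :=
  if h : Function.Bijective (kappa m p) then
    (LinearEquiv.ofBijective (kappa m p) h).symm.toLinearMap
  else 0

/-- The projection onto `⋀^m V`, which is a summand as `m` has the parity `m % 2`. -/
def prWedge (m : ℕ) : WedgePar m (m % 2) →ₗ[ℂ] ⋀[ℂ]^m (V m) :=
  LinearMap.proj (⟨⟨m, by omega⟩, rfl⟩ : Deg m (m % 2))

/-- `c : ⋀^m V → ⋀^{m+1} V*`, the contraction with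
`(-1)^{m(m+1)/2} v_1* ∧ ⋯ ∧ v_{2m+1}*`. -/
def contraction (m : ℕ) : ⋀[ℂ]^m (V m) →ₗ[ℂ] ⋀[ℂ]^(m + 1) (Module.Dual ℂ (V m)) :=
  contrWith m (m + 1) (by omega)
    ((-1 : ℂ) ^ (m * (m + 1) / 2) • exteriorPower.ιMulti ℂ (2 * m + 1)
      fun k => (LinearMap.proj k : V m →ₗ[ℂ] ℂ))

/-- The isomorphism `V* → V` given by `⟨ , ⟩`, that is `v_i* ↦ ε(i) v̄_i`. -/
def sharp (m : ℕ) : Module.Dual ℂ (V m) →ₗ[ℂ] V m :=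
  ∑ k, (LinearMap.applyₗ (Pi.single k (1 : ℂ)) : Module.Dual ℂ (V m) →ₗ[ℂ] ℂ).smulRight
    (eps m k • Pi.single k.rev 1)

theorem bil_sharp (m : ℕ) (φ : Module.Dual ℂ (V m)) (y : V m) : bil m (sharp m φ) y = φ y := by
  have e1 : ∑ k, y k • (Pi.single k 1 : V m) = y := by
    funext l; simp [Finset.sum_apply, Pi.single_apply]
  conv_rhs => rw [← e1]
  simp only [sharp, LinearMap.sum_apply, LinearMap.smulRight_apply, map_sum, map_smul]
  refine Finset.sum_congr rfl fun k _ => ?_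
  rw [← map_smul, LinearMap.smul_apply, bil_dualVec, LinearMap.applyₗ_apply_apply, smul_eq_mul,
    smul_eq_mul, mul_comm]

/-- `d : ⋀^{m+1} V* → ⋀^{m+1} V`. -/
def dualityMap (m : ℕ) : ⋀[ℂ]^(m + 1) (Module.Dual ℂ (V m)) →ₗ[ℂ] ⋀[ℂ]^(m + 1) (V m) :=
  exteriorPower.map (m + 1) (sharp m)

/-- `π : Sym² V_Spin → ⋀^{m+1} V`. -/
def projection (m : ℕ) : Sym[ℂ]^2 (VSpin m) →ₗ[ℂ] ⋀[ℂ]^(m + 1) (V m) :=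
  dualityMap m ∘ₗ contraction m ∘ₗ prWedge m ∘ₗ kappaInv m (m % 2) ∘ₗ symToEnd m

/-! ### Partitions and the elements `D_(j)`, `N_(j)` -/

/-- `w_λ` for a list `λ` of parts between `1` and `m`; it is `0` unless `λ` is a strict partition.
The strict partition `λ` stands for the set `I` of all `i` such that `m + 1 - i` is a part. -/
def wPart (m : ℕ) (L : List ℕ) : VSpin m :=
  if L.Pairwise (· > ·) then
    wBasis m (Finset.univ.filter fun i : Fin m => m - (i : ℕ) ∈ L)
  else 0

/-- The number of boxes of row `i` of `ρ_l` (for `p = 0`) or of `ρ_{l,+}` (for `p = 1`). -/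
def row (p l i : ℕ) : ℕ := l + 1 - i + if i = 1 then p else 0

/-- `ρ_l^J` (`p = 0`) and `ρ_{l,+}^J` (`p = 1`): the staircase with the rows `i ∈ J` removed. -/
def rho (p l : ℕ) (J : Finset ℕ) : List ℕ :=
  ((List.range' 1 l).filter fun i => i ∉ J).map (row p l)

/-- `μ_l^J` (`p = 0`) and `μ_{l,+}^J` (`p = 1`): the rows `m, m - 1, …, m + 1 - l` followed by the
rows `i ∈ J` of the staircase. -/
def mu (m p l : ℕ) (J : Finset ℕ) : List ℕ :=
  (List.range' 1 l).map (fun i => m + 1 - i) ++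
    ((List.range' 1 l).filter fun i => i ∈ J).map (row p l)

/-- The sum `∑_J (-1)^{s(J)} w_{ρ^J} w_{μ^J}` over `J ⊂ {1, …, l}`, with
`s(J) = ∑_{i ∈ J} (l + 1 - i)`. -/
def quadElt (m p l : ℕ) : Sym[ℂ]^2 (VSpin m) :=
  ∑ J ∈ (Finset.Icc 1 l).powerset, ((-1 : ℂ) ^ (∑ i ∈ J, (l + 1 - i))) •
    symMul (wPart m (rho p l J)) (wPart m (mu m p l J))

/-- The denominator element `D_(j)`. -/
def denomElt (m j : ℕ) : Sym[ℂ]^2 (VSpin m) := quadElt m 0 (m + 1 - j)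

/-- The numerator element `N_(j)`. -/
def numerElt (m j : ℕ) : Sym[ℂ]^2 (VSpin m) := quadElt m 1 (m + 1 - j)

/-! ### Elements of the exterior powers and of the Clifford algebra -/

/-- `v_j ∧ v_{j+1} ∧ ⋯ ∧ v_{j+m}`. -/
def vWedge (m j : ℕ) : ⋀[ℂ]^(m + 1) (V m) :=
  exteriorPower.ιMulti ℂ (m + 1) fun k => vec m (j + k)

/-- `v_{j-1} ∧ v_{j+1} ∧ ⋯ ∧ v_{j+m}`. -/
def vWedgePlus (m j : ℕ) : ⋀[ℂ]^(m + 1) (V m) :=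
  exteriorPower.ιMulti ℂ (m + 1) fun k => if (k : ℕ) = 0 then vec m (j - 1) else vec m (j + k)

/-- `v_1 ∧ ⋯ ∧ v_{m+1-j} ∧ v_{2m+3-j} ∧ ⋯ ∧ v_{2m+1}`. -/
def vOuter (m j : ℕ) : ⋀[ℂ]^m (V m) :=
  exteriorPower.ιMulti ℂ m fun k =>
    if (k : ℕ) + j < m + 1 then vec m (k + 1) else vec m (m + 2 + k)

/-- The product `v_{i_1} ⋯ v_{i_r}` in `Cl(V)` for `S = {i_1 < ⋯ < i_r}`. -/
def clMonomial (m : ℕ) (S : Finset ℕ) : Cl m :=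
  ((S.sort (· ≤ ·)).map fun i => CliffordAlgebra.ι (quad m) (vec m i)).prod

/-- The element
`(-1)^{m(m+1)/2} / 2 * (2 v_{1,…,m+1-j,2m+3-j,…,2m+1} + ∑_I ∏_{l ∉ I} (-1)^l v_{I ∪ T ∪ Ī})`
of `Cl(V)`. The sum is over the proper subsets `I` of `{1, …, k}`, where `k = min (m+1-j) (j-1)`;
`Ī = {2m+2-i | i ∈ I}`, and `T` is `{2m+3-j, …, m+j}` if `j > (m+1)/2` and `{j, …, m+1-j}`
otherwise. -/
def clDenom (m j : ℕ) : Cl m :=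
  ((-1 : ℂ) ^ (m * (m + 1) / 2) / 2) •
    ((2 : ℂ) • clMonomial m (Finset.Icc 1 (m + 1 - j) ∪ Finset.Icc (2 * m + 3 - j) (2 * m + 1)) +
      ∑ I ∈ (Finset.Icc 1 (min (m + 1 - j) (j - 1))).ssubsets,
        (∏ l ∈ Finset.Icc 1 (min (m + 1 - j) (j - 1)) \ I, (-1 : ℂ) ^ l) •
          clMonomial m (I ∪
            (if m + 1 < 2 * j then Finset.Icc (2 * m + 3 - j) (m + j) else Finset.Icc j (m + 1 - j)) ∪
            I.image fun i => 2 * m + 2 - i))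

end SpinProj

end

open SpinProj

open scoped TensorProduct
noncomputable section
-- As a vector space Cl(V) is ⋀V, through an isomorphism `toExt` with `toExt (v x) = v ∧ toExt x + ½
-- i_{⟨v,·⟩} (toExt x)`. Antisymmetrization inverts it degree by degree (`toExt_antisym`). Hence,
-- for y in Cl(V) of the parity of m, pr κ⁻¹ of the action of y is the degree-m part of `toExt y`
-- (`prWedge_kappaInv_spinRep`). That κ is bijective follows by counting dimensions once it is
-- surjective: the vacuum projection, creation and annihilation operators give all matrix units, and
-- the even and odd parts of Cl(V) have the same image because √2 v_{m+1} acts as an even element,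
-- the operator (-1)^{|I|}.
--
-- For the form δ every vector is self-adjoint up to the sign (-1)^m (`delta_gamma`). Therefore ι
-- intertwines the actions of Spin(V) and so(V) with conjugation and commutator, and its image
-- contains the antisymmetrized ⋀^m V (`exists_symToEnd_eq_antisym`), which makes π surjective. The
-- composite d ∘ c contracts a volume element through ⟨ , ⟩ (`coe_dualityMap_contraction`). It is
-- equivariant since the form is invariant and elements of top degree commute with the even part of
-- Cl(V) (`commute_of_even`).
--
-- For D_(j), let n_i be the occupation number of i. Since v_i v̄_i acts as ±n_i, the monomial v_{I
-- ∪ T ∪ Ī} acts as v_T times a product of ±n_i. One copy of the leading monomial completes the sum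
-- to all I ⊂ {1,…,k}, and this sum factors into ∏ (-1)^i (1 - n_i); the other copy gives ∏
-- (-1)^{i+1} n_i. Up to sign these are the projections to the w_C with C disjoint from {1,…,k},
-- respectively containing it, and they match the two halves of the symmetrization in ι(D_(j))
-- (`spinRep_clDenom_eq`). Proper subsets I give monomials with fewer than m factors, so only the
-- leading one is seen in ⋀^m V. Contracting the volume element by it leaves m + 1 consecutive
-- vectors, v_j ∧ ⋯ ∧ v_{j+m}.
--
-- Finally N_(j) = X · D_(j) for an element X of so(V) that sends v_j to v_{j-1}
-- (`symDer_lower_denomElt`), so π(N_(j)) follows from π(D_(j)) by equivariance.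
namespace SpinProj

/-! ### Contractions of exterior algebras, by linear forms and through bilinear forms -/

section General

variable {M N : Type} [AddCommGroup M] [Module ℂ M] [AddCommGroup N] [Module ℂ N]

/-- Contraction of `⋀ M` by a linear form. -/
abbrev ctr (φ : Module.Dual ℂ M) : ExteriorAlgebra ℂ M →ₗ[ℂ] ExteriorAlgebra ℂ M :=
  CliffordAlgebra.contractLeft (Q := (0 : QuadraticForm ℂ M)) φ

theorem ctr_ι_mul (φ : Module.Dual ℂ M) (v : M) (x : ExteriorAlgebra ℂ M) :
    ctr φ (ExteriorAlgebra.ι ℂ v * x) = φ v • x - ExteriorAlgebra.ι ℂ v * ctr φ x :=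
  CliffordAlgebra.contractLeft_ι_mul (Q := (0 : QuadraticForm ℂ M)) φ v x

theorem ctr_algebraMap (φ : Module.Dual ℂ M) (r : ℂ) :
    ctr φ (algebraMap ℂ (ExteriorAlgebra ℂ M) r) = 0 :=
  CliffordAlgebra.contractLeft_algebraMap (0 : QuadraticForm ℂ M) φ r

theorem ctr_one (φ : Module.Dual ℂ M) : ctr φ (1 : ExteriorAlgebra ℂ M) = 0 :=
  CliffordAlgebra.contractLeft_one (0 : QuadraticForm ℂ M) φ

theorem ctr_neg (φ : Module.Dual ℂ M) (x : ExteriorAlgebra ℂ M) : ctr (-φ) x = -ctr φ x := by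
  unfold ctr; rw [map_neg, LinearMap.neg_apply]

theorem ctr_smul (c : ℂ) (φ : Module.Dual ℂ M) (x : ExteriorAlgebra ℂ M) :
    ctr (c • φ) x = c • ctr φ x := by
  unfold ctr; rw [map_smul, LinearMap.smul_apply]

theorem ext_induction {C : ExteriorAlgebra ℂ M → Prop}
    (algebraMap : ∀ r, C (algebraMap ℂ (ExteriorAlgebra ℂ M) r))
    (add : ∀ x y, C x → C y → C (x + y))
    (ι_mul : ∀ x (v : M), C x → C (ExteriorAlgebra.ι ℂ v * x)) (x : ExteriorAlgebra ℂ M) : C x :=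
  CliffordAlgebra.left_induction (Q := (0 : QuadraticForm ℂ M)) algebraMap add ι_mul x

theorem ctr_map (f : M →ₗ[ℂ] N) (φ : Module.Dual ℂ N) (x : ExteriorAlgebra ℂ M) :
    ctr φ (ExteriorAlgebra.map f x) = ExteriorAlgebra.map f (ctr (φ ∘ₗ f) x) := by
  induction x using ext_induction with
  | algebraMap r => rw [AlgHom.commutes, ctr_algebraMap, ctr_algebraMap, map_zero]
  | add x y hx hy => simp only [map_add, hx, hy]
  | ι_mul x v hx =>
    rw [map_mul, ExteriorAlgebra.map_apply_ι, ctr_ι_mul, ctr_ι_mul, hx, map_sub, map_smul, map_mul,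
      ExteriorAlgebra.map_apply_ι, LinearMap.comp_apply]

/-! ### Derivations of the exterior algebra -/

section Derivation

variable {κ : Type} [Fintype κ] (b : Module.Basis κ ℂ M)

/-- The derivation of `⋀ M` extending the endomorphism `T`. -/
def derE (T : Module.End ℂ M) : ExteriorAlgebra ℂ M →ₗ[ℂ] ExteriorAlgebra ℂ M :=
  ∑ k, LinearMap.mulLeft ℂ (ExteriorAlgebra.ι ℂ (T (b k))) ∘ₗ ctr (b.coord k)

theorem derE_apply (T : Module.End ℂ M) (x : ExteriorAlgebra ℂ M) :
    derE b T x = ∑ k, ExteriorAlgebra.ι ℂ (T (b k)) * ctr (b.coord k) x := by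
  simp [derE, LinearMap.sum_apply]

theorem derE_algebraMap (T : Module.End ℂ M) (r : ℂ) :
    derE b T (algebraMap ℂ (ExteriorAlgebra ℂ M) r) = 0 := by
  simp only [derE_apply, ctr_algebraMap, mul_zero, Finset.sum_const_zero]

theorem ι_mul_ι_mul_comm (u v : M) (x : ExteriorAlgebra ℂ M) :
    ExteriorAlgebra.ι ℂ u * (ExteriorAlgebra.ι ℂ v * x) =
      -(ExteriorAlgebra.ι ℂ v * (ExteriorAlgebra.ι ℂ u * x)) := by
  rw [← mul_assoc, ← mul_assoc, ← neg_mul, eq_neg_of_add_eq_zero_left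
    (ExteriorAlgebra.ι_add_mul_swap u v)]

theorem derE_ι_mul (T : Module.End ℂ M) (v : M) (x : ExteriorAlgebra ℂ M) :
    derE b T (ExteriorAlgebra.ι ℂ v * x) =
      ExteriorAlgebra.ι ℂ (T v) * x + ExteriorAlgebra.ι ℂ v * derE b T x := by
  have h : T v = ∑ k, b.coord k v • T (b k) := by
    conv_lhs => rw [← b.sum_repr v, map_sum]
    simp
  rw [h, map_sum, Finset.sum_mul, derE_apply, derE_apply, Finset.mul_sum,
    ← Finset.sum_add_distrib]
  refine Finset.sum_congr rfl fun k _ => ?_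
  rw [ctr_ι_mul, mul_sub, ι_mul_ι_mul_comm (T (b k)) v, sub_neg_eq_add, map_smul, mul_smul_comm,
    smul_mul_assoc]

/-- The commutator of a contraction with a derivation is again a contraction. All infinitesimal
equivariance statements rest on this rule. -/
theorem ctr_derE (T : Module.End ℂ M) (φ : Module.Dual ℂ M) (x : ExteriorAlgebra ℂ M) :
    ctr φ (derE b T x) = ctr (φ ∘ₗ T) x + derE b T (ctr φ x) := by
  induction x using ext_induction with
  | algebraMap r => simp only [derE_algebraMap, ctr_algebraMap, map_zero, add_zero]
  | add x y hx hy => simp only [map_add, hx, hy]; abel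
  | ι_mul x v hx =>
    rw [derE_ι_mul, map_add, ctr_ι_mul, ctr_ι_mul, ctr_ι_mul, ctr_ι_mul, hx, map_sub, map_smul,
      derE_ι_mul, LinearMap.comp_apply, mul_add]
    abel

theorem derE_ιMulti (T : Module.End ℂ M) (n : ℕ) (u : Fin n → M) :
    derE b T (ExteriorAlgebra.ιMulti ℂ n u) =
      ∑ i, ExteriorAlgebra.ιMulti ℂ n (Function.update u i (T (u i))) := by
  induction n with
  | zero =>
    rw [ExteriorAlgebra.ιMulti_zero_apply, ← map_one (algebraMap ℂ _), derE_algebraMap]; simp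
  | succ n ih =>
    rw [ExteriorAlgebra.ιMulti_succ_apply, derE_ι_mul, ih, Fin.sum_univ_succ,
      ExteriorAlgebra.ιMulti_succ_apply, Finset.mul_sum]
    congr 1
    refine Finset.sum_congr rfl fun i _ => ?_
    rw [ExteriorAlgebra.ιMulti_succ_apply, Function.update_of_ne (Fin.succ_ne_zero i).symm]
    congr 2
    funext k
    simp only [Matrix.vecTail, Function.comp_apply, Function.update_apply, Fin.succ_inj]

theorem extDer_ιMulti (n : ℕ) (T : Module.End ℂ M) (u : Fin n → M) :
    extDer n T (exteriorPower.ιMulti ℂ n u) =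
      ∑ i, exteriorPower.ιMulti ℂ n (Function.update u i (T (u i))) := by
  rw [extDer, exteriorPower.alternatingMapLinearEquiv_apply_ιMulti]
  change (∑ i : Fin n, (exteriorPower.ιMulti ℂ n).toMultilinearMap.compLinearMap
    (fun k => if k = i then T else LinearMap.id) : MultilinearMap ℂ (fun _ => M) _) u = _
  rw [sum_apply]
  refine Finset.sum_congr rfl fun i _ => ?_
  rw [MultilinearMap.compLinearMap_apply]
  change exteriorPower.ιMulti ℂ n _ = _
  congr 1
  funext k
  by_cases h : k = i
  · subst h; simp
  · simp [h]

theorem coe_extDer (n : ℕ) (T : Module.End ℂ M) (x : ⋀[ℂ]^n M) :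
    (extDer n T x : ExteriorAlgebra ℂ M) = derE b T x := by
  suffices h : (⋀[ℂ]^n M).subtype ∘ₗ extDer n T = derE b T ∘ₗ (⋀[ℂ]^n M).subtype from
    LinearMap.congr_fun h x
  apply exteriorPower.linearMap_ext
  ext u
  simp only [LinearMap.compAlternatingMap_apply, LinearMap.comp_apply, Submodule.subtype_apply,
    extDer_ιMulti, exteriorPower.ιMulti_apply_coe, derE_ιMulti, AddSubmonoidClass.coe_finsetSum]

theorem mem_exteriorPower_ι_mul {n : ℕ} {x : ExteriorAlgebra ℂ M} (hx : x ∈ ⋀[ℂ]^n M) (v : M) :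
    ExteriorAlgebra.ι ℂ v * x ∈ ⋀[ℂ]^(n + 1) M := by
  change _ ∈ LinearMap.range (ExteriorAlgebra.ι ℂ) ^ (n + 1)
  rw [pow_succ']
  exact Submodule.mul_mem_mul ⟨v, rfl⟩ hx

include b in
theorem exteriorPower_eq_zero_of_card_lt {n : ℕ} (h : Fintype.card κ < n)
    {x : ExteriorAlgebra ℂ M} (hx : x ∈ ⋀[ℂ]^n M) : x = 0 := by
  have := Module.Finite.of_basis b
  have h1 : Module.finrank ℂ (⋀[ℂ]^n M) = 0 := by
    rw [exteriorPower.finrank_eq, Module.finrank_eq_card_basis b, Nat.choose_eq_zero_of_lt h]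
  have := Module.finrank_zero_iff.1 h1
  exact congrArg Subtype.val (Subsingleton.elim (⟨x, hx⟩ : ⋀[ℂ]^n M) 0)

/-- On the top power a derivation is its trace: T b_k ∧ x vanishes for degree reasons, and
contracting this relation with the k-th coordinate form turns T b_k ∧ i_k x into the k-th diagonal
entry times x. -/
theorem derE_of_mem_top (T : Module.End ℂ M) {x : ExteriorAlgebra ℂ M}
    (hx : x ∈ ⋀[ℂ]^(Fintype.card κ) M) :
    derE b T x = (∑ k, b.coord k (T (b k))) • x := by
  rw [derE_apply, Finset.sum_smul]
  refine Finset.sum_congr rfl fun k _ => ?_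
  have h : ExteriorAlgebra.ι ℂ (T (b k)) * x = 0 :=
    exteriorPower_eq_zero_of_card_lt b (Nat.lt_succ_self _) (mem_exteriorPower_ι_mul hx _)
  have h2 := ctr_ι_mul (b.coord k) (T (b k)) x
  rw [h, map_zero] at h2
  exact (sub_eq_zero.1 h2.symm).symm

end Derivation

/-- Contraction of `⋀ M` by `⋀ M` through a bilinear form `B`:
`u₁ ∧ ⋯ ∧ u_k` acts as `i_{B(u_k)} ⋯ i_{B(u₁)}`. -/
def formContr (B : LinearMap.BilinForm ℂ M) :
    ExteriorAlgebra ℂ M →ₐ[ℂ] (Module.End ℂ (ExteriorAlgebra ℂ M))ᵐᵒᵖ :=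
  ExteriorAlgebra.lift ℂ
    ⟨(MulOpposite.opLinearEquiv ℂ).toLinearMap ∘ₗ
      (CliffordAlgebra.contractLeft (Q := (0 : QuadraticForm ℂ M))) ∘ₗ B, fun v => by
      apply MulOpposite.unop_injective
      refine LinearMap.ext fun x => ?_
      exact CliffordAlgebra.contractLeft_contractLeft (Q := (0 : QuadraticForm ℂ M)) (B v) x⟩

theorem formContr_ι_mul (B : LinearMap.BilinForm ℂ M) (v : M) (x ω : ExteriorAlgebra ℂ M) :
    (formContr B (ExteriorAlgebra.ι ℂ v * x)).unop ω = (formContr B x).unop (ctr (B v) ω) := by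
  rw [map_mul, formContr, ExteriorAlgebra.lift_ι_apply]
  rfl

theorem formContr_algebraMap (B : LinearMap.BilinForm ℂ M) (r : ℂ) (ω : ExteriorAlgebra ℂ M) :
    (formContr B (algebraMap ℂ _ r)).unop ω = r • ω := by
  rw [AlgHom.commutes]; rfl

theorem formContr_add (B : LinearMap.BilinForm ℂ M) (x y ω : ExteriorAlgebra ℂ M) :
    (formContr B (x + y)).unop ω = (formContr B x).unop ω + (formContr B y).unop ω := by
  rw [map_add]; rfl

/-- Contraction is natural for isometries. The infinitesimal counterpart, for skew-adjoint T, is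
`formContr_derE`. -/
theorem formContr_map (B : LinearMap.BilinForm ℂ M) (T : Module.End ℂ M)
    (hT : ∀ u v, B (T u) (T v) = B u v) (x ω : ExteriorAlgebra ℂ M) :
    (formContr B (ExteriorAlgebra.map T x)).unop (ExteriorAlgebra.map T ω) =
      ExteriorAlgebra.map T ((formContr B x).unop ω) := by
  induction x using ext_induction generalizing ω with
  | algebraMap r => rw [AlgHom.commutes, formContr_algebraMap, formContr_algebraMap, map_smul]
  | add x y hx hy => rw [map_add, formContr_add, formContr_add, hx, hy, map_add]
  | ι_mul x v hx =>
    have h : B (T v) ∘ₗ T = B v := LinearMap.ext fun w => hT v w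
    rw [map_mul, ExteriorAlgebra.map_apply_ι, formContr_ι_mul, formContr_ι_mul, ctr_map, h, hx]

theorem formContr_derE {κ : Type} [Fintype κ] (b : Module.Basis κ ℂ M)
    (B : LinearMap.BilinForm ℂ M) (T : Module.End ℂ M)
    (hT : ∀ u v, B (T u) v = -B u (T v)) (x ω : ExteriorAlgebra ℂ M) :
    (formContr B (derE b T x)).unop ω =
      derE b T ((formContr B x).unop ω) - (formContr B x).unop (derE b T ω) := by
  induction x using ext_induction generalizing ω with
  | algebraMap r =>
    rw [derE_algebraMap, map_zero, formContr_algebraMap, formContr_algebraMap, map_smul, sub_self]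
    rfl
  | add x y hx hy => rw [map_add, formContr_add, formContr_add, formContr_add, hx, hy, map_add]; abel
  | ι_mul x v hx =>
    have h : B (T v) = -(B v ∘ₗ T) := LinearMap.ext fun w => hT v w
    rw [derE_ι_mul, formContr_add, formContr_ι_mul, formContr_ι_mul, formContr_ι_mul,
      formContr_ι_mul, hx, ctr_derE, h, ctr_neg, map_neg, map_add]
    abel

/-- Carries contraction of forms on M into contraction inside ⋀ M, whenever `s` represents linear
forms through `B`. It makes d ∘ c an operation on ⋀ V alone. -/
theorem map_contr (B : LinearMap.BilinForm ℂ M) (s : Module.Dual ℂ M →ₗ[ℂ] M)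
    (hs : ∀ v φ, B v (s φ) = φ v) (x : ExteriorAlgebra ℂ M)
    (ω : ExteriorAlgebra ℂ (Module.Dual ℂ M)) :
    ExteriorAlgebra.map s ((contr x).unop ω) =
      (formContr B x).unop (ExteriorAlgebra.map s ω) := by
  induction x using ext_induction generalizing ω with
  | algebraMap r =>
    rw [formContr_algebraMap, AlgHom.commutes, ← map_smul]; rfl
  | add x y hx hy => rw [map_add, formContr_add, ← hx, ← hy, MulOpposite.unop_add, LinearMap.add_apply, map_add]
  | ι_mul x v hx =>
    have h : B v ∘ₗ s = Module.Dual.eval ℂ M v := LinearMap.ext fun φ => hs v φ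
    rw [contr_ι_mul, formContr_ι_mul, hx, ctr_map, h]

theorem coe_exteriorPower_map (n : ℕ) (f : M →ₗ[ℂ] N) (x : ⋀[ℂ]^n M) :
    (exteriorPower.map n f x : ExteriorAlgebra ℂ N) = ExteriorAlgebra.map f x := by
  suffices h : (⋀[ℂ]^n N).subtype ∘ₗ exteriorPower.map n f =
      (ExteriorAlgebra.map f).toLinearMap ∘ₗ (⋀[ℂ]^n M).subtype from LinearMap.congr_fun h x
  apply exteriorPower.linearMap_ext
  ext u
  simp only [LinearMap.compAlternatingMap_apply, LinearMap.comp_apply, Submodule.subtype_apply,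
    exteriorPower.map_apply_ιMulti, exteriorPower.ιMulti_apply_coe, AlgHom.toLinearMap_apply,
    ExteriorAlgebra.map_apply_ιMulti]

end General


/-! ### The grading of the exterior algebra -/

section Grading

variable {M : Type} [AddCommGroup M] [Module ℂ M]

/-- The projection of `⋀ M` onto `⋀^k M`. -/
def extProj (k : ℕ) : ExteriorAlgebra ℂ M →ₗ[ℂ] ⋀[ℂ]^k M :=
  DirectSum.component ℂ ℕ (fun i => ⋀[ℂ]^i M) k ∘ₗ
    (DirectSum.decomposeLinearEquiv (fun i => ⋀[ℂ]^i M)).toLinearMap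

theorem extProj_of_mem {k : ℕ} {x : ExteriorAlgebra ℂ M} (hx : x ∈ ⋀[ℂ]^k M) :
    (extProj k x : ExteriorAlgebra ℂ M) = x :=
  DirectSum.decompose_of_mem_same (fun i => ⋀[ℂ]^i M) hx

theorem extProj_of_mem_ne {k l : ℕ} {x : ExteriorAlgebra ℂ M} (hx : x ∈ ⋀[ℂ]^k M) (h : k ≠ l) :
    extProj l x = 0 :=
  Subtype.ext (DirectSum.decompose_of_mem_ne (fun i => ⋀[ℂ]^i M) hx h)

theorem ι_mem_exteriorPower_one (v : M) : ExteriorAlgebra.ι ℂ v ∈ ⋀[ℂ]^1 M := by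
  change _ ∈ LinearMap.range (ExteriorAlgebra.ι ℂ) ^ 1
  rw [pow_one]; exact ⟨v, rfl⟩

theorem extProj_succ_ι_mul (k : ℕ) (v : M) (x : ExteriorAlgebra ℂ M) :
    (extProj (k + 1) (ExteriorAlgebra.ι ℂ v * x) : ExteriorAlgebra ℂ M) =
      ExteriorAlgebra.ι ℂ v * extProj k x := by
  rw [add_comm k 1]
  exact DirectSum.coe_decompose_mul_add_of_left_mem (fun i => ⋀[ℂ]^i M) (ι_mem_exteriorPower_one v)

theorem extProj_zero_ι_mul (v : M) (x : ExteriorAlgebra ℂ M) :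
    extProj 0 (ExteriorAlgebra.ι ℂ v * x) = 0 :=
  Subtype.ext (DirectSum.coe_decompose_mul_of_left_mem_of_not_le (fun i => ⋀[ℂ]^i M)
    (ι_mem_exteriorPower_one v) (by omega))

theorem extProj_ctr (k : ℕ) (φ : Module.Dual ℂ M) (x : ExteriorAlgebra ℂ M) :
    (extProj k (ctr φ x) : ExteriorAlgebra ℂ M) = ctr φ (extProj (k + 1) x) := by
  induction x using ext_induction generalizing k with
  | algebraMap r =>
    have h : algebraMap ℂ (ExteriorAlgebra ℂ M) r ∈ ⋀[ℂ]^0 M := by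
      change _ ∈ LinearMap.range (ExteriorAlgebra.ι ℂ) ^ 0
      rw [pow_zero]; exact Submodule.algebraMap_mem r
    rw [ctr_algebraMap, extProj_of_mem_ne h (by omega), map_zero]; simp
  | add x y hx hy => simp only [map_add, Submodule.coe_add, hx, hy]
  | ι_mul x v hx =>
    rw [ctr_ι_mul, map_sub, map_smul, extProj_succ_ι_mul, ctr_ι_mul, Submodule.coe_sub,
      Submodule.coe_smul]
    congr 1
    cases k with
    | zero =>
      rw [extProj_zero_ι_mul]
      -- Elements of degree zero are scalars, and contraction kills scalars.
      have h : ctr φ (extProj 0 x : ExteriorAlgebra ℂ M) = 0 := by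
        obtain ⟨r, hr⟩ : ∃ r, algebraMap ℂ (ExteriorAlgebra ℂ M) r = extProj 0 x := by
          have h := (extProj 0 x).2
          change _ ∈ LinearMap.range (ExteriorAlgebra.ι ℂ) ^ 0 at h
          rwa [pow_zero, Submodule.mem_one] at h
        rw [← hr, ctr_algebraMap]
      rw [h, mul_zero]; rfl
    | succ k => rw [extProj_succ_ι_mul, hx]

open Classical in
theorem sum_extProj (n : ℕ) (x : ExteriorAlgebra ℂ M) (h : ∀ k, n ≤ k → extProj k x = 0) :
    ∑ k ∈ Finset.range n, (extProj k x : ExteriorAlgebra ℂ M) = x := by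
  conv_rhs => rw [← DirectSum.sum_support_decompose (fun i => ⋀[ℂ]^i M) x]
  symm
  refine Finset.sum_subset (fun k hk => ?_) (fun k _ hk => ?_)
  · by_contra hn
    exact (DFinsupp.mem_support_iff.1 hk) (h k (by simpa using hn))
  · by_contra hn
    exact hk (DFinsupp.mem_support_iff.2 fun e => hn (congrArg Subtype.val e))

end Grading

/-! ### The Clifford algebra and the exterior algebra -/

/-- The linear isomorphism of the Clifford algebra with the exterior algebra. -/
def toExt (m : ℕ) : Cl m ≃ₗ[ℂ] ExteriorAlgebra ℂ (V m) := CliffordAlgebra.equivExterior (quad m)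

theorem toExt_algebraMap (m : ℕ) (r : ℂ) :
    toExt m (algebraMap ℂ (Cl m) r) = algebraMap ℂ _ r :=
  CliffordAlgebra.changeForm_algebraMap
    (CliffordAlgebra.changeForm.associated_neg_proof (Q := quad m)) r

theorem toExt_one (m : ℕ) : toExt m 1 = 1 :=
  CliffordAlgebra.changeForm_one (CliffordAlgebra.changeForm.associated_neg_proof (Q := quad m))

/-- Chevalley's formula. The factor ½ appears because the bilinear form of `quad` is Φ = ½⟨ , ⟩. -/
theorem toExt_ι_mul (m : ℕ) (v : V m) (x : Cl m) :
    toExt m (CliffordAlgebra.ι (quad m) v * x) =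
      ExteriorAlgebra.ι ℂ v * toExt m x + (1 / 2 : ℂ) • ctr (bil m v) (toExt m x) := by
  have h := CliffordAlgebra.changeForm_ι_mul
    (CliffordAlgebra.changeForm.associated_neg_proof (Q := quad m)) v x
  have h2 : QuadraticMap.associated (R := ℂ) (-quad m) v = -((1 / 2 : ℂ) • bil m v) := by
    rw [map_neg, quad, map_smul, QuadraticMap.associated_left_inverse ℂ (bil_symm m)]
    rfl
  refine h.trans ?_
  rw [h2]
  change _ - ctr _ _ = _
  rw [ctr_neg, ctr_smul, sub_neg_eq_add]
  rfl

/-- For pairwise orthogonal vectors every contraction term of Chevalley's formula vanishes. -/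
theorem toExt_prod_of_isOrtho (m n : ℕ) (u : Fin n → V m)
    (hu : ∀ i j, i ≠ j → bil m (u i) (u j) = 0) :
    toExt m (List.ofFn fun i => CliffordAlgebra.ι (quad m) (u i)).prod =
      ExteriorAlgebra.ιMulti ℂ n u := by
  have key : ∀ (n : ℕ) (φ : Module.Dual ℂ (V m)) (u : Fin n → V m), (∀ i, φ (u i) = 0) →
      ctr φ (ExteriorAlgebra.ιMulti ℂ n u) = 0 := by
    intro n φ
    induction n with
    | zero => intro u _; rw [ExteriorAlgebra.ιMulti_zero_apply, ctr_one]
    | succ n ih =>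
      intro u h
      rw [ExteriorAlgebra.ιMulti_succ_apply, ctr_ι_mul, h, ih (Matrix.vecTail u) fun i => h i.succ]
      simp
  induction n with
  | zero => simp [toExt_one]
  | succ n ih =>
    rw [List.ofFn_succ, List.prod_cons, toExt_ι_mul,
      ih (fun i => u i.succ) fun i j h => hu _ _ fun e => h (Fin.succ_injective _ e),
      ExteriorAlgebra.ιMulti_succ_apply, key n _ _ fun i => hu 0 i.succ (Fin.succ_ne_zero i).symm,
      smul_zero, add_zero]
    rfl

theorem antisym_ιMulti (m k : ℕ) (u : Fin k → V m) :
    antisym m k (exteriorPower.ιMulti ℂ k u) = (1 / (k.factorial : ℂ)) •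
      ∑ σ : Equiv.Perm (Fin k), (Equiv.Perm.sign σ : ℤˣ) •
        (List.ofFn fun i => CliffordAlgebra.ι (quad m) (u (σ i))).prod := by
  rw [antisym, exteriorPower.alternatingMapLinearEquiv_apply_ιMulti, AlternatingMap.smul_apply,
    MultilinearMap.alternatization_apply]
  rfl

/-- Both sides are alternating in the vectors, so an orthogonal basis suffices. There each of the k!
signed products is already the same wedge, and the factor 1/k! averages them. -/
theorem toExt_antisym (m k : ℕ) (x : ⋀[ℂ]^k (V m)) :
    toExt m (antisym m k x) = x := by
  suffices h : (toExt m).toLinearMap ∘ₗ antisym m k = (⋀[ℂ]^k (V m)).subtype from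
    LinearMap.congr_fun h x
  obtain ⟨b, hb⟩ := LinearMap.BilinForm.exists_orthogonal_basis (B := bil m) ⟨bil_symm m⟩
  apply exteriorPower.linearMap_ext
  refine b.ext_alternating fun v hv => ?_
  have ho : ∀ σ : Equiv.Perm (Fin k),
      toExt m (List.ofFn fun i => CliffordAlgebra.ι (quad m) (b (v (σ i)))).prod =
        (Equiv.Perm.sign σ : ℤˣ) • ExteriorAlgebra.ιMulti ℂ k (fun i => b (v i)) := by
    intro σ
    rw [toExt_prod_of_isOrtho m k (fun i => b (v (σ i)))
      fun i j h => hb fun e => h (σ.injective (hv e))]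
    exact AlternatingMap.map_perm _ (fun i => b (v i)) σ
  simp only [LinearMap.compAlternatingMap_apply, LinearMap.comp_apply, LinearEquiv.coe_coe,
    antisym_ιMulti, map_smul, map_sum, Submodule.subtype_apply, exteriorPower.ιMulti_apply_coe]
  have h1 : ∀ σ : Equiv.Perm (Fin k), toExt m ((Equiv.Perm.sign σ : ℤˣ) •
      (List.ofFn fun i => CliffordAlgebra.ι (quad m) (b (v (σ i)))).prod) =
        ExteriorAlgebra.ιMulti ℂ k (fun i => b (v i)) := by
    intro σ
    rw [Units.smul_def, map_zsmul, ho, ← Units.smul_def, smul_smul, Int.units_mul_self, one_smul]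
  rw [Finset.sum_congr rfl fun σ _ => h1 σ, Finset.sum_const, Finset.card_univ, Fintype.card_perm,
    Fintype.card_fin, ← Nat.cast_smul_eq_nsmul ℂ, smul_smul, one_div, inv_mul_cancel₀, one_smul]
  exact_mod_cast k.factorial_ne_zero

/-- Each further vector factor raises the degree by one through the wedge or lowers it by one
through the contraction. A product of i vectors thus lives in degrees at most i, of the parity of i.
-/
theorem extProj_toExt_of_mem_pow (m i : ℕ) (y : Cl m)
    (hy : y ∈ LinearMap.range (CliffordAlgebra.ι (quad m)) ^ i) (k : ℕ)
    (hk : i < k ∨ k % 2 ≠ i % 2) : extProj k (toExt m y) = 0 := by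
  induction hy using Submodule.pow_induction_on_left' generalizing k with
  | algebraMap r =>
    have h : algebraMap ℂ (ExteriorAlgebra ℂ (V m)) r ∈ ⋀[ℂ]^0 (V m) := by
      change _ ∈ LinearMap.range (ExteriorAlgebra.ι ℂ) ^ 0
      rw [pow_zero]; exact Submodule.algebraMap_mem r
    rw [toExt_algebraMap]
    exact extProj_of_mem_ne h (by rintro rfl; omega)
  | add x y i hx hy ihx ihy => rw [map_add, map_add, ihx k hk, ihy k hk, add_zero]
  | mem_mul a ha i x hx ih =>
    obtain ⟨v, rfl⟩ := ha
    have h1 : extProj k (ctr (bil m v) (toExt m x)) = 0 := by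
      apply Subtype.ext
      rw [extProj_ctr, ih (k + 1) (by omega)]
      simp
    rw [toExt_ι_mul, map_add, map_smul, h1, smul_zero, add_zero]
    cases k with
    | zero => exact extProj_zero_ι_mul _ _
    | succ k =>
      apply Subtype.ext
      rw [extProj_succ_ι_mul, ih k (by omega)]
      simp

theorem list_prod_mem_pow {m : ℕ} (L : List (V m)) :
    (L.map (CliffordAlgebra.ι (quad m))).prod ∈
      LinearMap.range (CliffordAlgebra.ι (quad m)) ^ L.length := by
  induction L with
  | nil => simp
  | cons v L ih =>
    rw [List.map_cons, List.prod_cons, List.length_cons, pow_succ']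
    exact Submodule.mul_mem_mul ⟨v, rfl⟩ ih

/-- The contraction terms never reach the top degree, so the leading symbol of a Clifford product is
the wedge product. -/
theorem extProj_toExt_list_prod (m : ℕ) (L : List (V m)) :
    (extProj L.length (toExt m (L.map (CliffordAlgebra.ι (quad m))).prod) :
      ExteriorAlgebra ℂ (V m)) = (L.map (ExteriorAlgebra.ι ℂ)).prod := by
  induction L with
  | nil =>
    rw [List.map_nil, List.prod_nil, toExt_one, List.map_nil, List.prod_nil]
    refine extProj_of_mem (?_ : _ ∈ LinearMap.range (ExteriorAlgebra.ι ℂ) ^ 0)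
    rw [pow_zero]; exact Submodule.one_le.1 le_rfl
  | cons v L ih =>
    have h1 : extProj (L.length + 1) (ctr (bil m v)
        (toExt m (L.map (CliffordAlgebra.ι (quad m))).prod)) = 0 := by
      apply Subtype.ext
      rw [extProj_ctr, extProj_toExt_of_mem_pow m _ _ (list_prod_mem_pow L) _ (by omega)]
      simp
    rw [List.map_cons, List.prod_cons, List.length_cons, toExt_ι_mul, map_add, map_smul, h1,
      smul_zero, add_zero, extProj_succ_ι_mul, ih, List.map_cons, List.prod_cons]

theorem extProj_toExt_of_mem_evenOdd (m : ℕ) (p : ZMod 2) (y : Cl m)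
    (hy : y ∈ CliffordAlgebra.evenOdd (quad m) p) (k : ℕ) (hk : (k : ZMod 2) ≠ p) :
    extProj k (toExt m y) = 0 := by
  rw [CliffordAlgebra.evenOdd] at hy
  induction hy using Submodule.iSup_induction' with
  | mem i x hx =>
    refine extProj_toExt_of_mem_pow m _ x hx k (Or.inr fun h => hk ?_)
    rw [← i.2]
    exact (ZMod.natCast_eq_natCast_iff _ _ _).2 h
  | zero => simp
  | add x y _ _ hx hy => rw [map_add, map_add, hx, hy, add_zero]

theorem exteriorPower_eq_zero (m k : ℕ) (hk : 2 * m + 1 < k) (x : ⋀[ℂ]^k (V m)) : x = 0 :=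
  Subtype.ext (exteriorPower_eq_zero_of_card_lt (Pi.basisFun ℂ (Fin (2 * m + 1))) (by simpa) x.2)

/-- The homogeneous components of an element of `Cl(V)`. -/
def components (m p : ℕ) (y : Cl m) : WedgePar m p := fun k => extProj (k : ℕ) (toExt m y)

/-- Gives an explicit κ-preimage of the action of y. Components of the wrong parity and those of
degree above 2m + 1 vanish, so the degrees kept in `Deg m p` recover all of `toExt m y`. -/
theorem kappa_components (m p : ℕ) (hp : p < 2) (y : Cl m)
    (hy : y ∈ CliffordAlgebra.evenOdd (quad m) p) :
    kappa m p (components m p y) = spinRep m y := by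
  simp only [kappa, LinearMap.comp_apply, AlgHom.toLinearMap_apply]
  congr 1
  apply (toExt m).injective
  simp only [LinearMap.sum_apply, LinearMap.comp_apply, LinearMap.proj_apply, map_sum,
    toExt_antisym, components]
  refine Eq.trans ?_ (sum_extProj (2 * m + 2) (toExt m y)
    fun k hk => exteriorPower_eq_zero m k (by omega) _)
  rw [Finset.sum_range, ← Finset.sum_subtype (Finset.univ.filter fun k : Fin (2 * m + 2) =>
    (k : ℕ) % 2 = p) (by simp) fun k : Fin (2 * m + 2) =>
      (extProj (k : ℕ) (toExt m y) : ExteriorAlgebra ℂ (V m))]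
  refine Finset.sum_subset (Finset.subset_univ _) fun k _ hk => ?_
  rw [extProj_toExt_of_mem_evenOdd m p y hy, Submodule.coe_zero]
  intro h
  rw [ZMod.natCast_eq_natCast_iff', Nat.mod_eq_of_lt hp] at h
  exact hk (by simpa using h)

/-! ### Brackets and conjugation -/

/-- If bracketing with s induces X on V, it induces the derivation of X on ⋀V. In the induction over
products the half-contraction terms agree because X is skew: moving the derivation past i_{⟨v,·⟩}
produces -i_{⟨Xv,·⟩}. -/
theorem toExt_bracket (m : ℕ) (s : Cl m) (X : Module.End ℂ (V m))
    (hX : ∀ u v, bil m (X u) v = -bil m u (X v))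
    (hs : ∀ v, s * CliffordAlgebra.ι (quad m) v - CliffordAlgebra.ι (quad m) v * s =
      CliffordAlgebra.ι (quad m) (X v)) (x : Cl m) :
    toExt m (s * x - x * s) = derE (Pi.basisFun ℂ _) X (toExt m x) := by
  induction x using CliffordAlgebra.left_induction with
  | algebraMap r => rw [Algebra.commutes, sub_self, map_zero, toExt_algebraMap, derE_algebraMap]
  | add x y hx hy =>
    rw [mul_add, add_mul, add_sub_add_comm, map_add, map_add, map_add, hx, hy]
  | ι_mul x v hx =>
    have h1 : s * (CliffordAlgebra.ι (quad m) v * x) - CliffordAlgebra.ι (quad m) v * x * s =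
        CliffordAlgebra.ι (quad m) (X v) * x + CliffordAlgebra.ι (quad m) v * (s * x - x * s) := by
      rw [← hs]; noncomm_ring
    have h2 : bil m (X v) = -(bil m v ∘ₗ X) := LinearMap.ext fun w => hX v w
    rw [h1, map_add, toExt_ι_mul, toExt_ι_mul, hx, toExt_ι_mul, map_add, derE_ι_mul, map_smul,
      ctr_derE, h2, ctr_neg]
    simp only [smul_neg, smul_add]
    abel

theorem antisym_extDer (m k : ℕ) (s : Cl m) (X : Module.End ℂ (V m))
    (hX : ∀ u v, bil m (X u) v = -bil m u (X v))
    (hs : ∀ v, s * CliffordAlgebra.ι (quad m) v - CliffordAlgebra.ι (quad m) v * s =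
      CliffordAlgebra.ι (quad m) (X v)) (z : ⋀[ℂ]^k (V m)) :
    antisym m k (extDer k X z) = s * antisym m k z - antisym m k z * s := by
  apply (toExt m).injective
  rw [toExt_bracket m s X hX hs, toExt_antisym, toExt_antisym, coe_extDer (Pi.basisFun ℂ _)]

theorem antisym_map (m k : ℕ) (g g' : Cl m) (hg : g' * g = 1) (hg' : g * g' = 1)
    (T : Module.End ℂ (V m))
    (hT : ∀ v, CliffordAlgebra.ι (quad m) (T v) = g * CliffordAlgebra.ι (quad m) v * g')
    (z : ⋀[ℂ]^k (V m)) :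
    antisym m k (exteriorPower.map k T z) = g * antisym m k z * g' := by
  suffices h : antisym m k ∘ₗ exteriorPower.map k T =
      LinearMap.mulRight ℂ g' ∘ₗ LinearMap.mulLeft ℂ g ∘ₗ antisym m k from LinearMap.congr_fun h z
  have key : ∀ (n : ℕ) (u : Fin n → V m),
      (List.ofFn fun i => CliffordAlgebra.ι (quad m) (T (u i))).prod =
        g * (List.ofFn fun i => CliffordAlgebra.ι (quad m) (u i)).prod * g' := by
    intro n
    induction n with
    | zero => intro u; simp [hg']
    | succ n ih =>
      intro u
      rw [List.ofFn_succ, List.ofFn_succ, List.prod_cons, List.prod_cons, ih fun i => u i.succ, hT]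
      calc _ = g * CliffordAlgebra.ι (quad m) (u 0) * (g' * g) * (List.ofFn fun i =>
          CliffordAlgebra.ι (quad m) (u i.succ)).prod * g' := by noncomm_ring
        _ = _ := by rw [hg]; noncomm_ring
  apply exteriorPower.linearMap_ext
  ext1 u
  simp only [LinearMap.compAlternatingMap_apply, LinearMap.comp_apply,
    exteriorPower.map_apply_ιMulti, antisym_ιMulti, LinearMap.mulRight_apply,
    LinearMap.mulLeft_apply, mul_smul_comm, smul_mul_assoc, Finset.mul_sum, Finset.sum_mul,
    Function.comp_apply, key]

/-- The infinitesimal rotation `y ↦ ⟨b, y⟩ a - ⟨a, y⟩ b`. -/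
def rot (m : ℕ) (a b : V m) : Module.End ℂ (V m) :=
  (bil m b).smulRight a - (bil m a).smulRight b

theorem rot_apply (m : ℕ) (a b y : V m) : rot m a b y = bil m b y • a - bil m a y • b := rfl

theorem rot_skew (m : ℕ) (a b u v : V m) : bil m (rot m a b u) v = -bil m u (rot m a b v) := by
  simp only [rot_apply, map_sub, map_smul, LinearMap.sub_apply, LinearMap.smul_apply, smul_eq_mul,
    bil_symm m u]
  ring

theorem rot_bracket (m : ℕ) (a b y : V m) :
    CliffordAlgebra.ι (quad m) a * CliffordAlgebra.ι (quad m) b * CliffordAlgebra.ι (quad m) y -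
      CliffordAlgebra.ι (quad m) y * (CliffordAlgebra.ι (quad m) a * CliffordAlgebra.ι (quad m) b)
      = CliffordAlgebra.ι (quad m) (rot m a b y) := by
  have h1 := ι_anticomm m b y
  have h2 := ι_anticomm m a y
  rw [rot_apply, map_sub, map_smul, map_smul, Algebra.smul_def, Algebra.smul_def, ← h1, ← h2,
    h1, Algebra.commutes, ← h1]
  noncomm_ring

theorem rot_trace (m : ℕ) (a b : V m) :
    ∑ k, (Pi.basisFun ℂ (Fin (2 * m + 1))).coord k
      (rot m a b (Pi.basisFun ℂ (Fin (2 * m + 1)) k)) = 0 := by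
  have h : ∀ z w : V m, ∑ k, bil m z (Pi.single k 1) * w k = bil m z w := by
    intro z w
    have : w = ∑ k, w k • (Pi.single k 1 : V m) := by
      funext l; simp [Finset.sum_apply, Pi.single_apply]
    conv_rhs => rw [this, map_sum]
    exact Finset.sum_congr rfl fun k _ => by rw [map_smul, smul_eq_mul, mul_comm]
  simp only [Module.Basis.coord_apply, Pi.basisFun_repr, Pi.basisFun_apply, rot_apply, Pi.sub_apply,
    Pi.smul_apply, smul_eq_mul, Finset.sum_sub_distrib, h, bil_symm m b a, sub_self]

/-- The even part is generated by products uv. Bracketing with uv is the derivation of `rot m u v`,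
up to `toExt`, and on the top degree this is multiplication by the trace of `rot m u v`, which is
zero. -/
theorem commute_of_even (m : ℕ) (g x : Cl m) (hg : g ∈ CliffordAlgebra.evenOdd (quad m) 0)
    (hx : toExt m x ∈ ⋀[ℂ]^(2 * m + 1) (V m)) : g * x = x * g := by
  induction g, hg using CliffordAlgebra.even_induction with
  | algebraMap r => exact Algebra.commutes r x
  | add a b _ _ ha hb => rw [add_mul, mul_add, ha, hb]
  | ι_mul_ι_mul u v y _ ih =>
    have h : CliffordAlgebra.ι (quad m) u * CliffordAlgebra.ι (quad m) v * x =
        x * (CliffordAlgebra.ι (quad m) u * CliffordAlgebra.ι (quad m) v) := by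
      rw [← sub_eq_zero]
      apply (toExt m).injective
      rw [toExt_bracket m _ (rot m u v) (rot_skew m u v) (rot_bracket m u v), map_zero,
        derE_of_mem_top _ _ (by rwa [Fintype.card_fin]), rot_trace, zero_smul]
    rw [mul_assoc, ih, ← mul_assoc, h, mul_assoc]


/-! ### Creation, annihilation and parity on the basis of an exterior algebra -/

section Fock

variable {M : Type} [AddCommGroup M] [Module ℂ M] {n : ℕ} (b : Module.Basis (Fin n) ℂ M)

theorem extBasis_apply (I : Finset (Fin n)) :
    b.ExteriorAlgebra I = ((I.sort (· ≤ ·)).map fun i => ExteriorAlgebra.ι ℂ (b i)).prod := by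
  rw [ExteriorAlgebra.basis_apply]
  refine (ExteriorAlgebra.ιMulti_apply _).trans ?_
  rw [← Finset.listMap_orderEmbOfFin_finRange I rfl, List.map_map, List.ofFn_eq_map]
  rfl

theorem extBasis_empty : b.ExteriorAlgebra ∅ = 1 := by
  rw [extBasis_apply, Finset.sort_empty, List.map_nil, List.prod_nil]

theorem extBasis_insert_min {a : Fin n} {I : Finset (Fin n)} (h : ∀ i ∈ I, a < i) :
    b.ExteriorAlgebra (insert a I) = ExteriorAlgebra.ι ℂ (b a) * b.ExteriorAlgebra I := by
  rw [extBasis_apply, Finset.sort_insert _ (fun i hi => (h i hi).le) fun ha => lt_irrefl _ (h a ha),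
    List.map_cons, List.prod_cons, extBasis_apply]

/-- The sign `(-1)^k`, where `k` is the number of elements of `I` smaller than `i`. -/
def sgn (i : Fin n) (I : Finset (Fin n)) : ℂ := (-1) ^ (I.filter (· < i)).card

theorem sgn_mul_self (i : Fin n) (I : Finset (Fin n)) : sgn i I * sgn i I = 1 := by
  rw [sgn, ← pow_add, ← two_mul, pow_mul]; norm_num

theorem sgn_insert_self (i : Fin n) (I : Finset (Fin n)) : sgn i (insert i I) = sgn i I := by
  rw [sgn, sgn, Finset.filter_insert, if_neg (lt_irrefl _)]

theorem sgn_erase_self (i : Fin n) (I : Finset (Fin n)) : sgn i (I.erase i) = sgn i I := by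
  rw [sgn, sgn, Finset.filter_erase, Finset.erase_eq_of_notMem (by simp)]

theorem sgn_insert_lt {a i : Fin n} {I : Finset (Fin n)} (h : a < i) (ha : a ∉ I) :
    sgn i (insert a I) = -sgn i I := by
  rw [sgn, sgn, Finset.filter_insert, if_pos h, Finset.card_insert_of_notMem (by simp [ha]),
    pow_succ]
  ring

theorem sgn_eq_one {i : Fin n} {I : Finset (Fin n)} (h : ∀ a ∈ I, i ≤ a) : sgn i I = 1 := by
  rw [sgn, Finset.filter_eq_empty_iff.2 fun a ha => not_lt.2 (h a ha), Finset.card_empty, pow_zero]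

/-- Induction on the least element of I: a larger i has to pass it, which costs one sign. -/
theorem ι_mul_extBasis (i : Fin n) (I : Finset (Fin n)) :
    ExteriorAlgebra.ι ℂ (b i) * b.ExteriorAlgebra I =
      if i ∈ I then 0 else sgn i I • b.ExteriorAlgebra (insert i I) := by
  induction I using Finset.induction_on_min with
  | empty =>
    rw [if_neg (Finset.notMem_empty _), sgn_eq_one (by simp), one_smul,
      ← extBasis_insert_min b (by simp)]
  | insert a I ha ih =>
    have haI : a ∉ I := fun h => lt_irrefl _ (ha a h)
    rcases lt_trichotomy i a with h | rfl | h
    · have h1 : ∀ k ∈ insert a I, i < k := by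
        intro k hk
        rcases Finset.mem_insert.1 hk with rfl | hk
        · exact h
        · exact h.trans (ha k hk)
      rw [if_neg fun hi => lt_irrefl _ (h1 i hi), sgn_eq_one fun k hk => (h1 k hk).le, one_smul,
        extBasis_insert_min b h1]
    · rw [if_pos (Finset.mem_insert_self _ _), extBasis_insert_min b ha, ← mul_assoc,
        ExteriorAlgebra.ι_sq_zero, zero_mul]
    · rw [extBasis_insert_min b ha, ι_mul_ι_mul_comm, ih]
      by_cases hi : i ∈ I
      · rw [if_pos hi, if_pos (Finset.mem_insert_of_mem hi), mul_zero, neg_zero]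
      · have h1 : ∀ k ∈ insert i I, a < k := by
          intro k hk
          rcases Finset.mem_insert.1 hk with rfl | hk
          · exact h
          · exact ha k hk
        rw [if_neg hi, if_neg (by simp [hi, h.ne']), sgn_insert_lt h haI, mul_smul_comm,
          ← extBasis_insert_min b h1, Finset.insert_comm, neg_smul]

/-- If i lies in I, `ι_mul_extBasis` writes the monomial as ± b_i times a monomial that does not
involve b_i, and contraction removes the leading factor. -/
theorem ctr_extBasis (i : Fin n) (I : Finset (Fin n)) :
    ctr (b.coord i) (b.ExteriorAlgebra I) =
      if i ∈ I then sgn i I • b.ExteriorAlgebra (I.erase i) else 0 := by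
  have h0 : ∀ I : Finset (Fin n), i ∉ I → ctr (b.coord i) (b.ExteriorAlgebra I) = 0 := by
    intro I
    induction I using Finset.induction_on_min with
    | empty => intro _; rw [extBasis_empty, ctr_one]
    | insert a I ha ih =>
      intro hi
      rw [Finset.mem_insert, not_or] at hi
      rw [extBasis_insert_min b ha, ctr_ι_mul, ih hi.2, b.coord_apply, b.repr_self,
        Finsupp.single_eq_of_ne hi.1]
      simp
  split_ifs with hi
  · have h1 := ι_mul_extBasis b i (I.erase i)
    rw [if_neg (Finset.notMem_erase _ _), Finset.insert_erase hi, sgn_erase_self] at h1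
    have h2 : b.ExteriorAlgebra I =
        sgn i I • (ExteriorAlgebra.ι ℂ (b i) * b.ExteriorAlgebra (I.erase i)) := by
      rw [h1, smul_smul, sgn_mul_self, one_smul]
    rw [h2, map_smul, ctr_ι_mul, h0 _ (Finset.notMem_erase _ _), b.coord_apply, b.repr_self]
    simp
  · exact h0 I hi

theorem involute_extBasis (I : Finset (Fin n)) :
    CliffordAlgebra.involute (Q := (0 : QuadraticForm ℂ M)) (b.ExteriorAlgebra I) =
      (-1 : ℂ) ^ I.card • b.ExteriorAlgebra I := by
  induction I using Finset.induction_on_min with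
  | empty => rw [extBasis_empty, map_one]; simp
  | insert a I ha ih =>
    have haI : a ∉ I := fun h => lt_irrefl _ (ha a h)
    rw [extBasis_insert_min b ha, map_mul, ih, Finset.card_insert_of_notMem haI, mul_smul_comm,
      pow_succ]
    have : CliffordAlgebra.involute (Q := (0 : QuadraticForm ℂ M)) (ExteriorAlgebra.ι ℂ (b a)) =
      -ExteriorAlgebra.ι ℂ (b a) := CliffordAlgebra.involute_ι _
    rw [this]
    simp

end Fock

/-! ### The basis vectors of `V` on the basis of `V_Spin` -/

theorem eps_sq (m i : ℕ) : ((-1 : ℂ) ^ (m + i)) * (-1) ^ (m + i) = 1 := by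
  rw [← pow_add, ← two_mul, pow_mul]; norm_num

theorem gamma_vec_lt (m : ℕ) (i : Fin m) (I : Finset (Fin m)) :
    gamma m (vec m (i + 1)) (wBasis m I) =
      if i ∈ I then 0 else sgn i I • wBasis m (insert i I) := by
  have h1 : projW m (vec m (i + 1)) = Pi.basisFun ℂ (Fin m) i := by
    ext k
    simp [projW, vec, LinearMap.funLeft_apply, Pi.single_apply, Fin.ext_iff]
  have h2 : (bil m (vec m (i + 1))).comp (inclW m) = 0 := by
    refine LinearMap.ext fun w => ?_
    rw [LinearMap.comp_apply, bil_apply, LinearMap.zero_apply]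
    refine Finset.sum_eq_zero fun k _ => ?_
    simp only [vec, inclW, LinearMap.coe_mk, AddHom.coe_mk, Fin.val_rev]
    split_ifs with h3 h4
    · omega
    all_goals simp
  have h3 : vec m (i + 1) (mid m) = 0 := by
    exact if_neg (by simp only [mid]; omega)
  rw [gamma_apply, h1, h2, h3, zero_mul, zero_smul, add_zero, map_zero, LinearMap.zero_apply,
    add_zero]
  exact ι_mul_extBasis _ i I

/-- As i is zero-based, 2m + 1 - i is the index of v̄_{i+1}, and (-1)^{m+i} is the sign ε(i+1). -/
theorem gamma_vec_gt (m : ℕ) (i : Fin m) (I : Finset (Fin m)) :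
    gamma m (vec m (2 * m + 1 - i)) (wBasis m I) =
      if i ∈ I then ((-1) ^ (m + (i : ℕ)) * sgn i I) • wBasis m (I.erase i) else 0 := by
  have h1 : projW m (vec m (2 * m + 1 - i)) = 0 := by
    ext k
    simp only [projW, vec, LinearMap.funLeft_apply, Fin.val_castLE,
      Pi.zero_apply, ite_eq_right_iff]
    omega
  have h2 : (bil m (vec m (2 * m + 1 - i))).comp (inclW m) =
      (-1 : ℂ) ^ (m + (i : ℕ)) • (Pi.basisFun ℂ (Fin m)).coord i := by
    refine LinearMap.ext fun w => ?_
    have hr : (Fin.rev ⟨i, by omega⟩ : Fin (2 * m + 1)).rev = ⟨i, by omega⟩ := Fin.rev_rev _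
    rw [LinearMap.comp_apply, bil_apply, Finset.sum_eq_single (Fin.rev ⟨i, by omega⟩), hr, eps_rev]
    · simp only [vec, eps, inclW, Fin.val_rev, LinearMap.coe_mk, AddHom.coe_mk,
        LinearMap.smul_apply, Module.Basis.coord_apply, Pi.basisFun_repr, smul_eq_mul]
      rw [if_pos (by omega), dif_pos i.2]
      simp
    · intro k _ hk
      have : vec m (2 * m + 1 - i) k = 0 := by
        simp only [vec, ite_eq_right_iff]
        intro h
        exact absurd (Fin.ext (by simp only [Fin.val_rev]; omega)) hk
      simp [this]
    · simp
  have h3 : vec m (2 * m + 1 - i) (mid m) = 0 := by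
    exact if_neg (by simp only [mid]; omega)
  have h4 : CliffordAlgebra.ι (0 : QuadraticForm ℂ (W m)) 0 = 0 := map_zero _
  rw [gamma_apply, h1, h2, h3, h4, zero_mul, zero_mul, zero_smul, add_zero, zero_add]
  refine (ctr_smul _ _ _).trans ?_
  rw [wBasis, ctr_extBasis, smul_ite, smul_zero, smul_smul]

theorem gamma_vec_mid (m : ℕ) (I : Finset (Fin m)) :
    gamma m (vec m (m + 1)) (wBasis m I) =
      (1 / (Real.sqrt 2 : ℂ) * (-1) ^ I.card) • wBasis m I := by
  have h1 : projW m (vec m (m + 1)) = 0 := by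
    ext k
    simp only [projW, vec, LinearMap.funLeft_apply, Fin.val_castLE,
      Pi.zero_apply, ite_eq_right_iff]
    omega
  have h2 : (bil m (vec m (m + 1))).comp (inclW m) = 0 := by
    refine LinearMap.ext fun w => ?_
    rw [LinearMap.comp_apply, bil_apply, LinearMap.zero_apply]
    refine Finset.sum_eq_zero fun k _ => ?_
    simp only [vec, inclW, LinearMap.coe_mk, AddHom.coe_mk, Fin.val_rev]
    split_ifs with h3 h4
    · omega
    all_goals simp
  have h3 : vec m (m + 1) (mid m) = 1 := by simp [vec, mid]
  have h4 : CliffordAlgebra.ι (0 : QuadraticForm ℂ (W m)) 0 = 0 := map_zero _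
  rw [gamma_apply, h1, h2, h3, h4, zero_mul, map_zero, LinearMap.zero_apply, zero_add, zero_add,
    wBasis, involute_extBasis, smul_smul, one_mul]

theorem spinRep_ι (m : ℕ) (v : V m) : spinRep m (CliffordAlgebra.ι (quad m) v) = gamma m v :=
  CliffordAlgebra.lift_ι_apply _ _ _


/-! ### The isomorphism `κ` -/

/-- The image of the even or odd part of `Cl(V)` in `End(V_Spin)`. -/
def parityImage (m : ℕ) (p : ZMod 2) : Submodule ℂ (Module.End ℂ (VSpin m)) :=
  (CliffordAlgebra.evenOdd (quad m) p).map (spinRep m).toLinearMap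

theorem parityImage_mul {m : ℕ} {p q r : ZMod 2} (h : p + q = r) {f g : Module.End ℂ (VSpin m)}
    (hf : f ∈ parityImage m p) (hg : g ∈ parityImage m q) : f * g ∈ parityImage m r := by
  subst h
  obtain ⟨x, hx, rfl⟩ := hf
  obtain ⟨y, hy, rfl⟩ := hg
  exact ⟨x * y, CliffordAlgebra.evenOdd_mul_le _ _ _ (Submodule.mul_mem_mul hx hy),
    map_mul (spinRep m) x y⟩

theorem gamma_mem_parityImage (m : ℕ) (v : V m) : gamma m v ∈ parityImage m 1 :=
  ⟨_, CliffordAlgebra.ι_mem_evenOdd_one _ v, spinRep_ι m v⟩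

theorem one_mem_parityImage_zero (m : ℕ) : 1 ∈ parityImage m 0 :=
  ⟨1, CliffordAlgebra.one_le_evenOdd_zero _ (Submodule.one_le.1 le_rfl), map_one (spinRep m)⟩

theorem number_apply (m : ℕ) (i : Fin m) (I : Finset (Fin m)) :
    (gamma m (vec m (i + 1)) * gamma m (vec m (2 * m + 1 - i))) (wBasis m I) =
      if i ∈ I then (-1 : ℂ) ^ (m + (i : ℕ)) • wBasis m I else 0 := by
  rw [Module.End.mul_apply, gamma_vec_gt]
  split_ifs with h
  · rw [map_smul, gamma_vec_lt, if_neg (Finset.notMem_erase _ _), sgn_erase_self, smul_smul,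
      mul_assoc, sgn_mul_self, mul_one, Finset.insert_erase h]
  · rw [map_zero]

/-- Products of operators `1 - c n_i`, where `n_i` is the occupation number of `i`. -/
theorem exists_diag_mem_parityImage (m : ℕ) (c : ℂ) (A : Finset (Fin m)) :
    ∃ f ∈ parityImage m 0, ∀ I, f (wBasis m I) = (1 - c) ^ (I ∩ A).card • wBasis m I := by
  induction A using Finset.induction_on with
  | empty => exact ⟨1, one_mem_parityImage_zero m, fun I => by simp⟩
  | insert i A hi ih =>
    obtain ⟨f, hf, hfI⟩ := ih
    -- The sign cancels the one in `number_apply`, so the new factor is exactly 1 - c n_i.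
    refine ⟨f * (1 - (c * (-1) ^ (m + (i : ℕ))) •
      (gamma m (vec m (i + 1)) * gamma m (vec m (2 * m + 1 - i)))), ?_, fun I => ?_⟩
    · refine parityImage_mul (add_zero 0) hf (sub_mem (one_mem_parityImage_zero m) (Submodule.smul_mem _ _ ?_))
      exact parityImage_mul (p := 1) (q := 1) (by decide) (gamma_mem_parityImage m _) (gamma_mem_parityImage m _)
    · rw [Module.End.mul_apply, LinearMap.sub_apply, LinearMap.smul_apply, number_apply,
        Module.End.one_apply]
      by_cases h : i ∈ I
      · rw [if_pos h, smul_smul, mul_assoc, eps_sq, mul_one, map_sub, map_smul, hfI,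
          Finset.inter_insert_of_mem h, Finset.card_insert_of_notMem (by simp [hi]), pow_succ,
          smul_smul, ← sub_smul]
        congr 1; ring
      · rw [if_neg h, smul_zero, sub_zero, hfI, Finset.inter_insert_of_notMem h]

/-- For c = 2 the diagonal operator is (-1)^{|I|}, which is even, and √2 v_{m+1}, which is odd, acts
in the same way. Their product is an odd element acting as the identity, so the two parities have
the same image. -/
theorem one_mem_parityImage_one (m : ℕ) : 1 ∈ parityImage m 1 := by
  obtain ⟨f, hf, hfI⟩ := exists_diag_mem_parityImage m 2 Finset.univ
  have h : (Real.sqrt 2 : ℂ) • (gamma m (vec m (m + 1)) * f) = 1 := by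
    refine (wBasis m).ext fun I => ?_
    have h2 : (Real.sqrt 2 : ℂ) ≠ 0 := by
      exact_mod_cast (Real.sqrt_pos.2 (by norm_num : (0 : ℝ) < 2)).ne'
    have h3 : ((-1 : ℂ) ^ I.card) * (-1) ^ I.card = 1 := by
      rw [← pow_add, ← two_mul, pow_mul]; norm_num
    rw [LinearMap.smul_apply, Module.End.mul_apply, hfI, Finset.inter_univ, map_smul, gamma_vec_mid,
      smul_smul, smul_smul, Module.End.one_apply]
    convert one_smul ℂ _
    rw [show (1 : ℂ) - 2 = -1 by norm_num]
    field_simp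
    linear_combination h3
  rw [← h]
  exact Submodule.smul_mem _ _ (parityImage_mul (add_zero 1) (gamma_mem_parityImage m _) hf)

theorem gamma_mem_parityImage_zero (m : ℕ) (v : V m) : gamma m v ∈ parityImage m 0 := by
  rw [← mul_one (gamma m v)]
  exact parityImage_mul (p := 1) (q := 1) (by decide) (gamma_mem_parityImage m v) (one_mem_parityImage_one m)

/-- The case A = B = ∅ is the vacuum projection ∏ (1 - n_i), that is c = 1. Multiplying by creation
operators on the left and by annihilation operators on the right then reaches every pair; each
single vector is available in the even image. -/
theorem matrixUnit_mem (m : ℕ) (A B : Finset (Fin m)) :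
    ((wBasis m).coord B).smulRight (wBasis m A) ∈ parityImage m 0 := by
  induction B using Finset.induction_on with
  | empty =>
    induction A using Finset.induction_on with
    | empty =>
      obtain ⟨f, hf, hfI⟩ := exists_diag_mem_parityImage m 1 Finset.univ
      convert hf
      refine (wBasis m).ext fun I => ?_
      rw [hfI, LinearMap.smulRight_apply, Module.Basis.coord_apply, Module.Basis.repr_self,
        Finset.inter_univ, sub_self]
      by_cases h : I = ∅
      · subst h; simp
      · rw [Finsupp.single_eq_of_ne (Ne.symm h), zero_pow (Finset.card_ne_zero.2
          (Finset.nonempty_iff_ne_empty.2 h)), zero_smul, zero_smul]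
    | insert i A hi ih =>
      convert Submodule.smul_mem _ (sgn i A)
        (parityImage_mul (add_zero 0) (gamma_mem_parityImage_zero m (vec m (i + 1))) ih) using 1
      refine (wBasis m).ext fun I => ?_
      rw [LinearMap.smul_apply, Module.End.mul_apply, LinearMap.smulRight_apply,
        LinearMap.smulRight_apply, map_smul, gamma_vec_lt, if_neg hi, smul_comm, smul_smul (sgn i A),
        sgn_mul_self, one_smul]
  | insert i B hi ih =>
    convert Submodule.smul_mem _ ((-1) ^ (m + (i : ℕ)) * sgn i B)
        (parityImage_mul (add_zero 0) ih (gamma_mem_parityImage_zero m (vec m (2 * m + 1 - i)))) using 1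
    refine (wBasis m).ext fun I => ?_
    rw [LinearMap.smul_apply, Module.End.mul_apply, gamma_vec_gt, LinearMap.smulRight_apply,
      Module.Basis.coord_apply, Module.Basis.repr_self]
    split_ifs with h
    · rw [map_smul, LinearMap.smulRight_apply, Module.Basis.coord_apply, Module.Basis.repr_self,
        smul_smul]
      by_cases h2 : I = insert i B
      · subst h2
        rw [Finset.erase_insert hi, Finsupp.single_eq_same, Finsupp.single_eq_same, one_smul,
          sgn_insert_self, mul_mul_mul_comm, eps_sq, sgn_mul_self, one_mul, one_smul]
      · have h3 : I.erase i ≠ B := fun e => h2 (by rw [← e, Finset.insert_erase h])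
        rw [Finsupp.single_eq_of_ne (Ne.symm h2), Finsupp.single_eq_of_ne (Ne.symm h3), zero_smul, smul_zero]
    · have h2 : I ≠ insert i B := fun e => h (e ▸ Finset.mem_insert_self _ _)
      rw [Finsupp.single_eq_of_ne (Ne.symm h2), map_zero, smul_zero, zero_smul]

theorem parityImage_zero (m : ℕ) : parityImage m 0 = ⊤ := by
  rw [eq_top_iff]
  intro f _
  have h : f = ∑ B, ∑ A, (wBasis m).repr (f (wBasis m B)) A •
      ((wBasis m).coord B).smulRight (wBasis m A) := by
    refine (wBasis m).ext fun I => ?_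
    simp only [LinearMap.sum_apply, LinearMap.smul_apply, LinearMap.smulRight_apply,
      Module.Basis.coord_apply, Module.Basis.repr_self]
    rw [Finset.sum_eq_single I]
    · simp only [Finsupp.single_eq_same, one_smul]
      exact ((wBasis m).sum_repr _).symm
    · intro B _ hB
      refine Finset.sum_eq_zero fun A _ => ?_
      rw [Finsupp.single_eq_of_ne hB, zero_smul, smul_zero]
    · simp
  rw [h]
  exact Submodule.sum_mem _ fun B _ => Submodule.sum_mem _ fun A _ =>
    Submodule.smul_mem _ _ (matrixUnit_mem m A B)

theorem parityImage_one (m : ℕ) : parityImage m 1 = ⊤ := by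
  rw [eq_top_iff]
  intro f _
  rw [← mul_one f]
  exact parityImage_mul (zero_add 1) (parityImage_zero m ▸ Submodule.mem_top)
    (one_mem_parityImage_one m)

theorem kappa_surjective (m p : ℕ) (hp : p < 2) : Function.Surjective (kappa m p) := by
  intro f
  have h : parityImage m p = ⊤ := by
    interval_cases p
    · exact_mod_cast parityImage_zero m
    · exact_mod_cast parityImage_one m
  obtain ⟨y, hy, rfl⟩ : f ∈ parityImage m p := h ▸ Submodule.mem_top
  exact ⟨_, kappa_components m p hp y hy⟩

theorem finrank_wedgePar (m p : ℕ) : Module.finrank ℂ (WedgePar m p) =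
    
    ∑ k ∈ Finset.univ.filter fun k : Fin (2 * m + 2) => (k : ℕ) % 2 = p, (2 * m + 1).choose k := by
  rw [Module.finrank_pi_fintype,
    Finset.sum_subtype (p := fun k : Fin (2 * m + 2) => (k : ℕ) % 2 = p) _ (by simp)]
  refine Finset.sum_congr rfl fun k _ => ?_
  rw [exteriorPower.finrank_eq, Module.finrank_fin_fun]

theorem finite_vSpin (m : ℕ) : Module.Finite ℂ (VSpin m) := Module.Finite.of_basis (wBasis m)

theorem finrank_end_vSpin (m : ℕ) : Module.finrank ℂ (Module.End ℂ (VSpin m)) = 2 ^ (2 * m) := by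
  have := finite_vSpin m
  have := Module.Free.of_basis (wBasis m)
  rw [Module.finrank_linearMap, Module.finrank_eq_card_basis (wBasis m), Fintype.card_finset,
    Fintype.card_fin, ← pow_add, two_mul]

/-- The even and odd parts of ⋀V have total dimension 2 · 2^{2m}, and each surjects onto a space of
dimension 2^{2m}. Both surjections are therefore bijective. -/
theorem kappa_bijective (m p : ℕ) (hp : p < 2) : Function.Bijective (kappa m p) := by
  have := finite_vSpin m
  have h0 := LinearMap.finrank_le_finrank_of_surjective (kappa_surjective m 0 (by norm_num))
  have h1 := LinearMap.finrank_le_finrank_of_surjective (kappa_surjective m 1 (by norm_num))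
  have hs : Module.finrank ℂ (WedgePar m 0) + Module.finrank ℂ (WedgePar m 1) = 2 ^ (2 * m + 1) := by
    rw [finrank_wedgePar, finrank_wedgePar, ← Nat.sum_range_choose, Finset.sum_range,
      ← Finset.sum_filter_add_sum_filter_not Finset.univ
        (fun k : Fin (2 * m + 2) => (k : ℕ) % 2 = 0)]
    simp only [Nat.mod_two_ne_zero]
  rw [finrank_end_vSpin] at h0 h1
  rw [pow_succ] at hs
  have h : Module.finrank ℂ (WedgePar m p) = Module.finrank ℂ (Module.End ℂ (VSpin m)) := by
    rw [finrank_end_vSpin]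
    interval_cases p <;> omega
  exact ⟨(LinearMap.injective_iff_surjective_of_finrank_eq_finrank h).2 (kappa_surjective m p hp),
    kappa_surjective m p hp⟩

theorem kappaInv_kappa (m p : ℕ) (hp : p < 2) (z : WedgePar m p) :
    kappaInv m p (kappa m p z) = z := by
  rw [kappaInv, dif_pos (kappa_bijective m p hp)]
  exact (LinearEquiv.ofBijective (kappa m p) _).symm_apply_apply z

theorem kappaInv_spinRep (m p : ℕ) (hp : p < 2) (y : Cl m)
    (hy : y ∈ CliffordAlgebra.evenOdd (quad m) p) :
    kappaInv m p (spinRep m y) = components m p y := by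
  rw [← kappa_components m p hp y hy, kappaInv_kappa m p hp]


/-! ### The bilinear form `δ(a)(b)` on `V_Spin` -/

/-- `|λ|`, where `λ` is the strict partition that corresponds to `I`. -/
def weight (m : ℕ) (I : Finset (Fin m)) : ℕ := ∑ i ∈ I, (m - (i : ℕ))

theorem delta_basis (m : ℕ) (I J : Finset (Fin m)) :
    delta m (wBasis m I) (wBasis m J) = if J = Iᶜ then (-1) ^ weight m I else 0 := by
  rw [delta, Module.Basis.constr_basis, LinearMap.smul_apply, Module.Basis.coord_apply,
    Module.Basis.repr_self, weight]
  split_ifs with h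
  · rw [h, Finsupp.single_eq_same, smul_eq_mul, mul_one]
  · rw [Finsupp.single_eq_of_ne (Ne.symm h), smul_zero]

theorem neg_one_pow_mul_self (k : ℕ) : ((-1 : ℂ) ^ k) * (-1) ^ k = 1 := by
  rw [← pow_add, ← two_mul, pow_mul]; norm_num

theorem neg_one_pow_congr {a b : ℕ} (h : a % 2 = b % 2) : (-1 : ℂ) ^ a = (-1) ^ b := by
  rw [neg_one_pow_eq_pow_mod_two, h, ← neg_one_pow_eq_pow_mod_two]

theorem weight_add_compl (m : ℕ) (I : Finset (Fin m)) :
    weight m I + weight m Iᶜ = m * (m + 1) / 2 := by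
  rw [weight, weight, Finset.sum_add_sum_compl, Fin.sum_univ_eq_sum_range (fun i => m - i) m]
  clear I
  induction m with
  | zero => rfl
  | succ m ih =>
    rw [Finset.sum_range_succ', Finset.sum_congr rfl fun j _ => Nat.add_sub_add_right m 1 j, ih,
      Nat.sub_zero, ← Nat.add_mul_div_right _ _ two_pos]
    congr 1; ring

/-- The partitions λ and PD(λ) together have the parts 1, …, m, so exchanging them changes the sign
by (-1)^{|λ| + |PD(λ)|} = (-1)^{m(m+1)/2}. -/
theorem delta_symm (m : ℕ) (a b : VSpin m) :
    delta m b a = (-1) ^ (m * (m + 1) / 2) * delta m a b := by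
  suffices h : (delta m).flip = (-1 : ℂ) ^ (m * (m + 1) / 2) • delta m from
    LinearMap.congr_fun (LinearMap.congr_fun h a) b
  refine (wBasis m).ext fun I => (wBasis m).ext fun J => ?_
  rw [LinearMap.flip_apply, LinearMap.smul_apply, LinearMap.smul_apply, delta_basis, delta_basis,
    smul_eq_mul]
  by_cases h : J = Iᶜ
  · subst h
    rw [if_pos (compl_compl I).symm, if_pos rfl, ← weight_add_compl m I, pow_add,
      mul_right_comm, neg_one_pow_mul_self, one_mul]
  · rw [if_neg h, if_neg fun e => h (by rw [e, compl_compl]), mul_zero]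

theorem delta_injective (m : ℕ) : Function.Injective (delta m) := by
  rw [injective_iff_map_eq_zero]
  intro a ha
  refine (wBasis m).repr.map_eq_zero_iff.1 (Finsupp.ext fun I => ?_)
  have h : delta m (wBasis m Iᶜ) a = 0 := by
    rw [delta_symm, ha, LinearMap.zero_apply, mul_zero]
  rw [delta, Module.Basis.constr_basis, LinearMap.smul_apply, compl_compl, smul_eq_mul] at h
  exact (mul_eq_zero.1 h).resolve_left (pow_ne_zero _ (by norm_num))

theorem delta_bijective (m : ℕ) : Function.Bijective (delta m) := by
  have := finite_vSpin m
  exact ⟨delta_injective m, (LinearMap.injective_iff_surjective_of_finrank_eq_finrank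
    Subspace.dual_finrank_eq.symm).1 (delta_injective m)⟩

theorem sgn_mul_sgn_compl {m : ℕ} (i : Fin m) (I : Finset (Fin m)) :
    sgn i I * sgn i Iᶜ = (-1) ^ (i : ℕ) := by
  rw [sgn, sgn, ← pow_add, Finset.compl_eq_univ_sdiff, ← Finset.card_union_of_disjoint,
    ← Finset.filter_union, Finset.union_sdiff_of_subset (Finset.subset_univ _)]
  · congr 1
    rw [← Fin.card_Iio i]
    congr 1; ext; simp
  · exact Finset.disjoint_filter_filter Finset.disjoint_sdiff

theorem sgn_compl {m : ℕ} (i : Fin m) (I : Finset (Fin m)) :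
    sgn i Iᶜ = (-1) ^ (i : ℕ) * sgn i I := by
  rw [← sgn_mul_sgn_compl i I, mul_comm (sgn i I), mul_assoc, sgn_mul_self, mul_one]

theorem weight_insert {m : ℕ} {i : Fin m} {I : Finset (Fin m)} (h : i ∉ I) :
    weight m (insert i I) = m - i + weight m I := Finset.sum_insert h

/-- Adding i to I (zero-based) amounts to adding it to J once J is compared with the complement of
I. The weight contributes (-1)^{m-i} and passing to the complement in `sgn` contributes (-1)^i,
which multiply to (-1)^m; removal is similar. For v_{m+1} the sign comes from |I| + |J| = m. -/
theorem delta_gamma_basis (m : ℕ) (v : V m) (I J : Finset (Fin m)) :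
    delta m (gamma m v (wBasis m I)) (wBasis m J) =
      (-1) ^ m * delta m (wBasis m I) (gamma m v (wBasis m J)) := by
  have hlt : ∀ i : Fin m, delta m (gamma m (vec m (i + 1)) (wBasis m I)) (wBasis m J) =
      (-1) ^ m * delta m (wBasis m I) (gamma m (vec m (i + 1)) (wBasis m J)) := by
    intro i
    rw [gamma_vec_lt, gamma_vec_lt]
    by_cases hi : i ∈ I
    · rw [if_pos hi, map_zero, LinearMap.zero_apply]
      split_ifs with hJ
      · simp
      · rw [map_smul, delta_basis, if_neg]
        · simp
        · intro h
          have : i ∈ Iᶜ := h ▸ Finset.mem_insert_self i J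
          exact Finset.mem_compl.1 this hi
    · rw [if_neg hi, map_smul, LinearMap.smul_apply, delta_basis]
      by_cases hJ : J = (insert i I)ᶜ
      · have h1 : i ∉ J := by simp [hJ]
        have h2 : insert i J = Iᶜ := by
          rw [hJ, Finset.compl_insert, Finset.insert_erase (Finset.mem_compl.2 hi)]
        rw [if_pos hJ, if_neg h1, map_smul, delta_basis, if_pos h2, weight_insert hi, hJ, sgn_compl,
          sgn_insert_self, smul_eq_mul, smul_eq_mul, pow_add]
        have : (-1 : ℂ) ^ (m - i) = (-1) ^ m * (-1) ^ (i : ℕ) := by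
          rw [← pow_add]; exact neg_one_pow_congr (by omega)
        rw [this]; ring
      · rw [if_neg hJ, smul_zero]
        split_ifs with h1
        · simp
        · rw [map_smul, delta_basis, if_neg]
          · simp
          · intro h
            exact hJ (by rw [Finset.compl_insert, ← h, Finset.erase_insert h1])
  have hgt : ∀ i : Fin m, delta m (gamma m (vec m (2 * m + 1 - i)) (wBasis m I)) (wBasis m J) =
      (-1) ^ m * delta m (wBasis m I) (gamma m (vec m (2 * m + 1 - i)) (wBasis m J)) := by
    intro i
    rw [gamma_vec_gt, gamma_vec_gt]
    by_cases hi : i ∈ I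
    · rw [if_pos hi, map_smul, LinearMap.smul_apply, delta_basis]
      by_cases hJ : J = (I.erase i)ᶜ
      · have h1 : i ∈ J := by simp [hJ]
        have h2 : J.erase i = Iᶜ := by
          rw [hJ, Finset.compl_erase, Finset.erase_insert (by simpa using hi)]
        have h3 := weight_insert (Finset.notMem_erase i I)
        rw [Finset.insert_erase hi] at h3
        rw [if_pos hJ, if_pos h1, map_smul, delta_basis, if_pos h2, h3, hJ, sgn_compl,
          sgn_erase_self, smul_eq_mul, smul_eq_mul, pow_add _ (m - (i : ℕ))]
        have h4 : (-1 : ℂ) ^ (m - i) = (-1) ^ m * (-1) ^ (i : ℕ) := by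
          rw [← pow_add]; exact neg_one_pow_congr (by omega)
        have h5 := neg_one_pow_mul_self m
        have h6 := neg_one_pow_mul_self i
        rw [h4]
        linear_combination (-(-1 : ℂ) ^ (m + (i : ℕ)) * sgn i I * (-1) ^ weight m (I.erase i)) *
          (-1 : ℂ) ^ (i : ℕ) * (-1 : ℂ) ^ (i : ℕ) * h5 -
          (-1 : ℂ) ^ (m + (i : ℕ)) * sgn i I * (-1) ^ weight m (I.erase i) * h6
      · rw [if_neg hJ, smul_zero]
        split_ifs with h1
        · rw [map_smul, delta_basis, if_neg]
          · simp
          · intro h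
            exact hJ (by rw [Finset.compl_erase, ← h, Finset.insert_erase h1])
        · simp
    · rw [if_neg hi, map_zero, LinearMap.zero_apply]
      split_ifs with h1
      · rw [map_smul, delta_basis, if_neg]
        · simp
        · intro h
          have : i ∈ Iᶜ := Finset.mem_compl.2 hi
          rw [← h] at this
          exact Finset.notMem_erase _ _ this
      · simp
  have hmid : delta m (gamma m (vec m (m + 1)) (wBasis m I)) (wBasis m J) =
      (-1) ^ m * delta m (wBasis m I) (gamma m (vec m (m + 1)) (wBasis m J)) := by
    rw [gamma_vec_mid, gamma_vec_mid, map_smul, map_smul, LinearMap.smul_apply, delta_basis]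
    split_ifs with h
    · have h1 : m = I.card + J.card := by
        rw [h, Finset.card_add_card_compl, Fintype.card_fin]
      have h2 : (-1 : ℂ) ^ m = (-1) ^ I.card * (-1) ^ J.card := by rw [← pow_add, ← h1]
      rw [h2, smul_eq_mul, smul_eq_mul]
      linear_combination (-(1 / (Real.sqrt 2 : ℂ)) * (-1) ^ I.card * (-1) ^ weight m I) *
        neg_one_pow_mul_self J.card
    · simp
  have hv : v = ∑ k : Fin (2 * m + 1), v k • vec m (k + 1) := by
    funext l
    simp [Finset.sum_apply, vec, Fin.val_inj]
  rw [hv]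
  simp only [map_sum, map_smul, LinearMap.sum_apply, LinearMap.smul_apply, Finset.mul_sum]
  refine Finset.sum_congr rfl fun k _ => ?_
  rw [smul_eq_mul, smul_eq_mul, mul_left_comm]
  congr 1
  rcases lt_trichotomy (k : ℕ) m with h | h | h
  · exact hlt ⟨k, h⟩
  · rw [h]; exact hmid
  · have := hgt ⟨2 * m - k, by omega⟩
    rwa [show 2 * m + 1 - (2 * m - (k : ℕ)) = k + 1 by omega] at this

theorem delta_gamma (m : ℕ) (v : V m) (a b : VSpin m) :
    delta m (gamma m v a) b = (-1) ^ m * delta m a (gamma m v b) := by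
  suffices h : delta m ∘ₗ gamma m v = (-1 : ℂ) ^ m • (delta m).compl₂ (gamma m v) from
    LinearMap.congr_fun (LinearMap.congr_fun h a) b
  exact (wBasis m).ext fun I => (wBasis m).ext fun J => delta_gamma_basis m v I J

/-- Taking δ-adjoints reverses products, and each of the k vectors contributes (-1)^m. -/
theorem delta_spinRep_of_mem_pow (m k : ℕ) (x : Cl m)
    (hx : x ∈ LinearMap.range (CliffordAlgebra.ι (quad m)) ^ k) (a b : VSpin m) :
    delta m (spinRep m x a) b =
      (-1) ^ (m * k) * delta m a (spinRep m (CliffordAlgebra.reverse x) b) := by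
  induction hx using Submodule.pow_induction_on_left' generalizing a b with
  | algebraMap r =>
    rw [CliffordAlgebra.reverse.commutes, AlgHom.commutes, Module.algebraMap_end_apply,
      Module.algebraMap_end_apply, map_smul, map_smul, LinearMap.smul_apply, mul_zero, pow_zero,
      one_mul]
  | add x y i hx hy ihx ihy =>
    simp only [map_add, LinearMap.add_apply, ihx, ihy, mul_add]
  | mem_mul c hc i x hx ih =>
    obtain ⟨v, rfl⟩ := hc
    rw [map_mul, Module.End.mul_apply, spinRep_ι, delta_gamma, ih, CliffordAlgebra.reverse.map_mul,
      CliffordAlgebra.reverse_ι, map_mul, Module.End.mul_apply, spinRep_ι, ← mul_assoc, ← pow_add]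
    congr 2
    rw [Nat.mul_succ, add_comm]

theorem delta_spinRep_of_even (m : ℕ) (x : Cl m)
    (hx : x ∈ CliffordAlgebra.evenOdd (quad m) 0) (a b : VSpin m) :
    delta m (spinRep m x a) b = delta m a (spinRep m (CliffordAlgebra.reverse x) b) := by
  rw [CliffordAlgebra.evenOdd] at hx
  induction hx using Submodule.iSup_induction' with
  | mem i x hx =>
    have h : Even (i : ℕ) := (ZMod.natCast_eq_zero_iff_even).1 i.2
    rw [delta_spinRep_of_mem_pow m _ x hx, (h.mul_left m).neg_one_pow, one_mul]
  | zero => simp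
  | add x y _ _ hx hy => simp only [map_add, LinearMap.add_apply, hx, hy]

/-! ### The embedding `ι` of `Sym² V_Spin` into `End(V_Spin)` -/

theorem sym_induction {M : Type} [AddCommGroup M] [Module ℂ M] {C : Sym[ℂ]^2 M → Prop}
    (mul : ∀ a b, C (symMul a b)) (smul : ∀ (r : ℂ) s, C s → C (r • s)) (zero : C 0)
    (add : ∀ s t, C s → C t → C (s + t)) (s : Sym[ℂ]^2 M) : C s := by
  have hs : s ∈ Submodule.span ℂ (Set.range (SymmetricPower.tprod ℂ (ι := Fin 2) (M := M))) := by
    rw [SymmetricPower.span_tprod_eq_top]; exact Submodule.mem_top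
  induction hs using Submodule.span_induction with
  | mem x hx =>
    obtain ⟨v, rfl⟩ := hx
    have : v = ![v 0, v 1] := by funext i; fin_cases i <;> rfl
    rw [this]; exact mul _ _
  | zero => exact zero
  | add x y _ _ hx hy => exact add x y hx hy
  | smul r x _ hx => exact smul r x hx

/-- Multiplication back into Sym² is a left inverse, thanks to the factor ½. -/
theorem symToTensor_injective {M : Type} [AddCommGroup M] [Module ℂ M] :
    Function.Injective (symToTensor (M := M)) := by
  refine Function.LeftInverse.injective (g := TensorProduct.lift symMulB) fun s => ?_
  induction s using sym_induction with
  | mul a b =>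
    rw [symToTensor, symLift_symMul]
    simp only [LinearMap.smul_apply, LinearMap.add_apply, TensorProduct.mk_apply,
      LinearMap.flip_apply, map_smul, map_add, TensorProduct.lift.tmul]
    change (1 / 2 : ℂ) • (symMul a b + symMul b a) = symMul a b
    rw [symMul_comm b a, ← two_smul ℂ, smul_smul]
    norm_num
  | smul r s hs => rw [map_smul, map_smul, hs]
  | zero => simp
  | add s t hs ht => rw [map_add, map_add, hs, ht]

/-- The isomorphism `V_Spin ⊗ V_Spin → V_Spin* ⊗ V_Spin → End(V_Spin)`. -/
def tensorToEnd (m : ℕ) : VSpin m ⊗[ℂ] VSpin m →ₗ[ℂ] Module.End ℂ (VSpin m) :=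
  dualTensorHom ℂ (VSpin m) (VSpin m) ∘ₗ TensorProduct.map (delta m) LinearMap.id

theorem tensorToEnd_bijective (m : ℕ) : Function.Bijective (tensorToEnd m) := by
  have := finite_vSpin m
  have h1 := (dualTensorHomEquivOfBasis (N := VSpin m) (wBasis m)).bijective
  have h2 := (TensorProduct.congr (LinearEquiv.ofBijective (delta m) (delta_bijective m))
    (LinearEquiv.refl ℂ (VSpin m))).bijective
  exact h1.comp h2

theorem tensorToEnd_tmul (m : ℕ) (a b x : VSpin m) :
    tensorToEnd m (a ⊗ₜ b) x = delta m a x • b := by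
  rw [tensorToEnd, LinearMap.comp_apply, TensorProduct.map_tmul, dualTensorHom_apply]
  rfl

theorem symToEnd_injective (m : ℕ) : Function.Injective (symToEnd m) :=
  (tensorToEnd_bijective m).1.comp symToTensor_injective

theorem symToEnd_symMul (m : ℕ) (a b x : VSpin m) :
    symToEnd m (symMul a b) x = (1 / 2 : ℂ) • (delta m a x • b + delta m b x • a) := by
  change tensorToEnd m (symToTensor (symMul a b)) x = _
  rw [symToTensor, symLift_symMul]
  simp only [LinearMap.smul_apply, LinearMap.add_apply, TensorProduct.mk_apply,
    LinearMap.flip_apply, map_smul, map_add, tensorToEnd_tmul]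

/-- Writing A as the image of a tensor t, the product of t in Sym² is sent to the average of A and
its transpose for δ. The hypothesis says that A is its own transpose. -/
theorem mem_range_symToEnd (m : ℕ) (A : Module.End ℂ (VSpin m))
    (hA : ∀ x y, delta m y (A x) = delta m x (A y)) : ∃ s, symToEnd m s = A := by
  obtain ⟨t, rfl⟩ := (tensorToEnd_bijective m).2 A
  have key : ∀ t x y, delta m y (symToEnd m (TensorProduct.lift symMulB t) x) =
      (1 / 2 : ℂ) * (delta m y (tensorToEnd m t x) + delta m x (tensorToEnd m t y)) := by
    intro t x y
    induction t using TensorProduct.induction_on with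
    | zero => simp
    | tmul a b =>
      rw [TensorProduct.lift.tmul]
      change delta m y (symToEnd m (symMul a b) x) = _
      rw [symToEnd_symMul, tensorToEnd_tmul, tensorToEnd_tmul]
      simp only [map_smul, map_add, smul_eq_mul]
      rw [delta_symm m x b, delta_symm m a y]
      linear_combination (1 / 2 * delta m x b * delta m a y) *
        neg_one_pow_mul_self (m * (m + 1) / 2)
    | add s t hs ht => simp only [map_add, LinearMap.add_apply, hs, ht]; ring
  refine ⟨TensorProduct.lift symMulB t, LinearMap.ext fun x => ?_⟩
  have h : ∀ y, delta m y (symToEnd m (TensorProduct.lift symMulB t) x) =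
      delta m y (tensorToEnd m t x) := by
    intro y
    rw [key, ← hA]; ring
  apply delta_injective m
  refine LinearMap.ext fun y => ?_
  rw [delta_symm m y, delta_symm m y, h]

theorem symMap_symMul {M : Type} [AddCommGroup M] [Module ℂ M] (T : Module.End ℂ M) (a b : M) :
    symMap T (symMul a b) = symMul (T a) (T b) := symLift_symMul _ _ a b

theorem symDer_symMul {M : Type} [AddCommGroup M] [Module ℂ M] (T : Module.End ℂ M) (a b : M) :
    symDer T (symMul a b) = symMul (T a) b + symMul a (T b) := symLift_symMul _ _ a b

theorem symToEnd_symMap (m : ℕ) (T T' : Module.End ℂ (VSpin m))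
    (hT : ∀ a b, delta m (T a) b = delta m a (T' b)) (s : Sym[ℂ]^2 (VSpin m)) :
    symToEnd m (symMap T s) = T * symToEnd m s * T' := by
  induction s using sym_induction with
  | mul a b =>
    rw [symMap_symMul]
    refine LinearMap.ext fun x => ?_
    rw [Module.End.mul_apply, Module.End.mul_apply, symToEnd_symMul, symToEnd_symMul, hT, hT,
      map_smul, map_add, map_smul, map_smul]
  | smul r s hs => rw [map_smul, map_smul, hs, map_smul, mul_smul_comm, smul_mul_assoc]
  | zero => simp
  | add s t hs ht => rw [map_add, map_add, hs, ht, map_add, mul_add, add_mul]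

theorem symToEnd_symDer (m : ℕ) (T : Module.End ℂ (VSpin m))
    (hT : ∀ a b, delta m (T a) b = -delta m a (T b)) (s : Sym[ℂ]^2 (VSpin m)) :
    symToEnd m (symDer T s) = T * symToEnd m s - symToEnd m s * T := by
  induction s using sym_induction with
  | mul a b =>
    rw [symDer_symMul]
    refine LinearMap.ext fun x => ?_
    rw [map_add, LinearMap.add_apply, LinearMap.sub_apply, Module.End.mul_apply,
      Module.End.mul_apply, symToEnd_symMul, symToEnd_symMul, symToEnd_symMul, symToEnd_symMul, hT,
      hT, map_smul, map_add, map_smul, map_smul]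
    module
  | smul r s hs => rw [map_smul, map_smul, hs, map_smul, mul_smul_comm, smul_mul_assoc, smul_sub]
  | zero => simp
  | add s t hs ht => rw [map_add, map_add, hs, ht, map_add, mul_add, add_mul]; abel

/-! ### Reversal -/

theorem list_prod_mul_ι {M : Type} [AddCommGroup M] [Module ℂ M] (L : List M) (v : M) :
    (L.map (ExteriorAlgebra.ι ℂ)).prod * ExteriorAlgebra.ι ℂ v =
      (-1 : ℂ) ^ L.length • (ExteriorAlgebra.ι ℂ v * (L.map (ExteriorAlgebra.ι ℂ)).prod) := by
  induction L with
  | nil => simp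
  | cons u L ih =>
    rw [List.map_cons, List.prod_cons, mul_assoc, ih, mul_smul_comm, ι_mul_ι_mul_comm,
      List.length_cons, pow_succ, mul_smul]
    simp

theorem list_prod_reverse {M : Type} [AddCommGroup M] [Module ℂ M] (L : List M) :
    (L.reverse.map (ExteriorAlgebra.ι ℂ)).prod =
      (-1 : ℂ) ^ (L.length * (L.length - 1) / 2) • (L.map (ExteriorAlgebra.ι ℂ)).prod := by
  induction L with
  | nil => simp
  | cons v L ih =>
    rw [List.reverse_cons, List.map_append, List.prod_append, ih, List.map_singleton,
      List.prod_singleton, smul_mul_assoc, list_prod_mul_ι, smul_smul, ← pow_add, List.map_cons,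
      List.prod_cons, List.length_cons]
    congr 2
    rw [← Finset.sum_range_id, ← Finset.sum_range_id, Finset.sum_range_succ]

theorem reverse_ofFn {α : Type} {n : ℕ} (f : Fin n → α) :
    (List.ofFn f).reverse = List.ofFn fun i => f i.rev := by
  refine List.ext_getElem (by simp) fun i h1 h2 => ?_
  rw [List.getElem_reverse, List.getElem_ofFn, List.getElem_ofFn]
  congr 1
  exact Fin.ext (by simp only [Fin.val_rev, List.length_ofFn]; omega)

/-- On an orthogonal basis the antisymmetrization is a single product, and reversing k anticommuting
factors costs (-1)^{k(k-1)/2}. -/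
theorem reverse_antisym (m k : ℕ) (z : ⋀[ℂ]^k (V m)) :
    CliffordAlgebra.reverse (antisym m k z) = (-1 : ℂ) ^ (k * (k - 1) / 2) • antisym m k z := by
  suffices h : CliffordAlgebra.reverse ∘ₗ antisym m k =
      (-1 : ℂ) ^ (k * (k - 1) / 2) • antisym m k from LinearMap.congr_fun h z
  obtain ⟨b, hb⟩ := LinearMap.BilinForm.exists_orthogonal_basis (B := bil m) ⟨bil_symm m⟩
  apply exteriorPower.linearMap_ext
  refine b.ext_alternating fun v hv => ?_
  have h1 : antisym m k (exteriorPower.ιMulti ℂ k fun i => b (v i)) =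
      ((List.ofFn fun i => b (v i)).map (CliffordAlgebra.ι (quad m))).prod := by
    apply (toExt m).injective
    rw [toExt_antisym, List.map_ofFn]
    exact (toExt_prod_of_isOrtho m k (fun i => b (v i)) fun i j h => hb fun e => h (hv e)).symm
  simp only [LinearMap.compAlternatingMap_apply, LinearMap.comp_apply, LinearMap.smul_apply]
  apply (toExt m).injective
  rw [map_smul, toExt_antisym, h1, CliffordAlgebra.reverse_prod_map_ι, ← List.map_reverse,
    reverse_ofFn, List.map_ofFn, exteriorPower.ιMulti_apply_coe, ExteriorAlgebra.ιMulti_apply]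
  refine (toExt_prod_of_isOrtho m k (fun i => b (v i.rev))
    fun i j h => hb fun e => h (Fin.rev_injective (hv e))).trans ?_
  have h2 := list_prod_reverse (List.ofFn fun i => b (v i))
  rw [reverse_ofFn, List.map_ofFn, List.map_ofFn, List.length_ofFn] at h2
  exact h2

theorem antisym_mem_pow (m k : ℕ) (z : ⋀[ℂ]^k (V m)) :
    antisym m k z ∈ LinearMap.range (CliffordAlgebra.ι (quad m)) ^ k := by
  -- Membership becomes the vanishing of a linear map into the quotient, which can be tested on
  -- decomposable wedges.
  rw [← Submodule.Quotient.mk_eq_zero, ← Submodule.mkQ_apply, ← LinearMap.comp_apply]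
  suffices h : Submodule.mkQ _ ∘ₗ antisym m k = 0 from LinearMap.congr_fun h z
  apply exteriorPower.linearMap_ext
  ext1 u
  simp only [LinearMap.compAlternatingMap_apply, LinearMap.comp_apply, LinearMap.zero_apply]
  rw [Submodule.mkQ_apply, Submodule.Quotient.mk_eq_zero, antisym_ιMulti]
  refine Submodule.smul_mem _ _ (Submodule.sum_mem _ fun σ _ => ?_)
  rw [Units.smul_def]
  refine zsmul_mem ?_ _
  have h := list_prod_mem_pow (List.ofFn fun i => u (σ i))
  rwa [List.map_ofFn, List.length_ofFn] at h

theorem mem_evenOdd_of_mem_pow {m k : ℕ} {x : Cl m}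
    (hx : x ∈ LinearMap.range (CliffordAlgebra.ι (quad m)) ^ k) :
    x ∈ CliffordAlgebra.evenOdd (quad m) (k : ZMod 2) :=
  Submodule.mem_iSup_of_mem (⟨k, rfl⟩ : { n : ℕ // (n : ZMod 2) = k }) hx

theorem cast_mod_two (m : ℕ) : ((m % 2 : ℕ) : ZMod 2) = m :=
  (ZMod.natCast_eq_natCast_iff' _ _ _).2 (Nat.mod_mod m 2)

/-- The rule by which pr κ⁻¹ is evaluated: any Clifford element of the right parity with the given
action may be used. -/
theorem prWedge_kappaInv_spinRep (m : ℕ) (y : Cl m)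
    (hy : y ∈ CliffordAlgebra.evenOdd (quad m) (m : ZMod 2)) :
    prWedge m (kappaInv m (m % 2) (spinRep m y)) = extProj m (toExt m y) := by
  rw [kappaInv_spinRep m _ (Nat.mod_lt _ two_pos) y (by rwa [cast_mod_two])]
  rfl

/-- Three signs enter the symmetry condition: (-1)^{m(m+1)/2} from the symmetry of δ, (-1)^{m·m}
from the adjoint of m vectors, and (-1)^{m(m-1)/2} from reversal. The exponents add up to 2m², so
degree m lies in the image of ι. -/
theorem exists_symToEnd_eq_antisym (m : ℕ) (z : ⋀[ℂ]^m (V m)) :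
    ∃ s, symToEnd m s = spinRep m (antisym m m z) := by
  refine mem_range_symToEnd m _ fun x y => ?_
  rw [delta_symm, delta_spinRep_of_mem_pow m m _ (antisym_mem_pow m m z), reverse_antisym, map_smul,
    LinearMap.smul_apply, map_smul, smul_eq_mul, ← mul_assoc, ← mul_assoc, ← pow_add, ← pow_add,
    Even.neg_one_pow, one_mul]
  have h1 : m * (m + 1) / 2 + m * (m - 1) / 2 = m * m := by
    rw [← Nat.add_div_of_dvd_right (Nat.even_mul_succ_self m).two_dvd, ← mul_add]
    cases m with
    | zero => rfl
    | succ m =>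
      rw [Nat.add_sub_cancel, show m + 1 + 1 + m = 2 * (m + 1) by ring, mul_left_comm,
        Nat.mul_div_cancel_left _ two_pos]
  rw [add_right_comm, h1]
  exact ⟨m * m, rfl⟩


/-! ### The maps `c` and `d` -/

/-- The volume form `(-1)^{m(m+1)/2} v_1* ∧ ⋯ ∧ v_{2m+1}*`. -/
def volForm (m : ℕ) : ⋀[ℂ]^(2 * m + 1) (Module.Dual ℂ (V m)) :=
  (-1 : ℂ) ^ (m * (m + 1) / 2) • exteriorPower.ιMulti ℂ (2 * m + 1)
    fun k => (LinearMap.proj k : V m →ₗ[ℂ] ℂ)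

theorem coe_contraction (m : ℕ) (x : ⋀[ℂ]^m (V m)) :
    (contraction m x : ExteriorAlgebra ℂ (Module.Dual ℂ (V m))) =
      (contr (x : ExteriorAlgebra ℂ (V m))).unop
        (volForm m : ExteriorAlgebra ℂ (Module.Dual ℂ (V m))) := rfl

/-- The basis of linear forms dual to the standard basis of `V`. -/
def dualVecBasis (m : ℕ) : Module.Basis (Fin (2 * m + 1)) ℂ (Module.Dual ℂ (V m)) :=
  (Pi.basisFun ℂ (Fin (2 * m + 1))).dualBasis

theorem dualVecBasis_apply (m : ℕ) (k : Fin (2 * m + 1)) :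
    dualVecBasis m k = (LinearMap.proj k : V m →ₗ[ℂ] ℂ) := by
  refine LinearMap.ext fun v => ?_
  simp [dualVecBasis]

theorem dualVecBasis_coord (m : ℕ) (k : Fin (2 * m + 1)) :
    (dualVecBasis m).coord k = Module.Dual.eval ℂ (V m) (Pi.single k 1) := by
  refine (dualVecBasis m).ext fun l => ?_
  rw [Module.Basis.coord_apply, Module.Basis.repr_self, Module.Dual.eval_apply, dualVecBasis_apply,
    LinearMap.proj_apply, Finsupp.single_apply, Pi.single_apply]

theorem coe_volForm (m : ℕ) : (volForm m : ExteriorAlgebra ℂ (Module.Dual ℂ (V m))) =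
    (-1 : ℂ) ^ (m * (m + 1) / 2) • (dualVecBasis m).ExteriorAlgebra Finset.univ := by
  rw [extBasis_apply, Fin.sort_univ, ← List.ofFn_eq_map]
  simp only [dualVecBasis_apply]
  rfl

/-- The range contains the full monomial and is stable under contraction by vectors. Contracting by
basis vectors removes indices one at a time, so every basis monomial is reached. -/
theorem contr_volForm_surjective (m : ℕ) (ω : ExteriorAlgebra ℂ (Module.Dual ℂ (V m))) :
    ∃ x, (contr x).unop (volForm m : ExteriorAlgebra ℂ (Module.Dual ℂ (V m))) = ω := by
  set F : ExteriorAlgebra ℂ (V m) →ₗ[ℂ] ExteriorAlgebra ℂ (Module.Dual ℂ (V m)) :=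
    LinearMap.applyₗ (volForm m : ExteriorAlgebra ℂ (Module.Dual ℂ (V m))) ∘ₗ
      (MulOpposite.opLinearEquiv ℂ).symm.toLinearMap ∘ₗ contr.toLinearMap with hF
  have hFa : ∀ x, F x = (contr x).unop (volForm m : ExteriorAlgebra ℂ (Module.Dual ℂ (V m))) :=
    fun _ => rfl
  suffices h : LinearMap.range F = ⊤ by
    obtain ⟨x, hx⟩ := LinearMap.range_eq_top.1 h ω
    exact ⟨x, hx⟩
  have hc : ∀ (v : V m) (ω), ω ∈ LinearMap.range F →
      ctr (Module.Dual.eval ℂ (V m) v) ω ∈ LinearMap.range F := by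
    rintro v _ ⟨x, rfl⟩
    refine ⟨x * ExteriorAlgebra.ι ℂ v, ?_⟩
    rw [hFa, hFa, map_mul, MulOpposite.unop_mul, Module.End.mul_apply, contr,
      ExteriorAlgebra.lift_ι_apply]
    rfl
  have hb : ∀ S : Finset (Fin (2 * m + 1)),
      (dualVecBasis m).ExteriorAlgebra Sᶜ ∈ LinearMap.range F := by
    intro S
    induction S using Finset.induction_on with
    | empty =>
      rw [Finset.compl_empty]
      have h1 : F 1 = (volForm m : ExteriorAlgebra ℂ (Module.Dual ℂ (V m))) := by
        rw [hFa, map_one]; rfl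
      have h2 := Submodule.smul_mem (LinearMap.range F) ((-1 : ℂ) ^ (m * (m + 1) / 2)) ⟨1, h1⟩
      rwa [coe_volForm, smul_smul, neg_one_pow_mul_self, one_smul] at h2
    | insert i S hi ih =>
      have h1 := hc (Pi.single i 1) _ ih
      rw [← dualVecBasis_coord, ctr_extBasis, if_pos (Finset.mem_compl.2 hi)] at h1
      have h2 := Submodule.smul_mem _ (sgn i Sᶜ) h1
      rwa [smul_smul, sgn_mul_self, one_smul, ← Finset.compl_insert] at h2
  rw [eq_top_iff, ← (dualVecBasis m).ExteriorAlgebra.span_eq, Submodule.span_le]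
  rintro _ ⟨S, rfl⟩
  rw [← compl_compl S]
  exact hb Sᶜ

theorem contr_volForm_injective (m : ℕ) (x : ExteriorAlgebra ℂ (V m))
    (h : (contr x).unop (volForm m : ExteriorAlgebra ℂ (Module.Dual ℂ (V m))) = 0) : x = 0 := by
  set F : ExteriorAlgebra ℂ (V m) →ₗ[ℂ] ExteriorAlgebra ℂ (Module.Dual ℂ (V m)) :=
    LinearMap.applyₗ (volForm m : ExteriorAlgebra ℂ (Module.Dual ℂ (V m))) ∘ₗ
      (MulOpposite.opLinearEquiv ℂ).symm.toLinearMap ∘ₗ contr.toLinearMap with hF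
  have h1 := (Pi.basisFun ℂ (Fin (2 * m + 1))).ExteriorAlgebra
  have h2 := (dualVecBasis m).ExteriorAlgebra
  have := Module.Finite.of_basis h1
  have := Module.Finite.of_basis h2
  have hs : Function.Surjective F := contr_volForm_surjective m
  have hi := (LinearMap.injective_iff_surjective_of_finrank_eq_finrank
    (by rw [Module.finrank_eq_card_basis h1, Module.finrank_eq_card_basis h2])).2 hs
  exact hi (h.trans (map_zero F).symm)

theorem contraction_bijective (m : ℕ) : Function.Bijective (contraction m) := by
  have hi : Function.Injective (contraction m) := by
    rw [injective_iff_map_eq_zero]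
    intro x hx
    refine Subtype.ext (contr_volForm_injective m x ?_)
    rw [← coe_contraction, hx]; rfl
  refine ⟨hi, (LinearMap.injective_iff_surjective_of_finrank_eq_finrank ?_).1 hi⟩
  rw [exteriorPower.finrank_eq, exteriorPower.finrank_eq, Subspace.dual_finrank_eq,
    Module.finrank_fin_fun, Nat.choose_symm_half]

theorem dualityMap_bijective (m : ℕ) : Function.Bijective (dualityMap m) := by
  have hi : Function.Injective (dualityMap m) :=
    exteriorPower.map_injective (bil m) (LinearMap.ext fun φ => LinearMap.ext fun y => bil_sharp m φ y)
  refine ⟨hi, (LinearMap.injective_iff_surjective_of_finrank_eq_finrank ?_).1 hi⟩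
  rw [exteriorPower.finrank_eq, exteriorPower.finrank_eq, Subspace.dual_finrank_eq]

/-- The volume element of `⋀ V`. -/
def volElt (m : ℕ) : ⋀[ℂ]^(2 * m + 1) (V m) := exteriorPower.map (2 * m + 1) (sharp m) (volForm m)

/-- With d ∘ c in this form, its equivariance only requires that the form and the volume element be
invariant. -/
theorem coe_dualityMap_contraction (m : ℕ) (x : ⋀[ℂ]^m (V m)) :
    (dualityMap m (contraction m x) : ExteriorAlgebra ℂ (V m)) =
      (formContr (bil m) x).unop (volElt m : ExteriorAlgebra ℂ (V m)) := by
  rw [dualityMap, coe_exteriorPower_map, coe_contraction, volElt, coe_exteriorPower_map,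
    map_contr (bil m) (sharp m) fun v φ => by rw [bil_symm, bil_sharp]]

theorem dualityMap_contraction_map (m : ℕ) (T : Module.End ℂ (V m))
    (hT : ∀ u v, bil m (T u) (T v) = bil m u v)
    (hvol : exteriorPower.map (2 * m + 1) T (volElt m) = volElt m) (x : ⋀[ℂ]^m (V m)) :
    dualityMap m (contraction m (exteriorPower.map m T x)) =
      exteriorPower.map (m + 1) T (dualityMap m (contraction m x)) := by
  apply Subtype.ext
  rw [coe_dualityMap_contraction, coe_exteriorPower_map, coe_exteriorPower_map,
    coe_dualityMap_contraction, ← formContr_map (bil m) T hT, ← coe_exteriorPower_map,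
    ← coe_exteriorPower_map, hvol]

theorem dualityMap_contraction_extDer (m : ℕ) (X : Module.End ℂ (V m))
    (hX : ∀ u v, bil m (X u) v = -bil m u (X v))
    (hvol : derE (Pi.basisFun ℂ (Fin (2 * m + 1))) X (volElt m) = 0) (x : ⋀[ℂ]^m (V m)) :
    dualityMap m (contraction m (extDer m X x)) =
      extDer (m + 1) X (dualityMap m (contraction m x)) := by
  apply Subtype.ext
  rw [coe_dualityMap_contraction, coe_extDer (Pi.basisFun ℂ _), coe_extDer (Pi.basisFun ℂ _),
    coe_dualityMap_contraction, formContr_derE _ (bil m) X hX, hvol, map_zero, sub_zero]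

/-! ### Equivariance -/

theorem kappa_eq_spinRep (m p : ℕ) (z : WedgePar m p) :
    kappa m p z = spinRep m (∑ k : Deg m p, antisym m (k : ℕ) (z k)) := by
  simp [kappa]

theorem star_eq_reverse (m : ℕ) (g : spinGroup (quad m)) :
    star (g : Cl m) = CliffordAlgebra.reverse (g : Cl m) := by
  rw [CliffordAlgebra.star_def, spinGroup.involute_eq g.2]

theorem spin_mem_even (m : ℕ) (g : spinGroup (quad m)) :
    (g : Cl m) ∈ CliffordAlgebra.evenOdd (quad m) 0 := spinGroup.mem_even g.2

/-- The form is the scalar in the anticommutator of two vectors, and conjugation preserves scalars.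
-/
theorem bil_vecRep (m : ℕ) (g : spinGroup (quad m)) (u v : V m) :
    bil m (vecRep m g u) (vecRep m g v) = bil m u v := by
  have h1 : star (g : Cl m) * (g : Cl m) = 1 := spinGroup.star_mul_self_of_mem g.2
  have h2 : (g : Cl m) * star (g : Cl m) = 1 := spinGroup.mul_star_self_of_mem g.2
  have h3 := ι_anticomm m (vecRep m g u) (vecRep m g v)
  have h4 : ∀ a b : Cl m, (g : Cl m) * a * star (g : Cl m) * ((g : Cl m) * b * star (g : Cl m)) =
      g * (a * b) * star (g : Cl m) := by
    intro a b
    calc _ = (g : Cl m) * a * (star (g : Cl m) * (g : Cl m)) * b * star (g : Cl m) := by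
          simp only [mul_assoc]
      _ = _ := by rw [h1, mul_one]; simp only [mul_assoc]
  rw [ι_vecRep, ι_vecRep, h4, h4, ← add_mul, ← mul_add, ι_anticomm, ← Algebra.commutes, mul_assoc,
    h2, mul_one] at h3
  have : Nontrivial (Cl m) := (toExt m).toEquiv.nontrivial
  exact ((algebraMap ℂ (Cl m)).injective h3).symm

/-- No determinant is needed: the antisymmetrized volume element commutes with the even element g,
so conjugation by g fixes it. -/
theorem map_volElt (m : ℕ) (g : spinGroup (quad m)) :
    exteriorPower.map (2 * m + 1) (vecRep m g) (volElt m) = volElt m := by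
  have h1 : star (g : Cl m) * (g : Cl m) = 1 := spinGroup.star_mul_self_of_mem g.2
  have h2 : (g : Cl m) * star (g : Cl m) = 1 := spinGroup.mul_star_self_of_mem g.2
  have h := antisym_map m (2 * m + 1) g (star (g : Cl m)) h1 h2 (vecRep m g) (ι_vecRep m g) (volElt m)
  rw [commute_of_even m g _ (spin_mem_even m g) (by rw [toExt_antisym]; exact (volElt m).2),
    mul_assoc, h2, mul_one] at h
  apply Subtype.ext
  rw [← toExt_antisym, h, toExt_antisym]

theorem kappaInv_conj (m p : ℕ) (hp : p < 2) (g : spinGroup (quad m))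
    (A : Module.End ℂ (VSpin m)) (k : Deg m p) :
    kappaInv m p (spinRep m g * A * spinRep m (star (g : Cl m))) k =
      exteriorPower.map (k : ℕ) (vecRep m g) (kappaInv m p A k) := by
  have h1 : star (g : Cl m) * (g : Cl m) = 1 := spinGroup.star_mul_self_of_mem g.2
  have h2 : (g : Cl m) * star (g : Cl m) = 1 := spinGroup.mul_star_self_of_mem g.2
  obtain ⟨z, rfl⟩ := kappa_surjective m p hp A
  have h3 : spinRep m g * kappa m p z * spinRep m (star (g : Cl m)) =
      kappa m p fun k => exteriorPower.map (k : ℕ) (vecRep m g) (z k) := by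
    rw [kappa_eq_spinRep, kappa_eq_spinRep, ← map_mul, ← map_mul, Finset.mul_sum, Finset.sum_mul]
    congr 1
    exact Finset.sum_congr rfl fun k _ =>
      (antisym_map m k g _ h1 h2 (vecRep m g) (ι_vecRep m g) (z k)).symm
  rw [h3, kappaInv_kappa m p hp, kappaInv_kappa m p hp]

/-- Since g is even, its δ-adjoint is its reversal, which on the spin group is g⁻¹. Thus ι carries
the action on Sym² to conjugation, and κ, c and d respect conjugation. -/
theorem projection_symMap (m : ℕ) (g : spinGroup (quad m)) (s : Sym[ℂ]^2 (VSpin m)) :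
    projection m (symMap (spinRep m (g : Cl m)) s) =
      exteriorPower.map (m + 1) (vecRep m g) (projection m s) := by
  have h := symToEnd_symMap m (spinRep m (g : Cl m)) (spinRep m (star (g : Cl m)))
    (fun a b => by rw [delta_spinRep_of_even m g (spin_mem_even m g), star_eq_reverse]) s
  simp only [projection, LinearMap.comp_apply]
  rw [← dualityMap_contraction_map m (vecRep m g) (bil_vecRep m g) (map_volElt m g), h]
  congr 2
  exact kappaInv_conj m (m % 2) (Nat.mod_lt _ two_pos) g _ _

theorem skew_bil (m : ℕ) (X : Module.End ℂ (V m)) (hX : X ∈ skewAdjointLieSubalgebra (bil m))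
    (u v : V m) : bil m (X u) v = -bil m u (X v) := by
  rw [(LinearMap.mem_skewAdjointSubmodule (B := bil m) X).1 hX u v, Pi.neg_apply, map_neg]

theorem trace_skew (m : ℕ) (X : Module.End ℂ (V m)) (hX : ∀ u v, bil m (X u) v = -bil m u (X v)) :
    ∑ k, X (Pi.single k 1) k = 0 := by
  have h1 : ∀ k, X (Pi.single k 1) k = bil m (eps m k • Pi.single k.rev 1) (X (Pi.single k 1)) :=
    fun k => (bil_dualVec m k _).symm
  have h2 : ∑ k, X (Pi.single k 1) k = -∑ k, X (Pi.single k 1) k := by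
    conv_lhs => rw [← Equiv.sum_comp Fin.revPerm]
    rw [← Finset.sum_neg_distrib]
    refine Finset.sum_congr rfl fun k _ => ?_
    rw [h1, h1, Fin.revPerm_apply, Fin.rev_rev, eps_rev, map_smul, map_smul, LinearMap.smul_apply,
      LinearMap.smul_apply, bil_symm m (Pi.single k 1), hX, smul_neg]
  exact self_eq_neg.1 h2

/-- Adding the reversal turns each summand into an anticommutator, a scalar; these scalars sum to
the trace of X, which is zero. So the element acts skew-adjointly for δ. -/
theorem reverse_soToCl (m : ℕ) (X : Module.End ℂ (V m))
    (hX : ∀ u v, bil m (X u) v = -bil m u (X v)) :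
    CliffordAlgebra.reverse (soToCl m X) = -soToCl m X := by
  rw [eq_neg_iff_add_eq_zero, soToCl, map_smul, ← smul_add, map_sum, ← Finset.sum_add_distrib]
  have h : ∀ k, CliffordAlgebra.reverse (CliffordAlgebra.ι (quad m) (X (Pi.single k 1)) *
      CliffordAlgebra.ι (quad m) (eps m k • Pi.single k.rev 1)) +
      CliffordAlgebra.ι (quad m) (X (Pi.single k 1)) *
      CliffordAlgebra.ι (quad m) (eps m k • Pi.single k.rev 1) =
      algebraMap ℂ (Cl m) (X (Pi.single k 1) k) := by
    intro k
    rw [CliffordAlgebra.reverse.map_mul, CliffordAlgebra.reverse_ι, CliffordAlgebra.reverse_ι,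
      ι_anticomm, bil_dualVec]
  rw [Finset.sum_congr rfl fun k _ => h k, ← map_sum, trace_skew m X hX, map_zero, smul_zero]

theorem soToCl_mem_pow (m : ℕ) (X : Module.End ℂ (V m)) :
    soToCl m X ∈ LinearMap.range (CliffordAlgebra.ι (quad m)) ^ 2 := by
  rw [pow_two]
  exact Submodule.smul_mem _ _ (Submodule.sum_mem _ fun k _ =>
    Submodule.mul_mem_mul ⟨_, rfl⟩ ⟨_, rfl⟩)

theorem projection_symDer (m : ℕ) (X : Module.End ℂ (V m))
    (hX : X ∈ skewAdjointLieSubalgebra (bil m)) (s : Sym[ℂ]^2 (VSpin m)) :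
    projection m (symDer (spinRep m (soToCl m X)) s) = extDer (m + 1) X (projection m s) := by
  have hX' := skew_bil m X hX
  have hp : m % 2 < 2 := Nat.mod_lt _ two_pos
  have h := symToEnd_symDer m (spinRep m (soToCl m X)) (fun a b => by
    rw [delta_spinRep_of_mem_pow m 2 _ (soToCl_mem_pow m X), reverse_soToCl m X hX', map_neg,
      LinearMap.neg_apply, map_neg, mul_neg, Even.neg_one_pow ⟨m, mul_two m⟩, one_mul]) s
  simp only [projection, LinearMap.comp_apply]
  rw [← dualityMap_contraction_extDer m X hX', h]
  · obtain ⟨z, hz⟩ := kappa_surjective m (m % 2) hp (symToEnd m s)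
    have h3 : spinRep m (soToCl m X) * kappa m (m % 2) z - kappa m (m % 2) z *
        spinRep m (soToCl m X) = kappa m (m % 2) fun k => extDer (k : ℕ) X (z k) := by
      rw [kappa_eq_spinRep, kappa_eq_spinRep, ← map_mul, ← map_mul, ← map_sub, Finset.mul_sum,
        Finset.sum_mul, ← Finset.sum_sub_distrib]
      congr 1
      exact Finset.sum_congr rfl fun k _ =>
        (antisym_extDer m k _ X hX' (soToCl_bracket m X hX) (z k)).symm
    rw [← hz, h3, kappaInv_kappa m _ hp, kappaInv_kappa m _ hp]
    rfl
  · rw [derE_of_mem_top _ _ (by rw [Fintype.card_fin]; exact (volElt m).2)]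
    have := trace_skew m X hX'
    simp only [Module.Basis.coord_apply, Pi.basisFun_repr, Pi.basisFun_apply, this, zero_smul]

/-- A preimage under c and d lies in ⋀^m V. Its antisymmetrization is in the image of ι and has no
components in other degrees. -/
theorem projection_surjective (m : ℕ) : Function.Surjective (projection m) := by
  intro w
  obtain ⟨φ, rfl⟩ := (dualityMap_bijective m).2 w
  obtain ⟨z, rfl⟩ := (contraction_bijective m).2 φ
  obtain ⟨s, hs⟩ := exists_symToEnd_eq_antisym m z
  refine ⟨s, ?_⟩
  simp only [projection, LinearMap.comp_apply]
  rw [hs, prWedge_kappaInv_spinRep m _ (mem_evenOdd_of_mem_pow (antisym_mem_pow m m z)),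
    toExt_antisym, Subtype.ext (extProj_of_mem z.2)]


/-! ### Monomials in the Clifford algebra -/

theorem clMonomial_empty (m : ℕ) : clMonomial m ∅ = 1 := by
  rw [clMonomial, Finset.sort_empty, List.map_nil, List.prod_nil]

theorem clMonomial_insert_min (m a : ℕ) (S : Finset ℕ) (h : ∀ s ∈ S, a < s) :
    clMonomial m (insert a S) = CliffordAlgebra.ι (quad m) (vec m a) * clMonomial m S := by
  rw [clMonomial, Finset.sort_insert _ (fun i hi => (h i hi).le) fun ha => lt_irrefl _ (h a ha),
    List.map_cons, List.prod_cons, clMonomial]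

theorem clMonomial_insert_max (m b : ℕ) (S : Finset ℕ) (h : ∀ s ∈ S, s < b) :
    clMonomial m (insert b S) = clMonomial m S * CliffordAlgebra.ι (quad m) (vec m b) := by
  induction S using Finset.induction_on_min with
  | empty =>
    rw [clMonomial_insert_min m b ∅ (by simp), clMonomial_empty, one_mul, mul_one]
  | insert a S ha ih =>
    have hab : a < b := h a (Finset.mem_insert_self _ _)
    rw [Finset.insert_comm, clMonomial_insert_min m a (insert b S), ih fun s hs => h s
      (Finset.mem_insert_of_mem hs), clMonomial_insert_min m a S ha, mul_assoc]
    intro s hs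
    rcases Finset.mem_insert.1 hs with rfl | hs
    · exact hab
    · exact ha s hs

theorem clMonomial_mem_pow (m : ℕ) (S : Finset ℕ) :
    clMonomial m S ∈ LinearMap.range (CliffordAlgebra.ι (quad m)) ^ S.card := by
  have h := list_prod_mem_pow ((S.sort (· ≤ ·)).map (vec m))
  rwa [List.map_map, List.length_map, Finset.length_sort] at h

theorem bil_vec_eq_zero (m i j : ℕ) (h : i + j ≠ 2 * m + 2) : bil m (vec m i) (vec m j) = 0 := by
  rw [bil_apply]
  refine Finset.sum_eq_zero fun k _ => ?_
  simp only [vec, Fin.val_rev]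
  split_ifs with h1 h2
  · omega
  all_goals simp

theorem ι_mul_clMonomial (m a : ℕ) (S : Finset ℕ) (h : ∀ s ∈ S, a + s ≠ 2 * m + 2) :
    CliffordAlgebra.ι (quad m) (vec m a) * clMonomial m S =
      (-1 : ℂ) ^ S.card • (clMonomial m S * CliffordAlgebra.ι (quad m) (vec m a)) := by
  induction S using Finset.induction_on_min with
  | empty => simp [clMonomial_empty]
  | insert b S hb ih =>
    have h1 := ι_anticomm m (vec m a) (vec m b)
    rw [bil_vec_eq_zero m a b (h b (Finset.mem_insert_self _ _)), map_zero] at h1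
    rw [clMonomial_insert_min m b S hb, ← mul_assoc, eq_neg_of_add_eq_zero_left h1, neg_mul,
      mul_assoc, ih fun s hs => h s (Finset.mem_insert_of_mem hs), mul_smul_comm, mul_assoc,
      Finset.card_insert_of_notMem fun hs => lt_irrefl _ (hb b hs), pow_succ]
    simp

/-- The indices `i` with `a ≤ i ≤ b`, in `1`-based numbering. -/
def seg (m a b : ℕ) : Finset (Fin m) := Finset.univ.filter fun i => a ≤ (i : ℕ) + 1 ∧ (i : ℕ) + 1 ≤ b

theorem mem_seg {m a b : ℕ} {i : Fin m} : i ∈ seg m a b ↔ a ≤ (i : ℕ) + 1 ∧ (i : ℕ) + 1 ≤ b := by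
  simp [seg]

/-- `1` if `i` belongs to `C` in `1`-based numbering, and `0` otherwise. -/
def occ (m : ℕ) (C : Finset (Fin m)) (i : ℕ) : ℂ := if ∃ c ∈ C, (c : ℕ) + 1 = i then 1 else 0

/-- The pairs v_i, v̄_i are nested around T. Moving the outermost v_a rightwards to v̄_a passes 2|I|
+ |T| vectors orthogonal to it, with net sign (-1)^{|T|}. The adjacent product v_a v̄_a is a signed
occupation number, diagonal on the basis, so the pairs peel off as scalars. -/
theorem spinRep_clMonomial_nested (m : ℕ) (T I : Finset ℕ) (hI : ∀ i ∈ I, 1 ≤ i ∧ i ≤ m)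
    (hT : ∀ t ∈ T, ∀ i ∈ I, i < t ∧ t < 2 * m + 2 - i) (C : Finset (Fin m)) :
    spinRep m (clMonomial m (I ∪ T ∪ I.image fun i => 2 * m + 2 - i)) (wBasis m C) =
      (∏ i ∈ I, ((-1) ^ (T.card + m + i + 1) * occ m C i)) •
        spinRep m (clMonomial m T) (wBasis m C) := by
  induction I using Finset.induction_on_min with
  | empty => simp
  | insert a I ha ih =>
    have haI : a ∉ I := fun h => lt_irrefl _ (ha a h)
    have ha1 := hI a (Finset.mem_insert_self _ _)
    have hI' := fun i hi => hI i (Finset.mem_insert_of_mem hi)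
    have hT' := fun t ht i hi => hT t ht i (Finset.mem_insert_of_mem hi)
    set S := I ∪ T ∪ I.image fun i => 2 * m + 2 - i with hS
    have hb : ∀ s ∈ S, a < s ∧ s < 2 * m + 2 - a := by
      intro s hs
      rw [hS, Finset.mem_union, Finset.mem_union, Finset.mem_image] at hs
      rcases hs with (hs | hs) | ⟨i, hi, rfl⟩
      · have := ha s hs; have := hI' s hs; omega
      · exact hT s hs a (Finset.mem_insert_self _ _)
      · have := ha i hi; have := hI' i hi; omega
    have hcard : S.card = 2 * I.card + T.card := by
      rw [hS, Finset.card_union_of_disjoint, Finset.card_union_of_disjoint,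
        Finset.card_image_of_injOn]
      · ring
      · intro x hx y hy hxy
        have := hI' x hx; have := hI' y hy
        simp only at hxy
        omega
      · rw [Finset.disjoint_left]
        intro s hs hs'
        exact lt_irrefl _ (hT' s hs' s hs).1
      · rw [Finset.disjoint_left]
        intro s hs hs'
        obtain ⟨i, hi, rfl⟩ := Finset.mem_image.1 hs'
        have h1 := hI' i hi
        rcases Finset.mem_union.1 hs with hs | hs
        · have := hI' _ hs; omega
        · exact lt_irrefl _ (hT' _ hs i hi).2
    have h1 : insert a I ∪ T ∪ (insert a I).image (fun i => 2 * m + 2 - i) =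
        insert a (insert (2 * m + 2 - a) S) := by
      rw [Finset.image_insert, Finset.insert_union, Finset.insert_union, Finset.union_insert]
    have h2 : CliffordAlgebra.ι (quad m) (vec m a) * (clMonomial m S *
        CliffordAlgebra.ι (quad m) (vec m (2 * m + 2 - a))) = (-1 : ℂ) ^ T.card • (clMonomial m S *
        (CliffordAlgebra.ι (quad m) (vec m a) *
          CliffordAlgebra.ι (quad m) (vec m (2 * m + 2 - a)))) := by
      rw [← mul_assoc, ι_mul_clMonomial m a S fun s hs => by have := hb s hs; omega, smul_mul_assoc,
        mul_assoc, hcard, pow_add, pow_mul]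
      norm_num
    have h3 : (spinRep m (CliffordAlgebra.ι (quad m) (vec m a) *
        CliffordAlgebra.ι (quad m) (vec m (2 * m + 2 - a)))) (wBasis m C) =
        ((-1) ^ (m + a + 1) * occ m C a) • wBasis m C := by
      have h4 := number_apply m ⟨a - 1, by omega⟩ C
      simp only [Nat.sub_add_cancel ha1.1] at h4
      rw [show 2 * m + 1 - (a - 1) = 2 * m + 2 - a by omega] at h4
      rw [map_mul, spinRep_ι, spinRep_ι, h4, occ]
      by_cases hc : (⟨a - 1, by omega⟩ : Fin m) ∈ C
      · rw [if_pos hc, if_pos ⟨_, hc, Nat.sub_add_cancel ha1.1⟩, mul_one,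
          neg_one_pow_congr (show (m + (a - 1)) % 2 = (m + a + 1) % 2 by omega)]
      · rw [if_neg hc, if_neg, mul_zero, zero_smul]
        rintro ⟨c, hc1, hc2⟩
        refine hc ?_
        convert hc1
        omega
    rw [h1, clMonomial_insert_min m a, clMonomial_insert_max m _ S fun s hs => (hb s hs).2, h2,
      map_smul, map_mul, LinearMap.smul_apply, Module.End.mul_apply, h3, map_smul, ih hI' hT',
      Finset.prod_insert haI, smul_smul, smul_smul]
    · congr 1
      rw [add_assoc T.card m, add_assoc T.card, pow_add]
      ring
    · intro s hs
      rcases Finset.mem_insert.1 hs with rfl | hs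
      · omega
      · exact (hb s hs).1

/-- The number of elements of `C` smaller than `a`, in `1`-based numbering. -/
def below (m : ℕ) (C : Finset (Fin m)) (a : ℕ) : ℕ := (C.filter fun i : Fin m => (i : ℕ) + 1 < a).card

theorem sgn_eq_below {m : ℕ} (i : Fin m) (C : Finset (Fin m)) :
    sgn i C = (-1) ^ below m C (i + 1) := by
  rw [sgn, below]
  congr 2
  ext k
  simp only [Finset.mem_filter, Fin.lt_def, add_lt_add_iff_right]

/-- The largest index is created first. Each later v_i therefore passes only the elements of C below
the segment, and all d factors give the same sign. -/
theorem spinRep_clMonomial_create (m l : ℕ) (hl : l ≤ m) (d : ℕ) (C : Finset (Fin m)) :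
    ∀ a, a + d = l + 1 → 1 ≤ a →
    spinRep m (clMonomial m (Finset.Icc a l)) (wBasis m C) =
      if Disjoint C (seg m a l) then (-1 : ℂ) ^ (d * below m C a) • wBasis m (C ∪ seg m a l)
      else 0 := by
  induction d with
  | zero =>
    intro a ha _
    have h1 : seg m a l = ∅ := by
      ext i; simp only [mem_seg, Finset.notMem_empty, iff_false]; omega
    rw [Finset.Icc_eq_empty (by omega), clMonomial_empty, h1, if_pos (Finset.disjoint_empty_right _)]
    simp
  | succ d ih =>
    intro a ha ha1
    set i : Fin m := ⟨a - 1, by omega⟩ with hi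
    have hi1 : (i : ℕ) + 1 = a := by simp only [hi]; omega
    have h1 : seg m a l = insert i (seg m (a + 1) l) := by
      ext k
      simp only [mem_seg, Finset.mem_insert, Fin.ext_iff]
      omega
    have h2 : Finset.Icc a l = insert a (Finset.Icc (a + 1) l) := by
      ext k; simp only [Finset.mem_Icc, Finset.mem_insert]; omega
    have h3 : i ∉ seg m (a + 1) l := by rw [mem_seg]; omega
    rw [h2, clMonomial_insert_min m a _ (fun s hs => by have := Finset.mem_Icc.1 hs; omega), map_mul,
      Module.End.mul_apply, ih (a + 1) (by omega) (by omega), spinRep_ι, h1]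
    by_cases hd : Disjoint C (seg m (a + 1) l)
    · rw [if_pos hd, map_smul, ← hi1, gamma_vec_lt, hi1]
      by_cases hC : i ∈ C
      · rw [if_pos (Finset.mem_union_left _ hC), if_neg fun h =>
          (Finset.disjoint_insert_right.1 h).1 hC, smul_zero]
      · rw [if_neg (by simp [hC, h3]), if_pos (Finset.disjoint_insert_right.2 ⟨hC, hd⟩), smul_smul, ← Finset.union_insert]
        congr 1
        have e1 : below m C (a + 1) = below m C a := by
          rw [below, below]
          congr 1
          ext k
          simp only [Finset.mem_filter]
          refine and_congr_right fun hk => ?_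
          have : k ≠ i := fun e => hC (e ▸ hk)
          rw [Ne, Fin.ext_iff] at this
          omega
        have e2 : below m (C ∪ seg m (a + 1) l) a = below m C a := by
          rw [below, below]
          congr 1
          ext k
          simp only [Finset.mem_filter, Finset.mem_union, mem_seg]
          constructor
          · rintro ⟨h | h, h'⟩
            · exact ⟨h, h'⟩
            · omega
          · exact fun h => ⟨Or.inl h.1, h.2⟩
        rw [sgn_eq_below, hi1, e1, e2, ← pow_add, Nat.succ_mul]
    · rw [if_neg hd, if_neg fun h => hd (Finset.disjoint_insert_right.1 h).2, map_zero]

/-- These indices are those of v̄_{l+d}, …, v̄_{l+1}, and v̄_{l+1} acts first. When a later factor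
acts, the smaller elements of the segment are gone, so only elements up to l are counted. The signs
ε multiply to the parity of the weight. -/
theorem spinRep_clMonomial_annihilate (m l d : ℕ) (hl : l + d ≤ m) (C : Finset (Fin m)) :
    spinRep m (clMonomial m (Finset.Icc (2 * m + 2 - (l + d)) (2 * m + 1 - l))) (wBasis m C) =
      if seg m (l + 1) (l + d) ⊆ C then
        ((-1 : ℂ) ^ weight m (seg m (l + 1) (l + d)) * (-1) ^ (d * below m C (l + 1))) •
          wBasis m (C \ seg m (l + 1) (l + d))
      else 0 := by
  induction d with
  | zero =>
    have h1 : seg m (l + 1) (l + 0) = ∅ := by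
      ext i; simp only [mem_seg, Finset.notMem_empty, iff_false]; omega
    rw [Finset.Icc_eq_empty (by omega), clMonomial_empty, h1, if_pos (Finset.empty_subset _)]
    simp [weight]
  | succ d ih =>
    set i : Fin m := ⟨l + d, by omega⟩ with hi
    have hi1 : (i : ℕ) = l + d := rfl
    have h1 : seg m (l + 1) (l + (d + 1)) = insert i (seg m (l + 1) (l + d)) := by
      ext k
      simp only [mem_seg, Finset.mem_insert, Fin.ext_iff]
      omega
    have h2 : Finset.Icc (2 * m + 2 - (l + (d + 1))) (2 * m + 1 - l) =
        insert (2 * m + 1 - i) (Finset.Icc (2 * m + 2 - (l + d)) (2 * m + 1 - l)) := by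
      ext k; simp only [Finset.mem_Icc, Finset.mem_insert]; omega
    have h3 : i ∉ seg m (l + 1) (l + d) := by rw [mem_seg]; omega
    rw [h2, clMonomial_insert_min m _ _ (fun s hs => by have := Finset.mem_Icc.1 hs; omega), map_mul,
      Module.End.mul_apply, ih (by omega), spinRep_ι, h1]
    by_cases hd : seg m (l + 1) (l + d) ⊆ C
    · rw [if_pos hd, map_smul, gamma_vec_gt]
      by_cases hC : i ∈ C
      · rw [if_pos (Finset.mem_sdiff.2 ⟨hC, h3⟩), if_pos (Finset.insert_subset hC hd),
          smul_smul, Finset.sdiff_insert,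
          weight_insert h3]
        congr 1
        have e2 : below m (C \ seg m (l + 1) (l + d)) (l + d + 1) = below m C (l + 1) := by
          rw [below, below]
          congr 1
          ext k
          simp only [Finset.mem_filter, Finset.mem_sdiff, mem_seg]
          constructor
          · rintro ⟨⟨h, h'⟩, h''⟩
            exact ⟨h, by omega⟩
          · rintro ⟨h, h'⟩
            exact ⟨⟨h, by omega⟩, by omega⟩
        rw [sgn_eq_below, hi1, e2, Nat.succ_mul, pow_add _ (d * _), pow_add _ (m - (l + d)),
          neg_one_pow_congr (show (m + (l + d)) % 2 = (m - (l + d)) % 2 by omega)]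
        ring
      · rw [if_neg fun h => hC (Finset.mem_sdiff.1 h).1, if_neg fun h =>
          hC (Finset.insert_subset_iff.1 h).1, smul_zero]
    · rw [if_neg hd, if_neg fun h => hd (Finset.insert_subset_iff.1 h).2, map_zero]


/-! ### Signs -/

/-- The sign `(-1)^{n(n+1)/2}`. -/
def tau (n : ℕ) : ℂ := (-1) ^ (n * (n + 1) / 2)

theorem tau_zero : tau 0 = 1 := by simp [tau]

theorem tau_succ (n : ℕ) : tau (n + 1) = tau n * (-1) ^ (n + 1) := by
  rw [tau, tau, ← pow_add, ← Nat.add_mul_div_right _ _ two_pos]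
  congr 2; ring

theorem tau_mul_self (n : ℕ) : tau n * tau n = 1 := neg_one_pow_mul_self _

theorem tau_add (a b : ℕ) : tau (a + b) = tau a * tau b * (-1) ^ (a * b) := by
  induction b with
  | zero => simp [tau_zero]
  | succ b ih =>
    have h : (-1 : ℂ) ^ (a + b + 1) = (-1) ^ a * (-1) ^ (b + 1) := by rw [add_assoc, pow_add]
    rw [← add_assoc, tau_succ, ih, tau_succ, Nat.mul_succ, pow_add _ (a * b), h]
    ring

theorem prod_Icc_neg_one_pow (k : ℕ) : ∏ i ∈ Finset.Icc 1 k, (-1 : ℂ) ^ i = tau k := by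
  induction k with
  | zero => simp [tau_zero]
  | succ k ih => rw [Finset.prod_Icc_succ_top (by omega), ih, tau_succ]

/-- The segment carries the parts m - b + 1, …, m - a, so its weight is a difference of two
triangular numbers. -/
theorem neg_one_pow_weight_seg (m a b : ℕ) (hab : a ≤ b) (hb : b ≤ m) :
    (-1 : ℂ) ^ weight m (seg m (a + 1) b) = tau (m - a) * tau (m - b) := by
  induction b, hab using Nat.le_induction with
  | base =>
    have h1 : seg m (a + 1) a = ∅ := by
      ext i; simp only [mem_seg, Finset.notMem_empty, iff_false]; omega
    rw [h1, tau_mul_self, weight, Finset.sum_empty, pow_zero]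
  | succ b hab ih =>
    have h1 : seg m (a + 1) (b + 1) = insert ⟨b, by omega⟩ (seg m (a + 1) b) := by
      ext k
      simp only [mem_seg, Finset.mem_insert, Fin.ext_iff]
      omega
    rw [h1, weight_insert (by rw [mem_seg]; simp), pow_add, ih (by omega)]
    obtain ⟨c, hc⟩ : ∃ c, m - b = c + 1 := ⟨m - b - 1, by omega⟩
    simp only
    rw [hc, show m - (b + 1) = c by omega, tau_succ]
    linear_combination (tau (m - a) * tau c) * neg_one_pow_mul_self (c + 1)

/-! ### The action of the element of `Cl(V)` -/

/-- The middle indices of the monomials of `clDenom`. -/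
def midIdx (m j : ℕ) : Finset ℕ :=
  if m + 1 < 2 * j then Finset.Icc (2 * m + 3 - j) (m + j) else Finset.Icc j (m + 1 - j)

theorem card_midIdx (m j : ℕ) (h2 : 2 ≤ j) (hj : j ≤ m) :
    (midIdx m j).card = m - 2 * min (m + 1 - j) (j - 1) := by
  rw [midIdx]
  split_ifs <;> rw [Nat.card_Icc] <;> omega

theorem mem_midIdx (m j : ℕ) (h2 : 2 ≤ j) (hj : j ≤ m) (t : ℕ) (ht : t ∈ midIdx m j) :
    min (m + 1 - j) (j - 1) < t ∧ t < 2 * m + 2 - min (m + 1 - j) (j - 1) := by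
  rw [midIdx] at ht
  split_ifs at ht <;> rw [Finset.mem_Icc] at ht <;> omega

/-- The leading monomial is the member I = {1,…,k} of the nested family. -/
theorem outer_eq (m j : ℕ) (h2 : 2 ≤ j) (hj : j ≤ m) :
    Finset.Icc 1 (m + 1 - j) ∪ Finset.Icc (2 * m + 3 - j) (2 * m + 1) =
      Finset.Icc 1 (min (m + 1 - j) (j - 1)) ∪ midIdx m j ∪
        (Finset.Icc 1 (min (m + 1 - j) (j - 1))).image fun i => 2 * m + 2 - i := by
  have h : (Finset.Icc 1 (min (m + 1 - j) (j - 1))).image (fun i => 2 * m + 2 - i) =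
      Finset.Icc (2 * m + 2 - min (m + 1 - j) (j - 1)) (2 * m + 1) := by
    ext s
    simp only [Finset.mem_image, Finset.mem_Icc]
    constructor
    · rintro ⟨i, hi, rfl⟩; omega
    · intro hs; exact ⟨2 * m + 2 - s, by omega, by omega⟩
  rw [h, midIdx]
  ext s
  split_ifs <;> simp only [Finset.mem_union, Finset.mem_Icc] <;> omega

theorem card_nested (m j : ℕ) (h2 : 2 ≤ j) (hj : j ≤ m) (I : Finset ℕ)
    (hI : I ⊆ Finset.Icc 1 (min (m + 1 - j) (j - 1))) :
    (I ∪ midIdx m j ∪ I.image fun i => 2 * m + 2 - i).card =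
      m - 2 * min (m + 1 - j) (j - 1) + 2 * I.card := by
  have hI' := fun (i : ℕ) (hi : i ∈ I) => Finset.mem_Icc.1 (hI hi)
  have hT := mem_midIdx m j h2 hj
  rw [Finset.card_union_of_disjoint, Finset.card_union_of_disjoint, Finset.card_image_of_injOn,
    card_midIdx m j h2 hj]
  · ring
  · intro x hx y hy hxy
    have := hI' x hx; have := hI' y hy
    simp only at hxy
    omega
  · rw [Finset.disjoint_left]
    intro s hs hs'
    have := hI' s hs; have := hT s hs'; omega
  · rw [Finset.disjoint_left]
    intro s hs hs'
    obtain ⟨i, hi, rfl⟩ := Finset.mem_image.1 hs'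
    have h1 := hI' i hi
    rcases Finset.mem_union.1 hs with hs | hs
    · have := hI' _ hs; omega
    · have := hT _ hs; omega

/-- One of the two copies of the leading monomial is the missing term I = {1,…,k}, whose coefficient
is an empty product. The sum then runs over the whole power set. -/
theorem clDenom_eq (m j : ℕ) (h2 : 2 ≤ j) (hj : j ≤ m) : clDenom m j = (tau m / 2) •
    (clMonomial m (Finset.Icc 1 (min (m + 1 - j) (j - 1)) ∪ midIdx m j ∪
        (Finset.Icc 1 (min (m + 1 - j) (j - 1))).image fun i => 2 * m + 2 - i) +
      ∑ I ∈ (Finset.Icc 1 (min (m + 1 - j) (j - 1))).powerset,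
        (∏ l ∈ Finset.Icc 1 (min (m + 1 - j) (j - 1)) \ I, (-1 : ℂ) ^ l) •
          clMonomial m (I ∪ midIdx m j ∪ I.image fun i => 2 * m + 2 - i)) := by
  rw [clDenom, outer_eq m j h2 hj, two_smul, add_assoc,
    ← Finset.add_sum_erase _ _ (Finset.mem_powerset_self _), Finset.sdiff_self,
    Finset.prod_empty, one_smul]
  rfl

/-- Here |T| = m - 2k, so |T| + m is even and drops out of the signs. The power set sum is the
expansion of a product of two-term factors. -/
theorem spinRep_clDenom (m j : ℕ) (h2 : 2 ≤ j) (hj : j ≤ m) (C : Finset (Fin m)) :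
    spinRep m (clDenom m j) (wBasis m C) = (tau m / 2) •
      (((∏ i ∈ Finset.Icc 1 (min (m + 1 - j) (j - 1)), ((-1) ^ (i + 1) * occ m C i)) +
        ∏ i ∈ Finset.Icc 1 (min (m + 1 - j) (j - 1)), ((-1) ^ (i + 1) * occ m C i + (-1) ^ i)) •
        spinRep m (clMonomial m (midIdx m j)) (wBasis m C)) := by
  set k := min (m + 1 - j) (j - 1) with hk
  have hcard := card_midIdx m j h2 hj
  rw [← hk] at hcard
  have key : ∀ I ⊆ Finset.Icc 1 k,
      spinRep m (clMonomial m (I ∪ midIdx m j ∪ I.image fun i => 2 * m + 2 - i)) (wBasis m C) =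
        (∏ i ∈ I, ((-1) ^ (i + 1) * occ m C i)) •
          spinRep m (clMonomial m (midIdx m j)) (wBasis m C) := by
    intro I hI
    rw [spinRep_clMonomial_nested m (midIdx m j) I
      (fun i hi => by have := Finset.mem_Icc.1 (hI hi); omega)
      (fun t ht i hi => by
        have := Finset.mem_Icc.1 (hI hi); have := mem_midIdx m j h2 hj t ht; omega)]
    congr 1
    refine Finset.prod_congr rfl fun i _ => ?_
    rw [hcard, neg_one_pow_congr (show (m - 2 * k + m + i + 1) % 2 = (i + 1) % 2 by omega)]
  rw [clDenom_eq m j h2 hj, map_smul, map_add, map_sum, LinearMap.smul_apply, LinearMap.add_apply,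
    LinearMap.sum_apply, ← hk, key _ subset_rfl, Finset.prod_add, add_smul, Finset.sum_smul]
  congr 2
  refine Finset.sum_congr rfl fun I hI => ?_
  rw [map_smul, LinearMap.smul_apply, key I (Finset.mem_powerset.1 hI), smul_smul, mul_comm]

theorem occ_of_mem {m : ℕ} {C : Finset (Fin m)} {i : Fin m} (h : i ∈ C) : occ m C (i + 1) = 1 :=
  if_pos ⟨i, h, rfl⟩

theorem occ_of_notMem {m : ℕ} {C : Finset (Fin m)} {i : Fin m} (h : i ∉ C) :
    occ m C (i + 1) = 0 :=
  if_neg fun ⟨c, hc, e⟩ => h (by rwa [← Fin.ext (Nat.succ_injective e)])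

theorem prod_full (m k : ℕ) (hk : k ≤ m) (C : Finset (Fin m)) :
    ∏ i ∈ Finset.Icc 1 k, ((-1) ^ (i + 1) * occ m C i) =
      if seg m 1 k ⊆ C then (-1) ^ k * tau k else 0 := by
  split_ifs with h
  · have h1 : ∀ i ∈ Finset.Icc 1 k, (-1) ^ (i + 1) * occ m C i = (-1) * (-1 : ℂ) ^ i := by
      intro i hi
      rw [Finset.mem_Icc] at hi
      have := occ_of_mem (m := m) (C := C) (i := ⟨i - 1, by omega⟩)
        (h (mem_seg.2 (by simp only; omega)))
      simp only [Nat.sub_add_cancel hi.1] at this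
      rw [this, pow_succ]; ring
    rw [Finset.prod_congr rfl h1, Finset.prod_mul_distrib, prod_Icc_neg_one_pow, Finset.prod_const,
      Nat.card_Icc, Nat.add_sub_cancel]
  · obtain ⟨i, hi, hC⟩ := Finset.not_subset.1 h
    exact Finset.prod_eq_zero (i := (i : ℕ) + 1) (Finset.mem_Icc.2 (mem_seg.1 hi))
      (by rw [occ_of_notMem hC, mul_zero])

/-- Each factor is (-1)^i (1 - n_i), so the product detects that no index of {1,…,k} is occupied. It
complements `prod_full`, which detects that all of them are. -/
theorem prod_empty (m k : ℕ) (hk : k ≤ m) (C : Finset (Fin m)) :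
    ∏ i ∈ Finset.Icc 1 k, ((-1) ^ (i + 1) * occ m C i + (-1) ^ i) =
      if Disjoint C (seg m 1 k) then tau k else 0 := by
  split_ifs with h
  · rw [← prod_Icc_neg_one_pow]
    refine Finset.prod_congr rfl fun i hi => ?_
    rw [Finset.mem_Icc] at hi
    have := occ_of_notMem (m := m) (C := C) (i := ⟨i - 1, by omega⟩)
        fun hC => Finset.disjoint_left.1 h hC (mem_seg.2 (by simp only; omega))
    simp only [Nat.sub_add_cancel hi.1] at this
    rw [this, mul_zero, zero_add]
  · obtain ⟨i, hC, hi⟩ := Finset.not_disjoint_iff.1 h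
    exact Finset.prod_eq_zero (i := (i : ℕ) + 1) (Finset.mem_Icc.2 (mem_seg.1 hi))
      (by rw [occ_of_mem hC, pow_succ]; ring)

theorem symMul_zero {M : Type} [AddCommGroup M] [Module ℂ M] (a : M) : symMul a 0 = 0 :=
  (symMulB a).map_zero

theorem zero_symMul {M : Type} [AddCommGroup M] [Module ℂ M] (b : M) : symMul 0 b = 0 := by
  rw [symMul_comm, symMul_zero]

/-! ### The element `D_(j)` as an endomorphism -/

theorem row_pairwise (p l : ℕ) (q : ℕ → Bool) :
    (((List.range' 1 l).filter q).map (row p l)).Pairwise (· > ·) := by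
  rw [List.pairwise_map]
  refine List.Pairwise.filter _ ?_
  refine (List.pairwise_lt_range' (s := 1) (n := l)).imp_of_mem ?_
  intro a b ha hb hab
  rw [List.mem_range'_1] at ha hb
  simp only [row]
  split_ifs <;> omega

theorem mem_rho {p l : ℕ} {J : Finset ℕ} {n : ℕ} :
    n ∈ rho p l J ↔ ∃ r, (1 ≤ r ∧ r ≤ l) ∧ r ∉ J ∧ row p l r = n := by
  simp only [rho, List.mem_map, List.mem_filter, List.mem_range'_1, decide_eq_true_eq]
  refine exists_congr fun r => ?_
  rw [show r < 1 + l ↔ r ≤ l by omega, and_assoc]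

theorem wPart_rho (m p l : ℕ) (J : Finset ℕ) : wPart m (rho p l J) =
    wBasis m (Finset.univ.filter fun i : Fin m => m - (i : ℕ) ∈ rho p l J) :=
  if_pos (row_pairwise p l _)

theorem mem_mu {m p l : ℕ} {J : Finset ℕ} {n : ℕ} :
    n ∈ mu m p l J ↔ (∃ r, (1 ≤ r ∧ r ≤ l) ∧ m + 1 - r = n) ∨
      ∃ r, (1 ≤ r ∧ r ≤ l) ∧ r ∈ J ∧ row p l r = n := by
  simp only [mu, List.mem_append, List.mem_map, List.mem_filter, List.mem_range'_1,
    decide_eq_true_eq]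
  refine or_congr (exists_congr fun r => ?_) (exists_congr fun r => ?_) <;>
    rw [show r < 1 + l ↔ r ≤ l by omega]
  rw [and_assoc]

/-- Both blocks of rows decrease strictly, so strictness is decided at the junction, against the
last upper row m + 1 - l. -/
theorem mu_pairwise_iff (m p l : ℕ) (hl : 1 ≤ l) (hlm : l ≤ m) (J : Finset ℕ) :
    (mu m p l J).Pairwise (· > ·) ↔ ∀ r ∈ J, 1 ≤ r → r ≤ l → row p l r < m + 1 - l := by
  rw [mu, List.pairwise_append, List.pairwise_map]
  have h1 : (List.range' 1 l).Pairwise fun a b => m + 1 - a > m + 1 - b := by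
    refine (List.pairwise_lt_range' (s := 1) (n := l)).imp_of_mem ?_
    intro a b ha hb hab
    rw [List.mem_range'_1] at ha hb
    omega
  simp only [h1, row_pairwise, true_and, List.mem_map, List.mem_filter, List.mem_range'_1,
    decide_eq_true_eq]
  constructor
  · intro h r hr h1 h2
    exact h _ ⟨l, by omega, rfl⟩ _ ⟨r, ⟨by omega, hr⟩, rfl⟩
  · rintro h _ ⟨a, ha, rfl⟩ _ ⟨r, ⟨hr, hrJ⟩, rfl⟩
    have := h r hrJ (by omega) (by omega)
    omega

theorem wPart_mu (m p l : ℕ) (hl : 1 ≤ l) (hlm : l ≤ m) (J : Finset ℕ)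
    (h : ∀ r ∈ J, 1 ≤ r → r ≤ l → row p l r < m + 1 - l) : wPart m (mu m p l J) =
    wBasis m (Finset.univ.filter fun i : Fin m => m - (i : ℕ) ∈ mu m p l J) :=
  if_pos ((mu_pairwise_iff m p l hl hlm J).2 h)

theorem wPart_mu_of_not (m p l : ℕ) (hl : 1 ≤ l) (hlm : l ≤ m) (J : Finset ℕ)
    (h : ¬∀ r ∈ J, 1 ≤ r → r ≤ l → row p l r < m + 1 - l) : wPart m (mu m p l J) = 0 :=
  if_neg fun h' => h ((mu_pairwise_iff m p l hl hlm J).1 h')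

/-- For l = m + 1 - j the part m - i is the row r = i + 2 - j of the staircase. This translation
between rows and zero-based indices is used throughout. -/
theorem mem_rho_zero {m j : ℕ} (hj : j ≤ m) (J : Finset ℕ) (i : Fin m) :
    m - (i : ℕ) ∈ rho 0 (m + 1 - j) J ↔ j ≤ (i : ℕ) + 1 ∧ (i : ℕ) + 2 - j ∉ J := by
  simp only [mem_rho, row, ite_self, add_zero]
  constructor
  · rintro ⟨r, hr, hrJ, h⟩
    obtain rfl : r = (i : ℕ) + 2 - j := by omega
    exact ⟨by omega, hrJ⟩
  · rintro ⟨h, hJ⟩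
    exact ⟨_, by omega, hJ, by omega⟩

theorem mem_mu_zero {m j : ℕ} (hj : j ≤ m) (J : Finset ℕ) (i : Fin m) :
    m - (i : ℕ) ∈ mu m 0 (m + 1 - j) J ↔
      (i : ℕ) + 1 ≤ m + 1 - j ∨ j ≤ (i : ℕ) + 1 ∧ (i : ℕ) + 2 - j ∈ J := by
  simp only [mem_mu, row, ite_self, add_zero]
  refine or_congr ⟨?_, fun h => ⟨(i : ℕ) + 1, by omega, by omega⟩⟩ ⟨?_, ?_⟩
  · rintro ⟨r, hr, h⟩; omega
  · rintro ⟨r, hr, hrJ, h⟩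
    obtain rfl : r = (i : ℕ) + 2 - j := by omega
    exact ⟨by omega, hrJ⟩
  · rintro ⟨h, hJ⟩
    exact ⟨_, by omega, hJ, by omega⟩

/-- Put l = m + 1 - j. Rows r ∈ J correspond to indices i = r + j - 2, which turns s(J) into |K|.
Strictness of μ^J forces the one-based indices of K above l, so K ranges over the subsets of {max(j,
l + 1), …, m}. -/
theorem denomElt_eq (m j : ℕ) (h2 : 2 ≤ j) (hj : j ≤ m) :
    denomElt m j = ∑ K ∈ (seg m (m + 1 - min (m + 1 - j) (j - 1)) m).powerset,
      (-1 : ℂ) ^ weight m K • symMul (wBasis m (seg m j m \ K))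
        (wBasis m (seg m 1 (m + 1 - j) ∪ K)) := by
  rw [denomElt, quadElt]
  set l := m + 1 - j with hl
  have hsub : ∀ K ∈ (seg m (m + 1 - min l (j - 1)) m).powerset, ∀ i ∈ K,
      j ≤ (i : ℕ) + 1 ∧ l < (i : ℕ) + 1 := fun K hK i hi => by
    have := mem_seg.1 (Finset.mem_powerset.1 hK hi); omega
  have hmem : ∀ K ∈ (seg m (m + 1 - min l (j - 1)) m).powerset, ∀ i : Fin m, j ≤ (i : ℕ) + 1 →
      ((i : ℕ) + 2 - j ∈ K.image (fun i : Fin m => (i : ℕ) + 2 - j) ↔ i ∈ K) := by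
    intro K hK i hi
    rw [Finset.mem_image]
    constructor
    · rintro ⟨a, ha, h⟩
      have := hsub K hK a ha
      obtain rfl : a = i := Fin.ext (by omega)
      exact ha
    · exact fun h => ⟨i, h, rfl⟩
  symm
  refine Finset.sum_of_injOn (fun K : Finset (Fin m) => K.image fun i : Fin m => (i : ℕ) + 2 - j)
    ?_ ?_ ?_ ?_
  · intro K hK L hL hKL
    simp only at hKL
    ext i
    constructor
    · intro hi
      rwa [← hmem L hL i (hsub K hK i hi).1, ← hKL, hmem K hK i (hsub K hK i hi).1]
    · intro hi
      rwa [← hmem K hK i (hsub L hL i hi).1, hKL, hmem L hL i (hsub L hL i hi).1]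
  · intro K hK
    rw [Finset.mem_coe, Finset.mem_powerset]
    intro r hr
    obtain ⟨i, hi, rfl⟩ := Finset.mem_image.1 hr
    have := hsub K hK i hi
    rw [Finset.mem_Icc]
    omega
  -- A set J that comes from no K has a row of length at least m + 1 - l, so μ^J is not strict and
  -- its term is zero.
  · intro J hJ hJ'
    rw [Finset.mem_powerset] at hJ
    rw [wPart_mu_of_not m 0 l (by omega) (by omega) J]
    · rw [symMul_zero, smul_zero]
    · intro h
      refine hJ' ⟨Finset.univ.filter fun i : Fin m => j ≤ (i : ℕ) + 1 ∧ (i : ℕ) + 2 - j ∈ J, ?_, ?_⟩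
      · rw [Finset.mem_coe, Finset.mem_powerset]
        intro i hi
        have hi := (Finset.mem_filter.1 hi).2
        have := h _ hi.2 (by omega) (by omega)
        rw [row] at this
        rw [mem_seg]
        split_ifs at this <;> omega
      · ext r
        simp only [Finset.mem_image, Finset.mem_filter, Finset.mem_univ, true_and]
        constructor
        · rintro ⟨i, hi, rfl⟩
          exact hi.2
        · intro hr
          have h1 := Finset.mem_Icc.1 (hJ hr)
          have e : r + j - 2 + 2 - j = r := by omega
          exact ⟨⟨r + j - 2, by omega⟩, ⟨by simp only; omega, by simp only [e]; exact hr⟩, e⟩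
  · intro K hK
    have h1 : ∑ i ∈ K.image (fun i : Fin m => (i : ℕ) + 2 - j), (l + 1 - i) = weight m K := by
      rw [Finset.sum_image, weight]
      · refine Finset.sum_congr rfl fun i hi => ?_
        have := hsub K hK i hi
        omega
      · intro a ha b hb hab
        have := hsub K hK a ha; have := hsub K hK b hb
        simp only at hab
        exact Fin.ext (by omega)
    rw [h1, wPart_rho, wPart_mu m 0 l (by omega) (by omega)]
    · congr 3
      · ext i
        rw [Finset.mem_sdiff, mem_seg, Finset.mem_filter, mem_rho_zero hj]
        constructor
        · rintro ⟨h, hK'⟩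
          exact ⟨Finset.mem_univ _, h.1, fun h' => hK' ((hmem K hK i h.1).1 h')⟩
        · rintro ⟨_, h, hK'⟩
          exact ⟨⟨h, by omega⟩, fun h' => hK' ((hmem K hK i h).2 h')⟩
      · ext i
        rw [Finset.mem_union, mem_seg, Finset.mem_filter, mem_mu_zero hj]
        constructor
        · rintro (h | h)
          · exact ⟨Finset.mem_univ _, Or.inl h.2⟩
          · exact ⟨Finset.mem_univ _, Or.inr ⟨(hsub K hK i h).1,
              (hmem K hK i (hsub K hK i h).1).2 h⟩⟩
        · rintro ⟨_, h | ⟨h, h'⟩⟩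
          · exact Or.inl ⟨by omega, h⟩
          · exact Or.inr ((hmem K hK i h).1 h')
    · intro r hr _ _
      obtain ⟨i, hi, rfl⟩ := Finset.mem_image.1 hr
      have := hsub K hK i hi
      rw [row]
      split_ifs <;> omega

theorem sum_ite_eq_of_iff {ι M : Type} [DecidableEq ι] [AddCommMonoid M] (s : Finset ι) (i₀ : ι)
    (q : ι → Prop) [DecidablePred q] (p : Prop) [Decidable p] (hi₀ : i₀ ∈ s)
    (h : ∀ i ∈ s, q i ↔ p ∧ i = i₀) (f : ι → M) :
    ∑ i ∈ s, (if q i then f i else 0) = if p then f i₀ else 0 := by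
  rw [Finset.sum_eq_single i₀ (fun i hi hne => if_neg fun hq => hne ((h i hi).1 hq).2)
    fun hn => absurd hi₀ hn]
  exact if_congr ⟨fun hq => ((h i₀ hi₀).1 hq).1, fun hp => (h i₀ hi₀).2 ⟨hp, rfl⟩⟩ rfl rfl

theorem weight_union_of_disjoint (m : ℕ) {A B : Finset (Fin m)} (h : Disjoint A B) :
    weight m (A ∪ B) = weight m A + weight m B :=
  Finset.sum_union h

/-- Applied to w_C, each half of the symmetrization has at most one surviving K, namely C ∩ R or R \
C. The coefficient (-1)^{|K|} combines with the sign of δ to one independent of K, given by P in one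
half and by Q in the other. -/
theorem symToEnd_sum_powerset (m : ℕ) (P Q R C : Finset (Fin m)) (hRP : R ⊆ P)
    (hQR : Disjoint Q R) :
    symToEnd m (∑ K ∈ R.powerset, (-1 : ℂ) ^ weight m K •
      symMul (wBasis m (P \ K)) (wBasis m (Q ∪ K))) (wBasis m C) =
      (1 / 2 : ℂ) • ((if C \ R = Pᶜ then (-1 : ℂ) ^ weight m P • wBasis m (Q ∪ C ∩ R) else 0) +
        if C \ R = Qᶜ \ R then (-1 : ℂ) ^ weight m Q • wBasis m (P \ (R \ C)) else 0) := by
  rw [map_sum, LinearMap.sum_apply,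
    ← sum_ite_eq_of_iff R.powerset (C ∩ R) (fun K => C = (P \ K)ᶜ) (C \ R = Pᶜ)
      (Finset.mem_powerset.2 Finset.inter_subset_right)
      (f := fun K => (-1 : ℂ) ^ weight m P • wBasis m (Q ∪ K)),
    ← sum_ite_eq_of_iff R.powerset (R \ C) (fun K => C = (Q ∪ K)ᶜ) (C \ R = Qᶜ \ R)
      (Finset.mem_powerset.2 Finset.sdiff_subset)
      (f := fun K => (-1 : ℂ) ^ weight m Q • wBasis m (P \ K)), ← Finset.sum_add_distrib,
    Finset.smul_sum]
  · refine Finset.sum_congr rfl fun K hK => ?_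
    rw [Finset.mem_powerset] at hK
    have hP : (-1 : ℂ) ^ weight m K * (-1) ^ weight m (P \ K) = (-1) ^ weight m P := by
      rw [← pow_add, ← weight_union_of_disjoint m Finset.disjoint_sdiff,
        Finset.union_sdiff_of_subset (hK.trans hRP)]
    have hQ : (-1 : ℂ) ^ weight m K * (-1) ^ weight m (Q ∪ K) = (-1) ^ weight m Q := by
      rw [weight_union_of_disjoint m (hQR.mono_right hK), pow_add, mul_left_comm,
        neg_one_pow_mul_self, mul_one]
    rw [map_smul, LinearMap.smul_apply, symToEnd_symMul, delta_basis, delta_basis, smul_comm,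
      smul_add, smul_smul, smul_smul, ← hP, ← hQ]
    congr 2 <;> split_ifs <;> simp
  · intro K hK
    rw [Finset.mem_powerset] at hK
    simp only [Finset.ext_iff, Finset.mem_compl, Finset.mem_sdiff, Finset.mem_union,
      Finset.disjoint_left] at *
    grind
  · intro K hK
    rw [Finset.mem_powerset] at hK
    simp only [Finset.ext_iff, Finset.mem_compl, Finset.mem_sdiff, Finset.mem_inter] at *
    grind

theorem below_of_subset {m a : ℕ} {C : Finset (Fin m)} (ha : a ≤ m) (h : seg m 1 a ⊆ C) :
    below m C (a + 1) = a := by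
  rw [below, ← Finset.card_map Fin.valEmbedding, show (C.filter fun i : Fin m =>
    (i : ℕ) + 1 < a + 1).map Fin.valEmbedding = Finset.range a from ?_, Finset.card_range]
  ext k
  simp only [Finset.mem_map, Finset.mem_filter, Fin.valEmbedding_apply, Finset.mem_range]
  constructor
  · rintro ⟨i, hi, rfl⟩; omega
  · intro hk
    exact ⟨⟨k, by omega⟩, ⟨h (mem_seg.2 (by simp only; omega)), by simp only; omega⟩, rfl⟩

theorem below_of_disjoint {m a : ℕ} {C : Finset (Fin m)} (h : Disjoint C (seg m 1 a)) :
    below m C (a + 1) = 0 := by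
  rw [below, Finset.card_eq_zero, Finset.filter_eq_empty_iff]
  exact fun i hi hi' => Finset.disjoint_left.1 h hi (mem_seg.2 (by omega))

/-- Both sides are evaluated on w_C. The product over occupied indices matches the half of ι in
which δ is applied to w_{ρ^J}, and the product over empty indices matches the half in which it is
applied to w_{μ^J}. What remains is to compare index sets and signs. -/
theorem spinRep_clDenom_eq (m j : ℕ) (h2 : 2 ≤ j) (hj : j ≤ m) :
    spinRep m (clDenom m j) = symToEnd m (denomElt m j) := by
  refine (wBasis m).ext fun C => ?_
  obtain ⟨l, hl⟩ : ∃ l, m + 1 - j = l := ⟨_, rfl⟩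
  rw [denomElt_eq m j h2 hj, spinRep_clDenom m j h2 hj, midIdx, hl]
  rw [symToEnd_sum_powerset m (seg m j m) (seg m 1 l) _ C (fun i hi => by
      rw [mem_seg] at *; omega) (Finset.disjoint_left.2 fun i hi hi' => by
      rw [mem_seg] at *; omega)]
  -- The segment from j to m carries the parts 1, …, l; the segment from 1 to l carries m - l + 1,
  -- …, m.
  have wP : (-1 : ℂ) ^ weight m (seg m j m) = tau l := by
    have := neg_one_pow_weight_seg m (j - 1) m (by omega) le_rfl
    rwa [show j - 1 + 1 = j by omega, Nat.sub_self, tau_zero, mul_one,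
      show m - (j - 1) = l by omega] at this
  have wQ : (-1 : ℂ) ^ weight m (seg m 1 l) = tau m * tau (m - l) :=
    neg_one_pow_weight_seg m 0 l (by omega) (by omega)
  rw [prod_full m _ (by omega), prod_empty m _ (by omega), wP, wQ]
  rw [add_smul, smul_add, smul_add]
  -- For large j the middle monomial consists of annihilation operators and k = l; otherwise it
  -- consists of creation operators and k = j - 1.
  by_cases hc : m + 1 < 2 * j
  · rw [if_pos hc]
    obtain ⟨d, hd⟩ : ∃ d, j - 1 = l + d := ⟨j - 1 - l, by omega⟩
    obtain ⟨n, hn⟩ : ∃ n, m = l + n := ⟨m - l, by omega⟩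
    have wS := neg_one_pow_weight_seg m l (l + d) (by omega) (by omega)
    rw [show min l (j - 1) = l by omega, show m + 1 - l = j by omega,
      show Finset.Icc (2 * m + 3 - j) (m + j) = Finset.Icc (2 * m + 2 - (l + d)) (2 * m + 1 - l) by
        congr 1 <;> omega, spinRep_clMonomial_annihilate m l d (by omega), wS,
      show m - (l + d) = l by omega, show m - l = n by omega]
    have tm : tau m = tau l * tau n * (-1) ^ (l * n) := by rw [hn, tau_add]
    have mem0 : ∀ i : Fin m, i ∈ seg m 1 l ↔ (i : ℕ) + 1 ≤ l := fun i => by rw [mem_seg]; omega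
    have memS : ∀ i : Fin m, i ∈ seg m (l + 1) (l + d) ↔ l < (i : ℕ) + 1 ∧ (i : ℕ) + 1 < j :=
      fun i => by rw [mem_seg]; omega
    have memP : ∀ i : Fin m, i ∈ seg m j m ↔ j ≤ (i : ℕ) + 1 := fun i => by rw [mem_seg]; omega
    have e1 : C \ seg m j m = (seg m j m)ᶜ ↔ seg m 1 l ⊆ C ∧ seg m (l + 1) (l + d) ⊆ C := by
      simp only [Finset.ext_iff, Finset.subset_iff, Finset.mem_sdiff, Finset.mem_compl, mem0, memS,
        memP]
      grind
    have e2 : C \ seg m j m = (seg m 1 l)ᶜ \ seg m j m ↔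
        Disjoint C (seg m 1 l) ∧ seg m (l + 1) (l + d) ⊆ C := by
      simp only [Finset.ext_iff, Finset.subset_iff, Finset.mem_sdiff, Finset.mem_compl, mem0, memS,
        memP, Finset.disjoint_left]
      grind
    have hset : seg m (l + 1) (l + d) ⊆ C → seg m 1 l ⊆ C →
        C \ seg m (l + 1) (l + d) = seg m 1 l ∪ C ∩ seg m j m := fun h1 h2 => by
      simp only [Finset.ext_iff, Finset.subset_iff, Finset.mem_sdiff, Finset.mem_union,
        Finset.mem_inter, mem0, memS, memP] at *
      grind
    have hset' : Disjoint C (seg m 1 l) → C \ seg m (l + 1) (l + d) =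
        seg m j m \ (seg m j m \ C) := fun h => by
      simp only [Finset.ext_iff, Finset.disjoint_left, Finset.mem_sdiff, mem0, memS, memP] at *
      grind
    congr 1
    · by_cases hS : seg m (l + 1) (l + d) ⊆ C
      · by_cases hF : seg m 1 l ⊆ C
        · have hb := below_of_subset (by omega) hF
          rw [if_pos hS, if_pos hF, if_pos (e1.2 ⟨hF, hS⟩), ← hset hS hF, smul_smul, smul_smul,
            smul_smul, hb, tm]
          congr 1
          -- The signs come from `tau_add`, `prod_full` and the l occupied indices below the
          -- segment. With n = l + d the exponent is l(l + 1) + 2dl.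
          have h : (-1 : ℂ) ^ (l * n) * (-1) ^ l * (-1) ^ (d * l) = 1 := by
            rw [← pow_add, ← pow_add, show l * n + l + d * l = l * (l + 1) + 2 * (d * l) by
              rw [show n = l + d by omega]; ring]
            exact ((Nat.even_mul_succ_self l).add (even_two_mul _)).neg_one_pow
          linear_combination tau l ^ 3 * tau n ^ 2 / 2 * h +
            tau l * tau n ^ 2 / 2 * tau_mul_self l + tau l / 2 * tau_mul_self n
        · rw [if_neg hF, if_neg fun h => hF (e1.1 h).1, zero_smul, smul_zero, smul_zero]
      · rw [if_neg hS, if_neg fun h => hS (e1.1 h).2, smul_zero, smul_zero, smul_zero]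
    · by_cases hS : seg m (l + 1) (l + d) ⊆ C
      · by_cases hF : Disjoint C (seg m 1 l)
        · have hb := below_of_disjoint hF
          rw [if_pos hS, if_pos hF, if_pos (e2.2 ⟨hF, hS⟩), ← hset' hF, smul_smul, smul_smul,
            smul_smul, hb, mul_zero, pow_zero]
          congr 1
          linear_combination tau m * tau n / 2 * tau_mul_self l
        · rw [if_neg hF, if_neg fun h => hF (e2.1 h).1, zero_smul, smul_zero, smul_zero]
      · rw [if_neg hS, if_neg fun h => hS (e2.1 h).2, smul_zero, smul_zero, smul_zero]
  · rw [if_neg hc]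
    obtain ⟨k, hk⟩ : ∃ k, j - 1 = k := ⟨_, rfl⟩
    obtain ⟨d, hd⟩ : ∃ d, l = k + d := ⟨l - k, by omega⟩
    rw [show min l (j - 1) = k by omega, show m + 1 - k = l + 1 by omega,
      spinRep_clMonomial_create m l (by omega) d C j (by omega) (by omega),
      show m - l = k by omega]
    have tm : tau m = tau k * tau l * (-1) ^ (k * l) := by rw [show m = k + l by omega, tau_add]
    have mem0 : ∀ i : Fin m, i ∈ seg m 1 k ↔ (i : ℕ) + 1 < j := fun i => by rw [mem_seg]; omega
    have memQ : ∀ i : Fin m, i ∈ seg m 1 l ↔ (i : ℕ) + 1 ≤ l := fun i => by rw [mem_seg]; omega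
    have memS : ∀ i : Fin m, i ∈ seg m j l ↔ j ≤ (i : ℕ) + 1 ∧ (i : ℕ) + 1 ≤ l := fun i => mem_seg
    have memP : ∀ i : Fin m, i ∈ seg m j m ↔ j ≤ (i : ℕ) + 1 := fun i => by rw [mem_seg]; omega
    have memR : ∀ i : Fin m, i ∈ seg m (l + 1) m ↔ l < (i : ℕ) + 1 := fun i => by
      rw [mem_seg]; omega
    have e1 : C \ seg m (l + 1) m = (seg m j m)ᶜ ↔ seg m 1 k ⊆ C ∧ Disjoint C (seg m j l) := by
      simp only [Finset.ext_iff, Finset.subset_iff, Finset.mem_sdiff, Finset.mem_compl, mem0, memS,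
        memP, memR, Finset.disjoint_left]
      grind
    have e2 : C \ seg m (l + 1) m = (seg m 1 l)ᶜ \ seg m (l + 1) m ↔
        Disjoint C (seg m 1 k) ∧ Disjoint C (seg m j l) := by
      simp only [Finset.ext_iff, Finset.mem_sdiff, Finset.mem_compl, mem0, memS,
        memQ, memR, Finset.disjoint_left]
      grind
    have hset : Disjoint C (seg m j l) → seg m 1 k ⊆ C →
        C ∪ seg m j l = seg m 1 l ∪ C ∩ seg m (l + 1) m := fun h1 h2 => by
      simp only [Finset.ext_iff, Finset.subset_iff, Finset.disjoint_left, Finset.mem_union,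
        Finset.mem_inter, mem0, memS, memQ, memR] at *
      grind
    have hset' : Disjoint C (seg m 1 k) → Disjoint C (seg m j l) → C ∪ seg m j l =
        seg m j m \ (seg m (l + 1) m \ C) := fun h h' => by
      simp only [Finset.ext_iff, Finset.disjoint_left, Finset.mem_sdiff, Finset.mem_union, mem0,
        memS, memP, memR] at *
      grind
    congr 1
    · by_cases hS : Disjoint C (seg m j l)
      · by_cases hF : seg m 1 k ⊆ C
        · have hb := below_of_subset (by omega) hF
          rw [show k + 1 = j by omega] at hb
          rw [if_pos hS, if_pos hF, if_pos (e1.2 ⟨hF, hS⟩), ← hset hS hF, smul_smul, smul_smul,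
            smul_smul, hb, tm]
          congr 1
          -- The same cancellation as in the other case, now with l = k + d.
          have h : (-1 : ℂ) ^ (k * l) * (-1) ^ k * (-1) ^ (d * k) = 1 := by
            rw [← pow_add, ← pow_add, show k * l + k + d * k = k * (k + 1) + 2 * (d * k) by
              rw [hd]; ring]
            exact ((Nat.even_mul_succ_self k).add (even_two_mul _)).neg_one_pow
          linear_combination tau k ^ 2 * tau l / 2 * h + tau l / 2 * tau_mul_self k
        · rw [if_neg hF, if_neg fun h => hF (e1.1 h).1, zero_smul, smul_zero, smul_zero]
      · rw [if_neg hS, if_neg fun h => hS (e1.1 h).2, smul_zero, smul_zero, smul_zero]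
    · by_cases hS : Disjoint C (seg m j l)
      · by_cases hF : Disjoint C (seg m 1 k)
        · have hb := below_of_disjoint hF
          rw [show k + 1 = j by omega] at hb
          rw [if_pos hS, if_pos hF, if_pos (e2.2 ⟨hF, hS⟩), ← hset' hF hS, smul_smul, smul_smul,
            smul_smul, hb, mul_zero, pow_zero]
          congr 1
          ring
        · rw [if_neg hF, if_neg fun h => hF (e2.1 h).1, zero_smul, smul_zero, smul_zero]
      · rw [if_neg hS, if_neg fun h => hS (e2.1 h).2, smul_zero, smul_zero, smul_zero]

theorem clDenom_mem_evenOdd (m j : ℕ) (h2 : 2 ≤ j) (hj : j ≤ m) :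
    clDenom m j ∈ CliffordAlgebra.evenOdd (quad m) (m : ZMod 2) := by
  have key : ∀ I ⊆ Finset.Icc 1 (min (m + 1 - j) (j - 1)),
      clMonomial m (I ∪ midIdx m j ∪ I.image fun i => 2 * m + 2 - i) ∈
        CliffordAlgebra.evenOdd (quad m) (m : ZMod 2) := by
    intro I hI
    have h := mem_evenOdd_of_mem_pow (clMonomial_mem_pow m
      (I ∪ midIdx m j ∪ I.image fun i => 2 * m + 2 - i))
    rwa [card_nested m j h2 hj I hI, show ((m - 2 * min (m + 1 - j) (j - 1) + 2 * I.card : ℕ) : ZMod 2)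
      = (m : ZMod 2) from (ZMod.natCast_eq_natCast_iff' _ _ 2).2 (by omega)] at h
  rw [clDenom_eq m j h2 hj]
  refine Submodule.smul_mem _ _ (add_mem (key _ subset_rfl) (sum_mem fun I hI => ?_))
  exact Submodule.smul_mem _ _ (key I (Finset.mem_powerset.1 hI))


/-! ### Products of basis vectors in the exterior algebra -/

/-- The product of the basis vectors `v_i`, `i ∈ L`, in the exterior algebra. -/
def wedgeList (m : ℕ) (L : List ℕ) : ExteriorAlgebra ℂ (V m) :=
  ((L.map (vec m)).map (ExteriorAlgebra.ι ℂ)).prod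

theorem wedgeList_append (m : ℕ) (L L' : List ℕ) :
    wedgeList m (L ++ L') = wedgeList m L * wedgeList m L' := by
  simp only [wedgeList, List.map_append, List.prod_append]

theorem coe_ιMulti_eq {M : Type} [AddCommGroup M] [Module ℂ M] (n : ℕ) (u : Fin n → M) :
    (exteriorPower.ιMulti ℂ n u : ExteriorAlgebra ℂ M) =
      ((List.ofFn u).map (ExteriorAlgebra.ι ℂ)).prod := by
  rw [exteriorPower.ιMulti_apply_coe, ExteriorAlgebra.ιMulti_apply, List.map_ofFn]
  rfl

theorem coe_vWedge (m j : ℕ) :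
    (vWedge m j : ExteriorAlgebra ℂ (V m)) = wedgeList m (List.range' j (m + 1)) := by
  rw [vWedge, coe_ιMulti_eq, wedgeList]
  congr 2
  refine List.ext_getElem (by simp) fun i h1 h2 => ?_
  rw [List.getElem_ofFn, List.getElem_map, List.getElem_range'_1]

/-- The list `1, …, m + 1 - j, 2m + 3 - j, …, 2m + 1`. -/
def outerList (m j : ℕ) : List ℕ :=
  List.range' 1 (m + 1 - j) ++ List.range' (2 * m + 3 - j) (j - 1)

theorem length_outerList (m j : ℕ) (h2 : 2 ≤ j) (hj : j ≤ m) : (outerList m j).length = m := by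
  rw [outerList, List.length_append, List.length_range', List.length_range']
  omega

theorem coe_vOuter (m j : ℕ) (h2 : 2 ≤ j) (hj : j ≤ m) :
    (vOuter m j : ExteriorAlgebra ℂ (V m)) = wedgeList m (outerList m j) := by
  rw [vOuter, coe_ιMulti_eq, wedgeList]
  congr 2
  refine List.ext_getElem (by simp [length_outerList m j h2 hj]) fun i h1 h2 => ?_
  rw [List.getElem_ofFn, List.getElem_map]
  simp only [outerList, List.getElem_append, List.length_range', List.getElem_range'_1]
  split_ifs <;> first | omega | (congr 1; omega)

theorem sort_outer (m j : ℕ) (h2 : 2 ≤ j) (hj : j ≤ m) :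
    (Finset.Icc 1 (m + 1 - j) ∪ Finset.Icc (2 * m + 3 - j) (2 * m + 1)).sort (· ≤ ·) =
      outerList m j := by
  have hp : (outerList m j).Pairwise (· < ·) := by
    rw [outerList, List.pairwise_append]
    refine ⟨List.pairwise_lt_range', List.pairwise_lt_range', fun a ha b hb => ?_⟩
    rw [List.mem_range'_1] at ha hb
    omega
  have h : Finset.Icc 1 (m + 1 - j) ∪ Finset.Icc (2 * m + 3 - j) (2 * m + 1) =
      (outerList m j).toFinset := by
    ext s
    simp only [outerList, Finset.mem_union, Finset.mem_Icc, List.mem_toFinset, List.mem_append,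
      List.mem_range'_1]
    omega
  rw [h]
  exact (List.toFinset_sort (· ≤ ·) (hp.imp ne_of_lt)).2 (hp.imp le_of_lt)

/-- A proper subset I gives m - 2k + 2|I| < m factors and hence no component in degree m. The
leading monomial has m factors, and its coefficient 2 cancels the prefactor ½. -/
theorem extProj_toExt_clDenom (m j : ℕ) (h2 : 2 ≤ j) (hj : j ≤ m) :
    extProj m (toExt m (clDenom m j)) = tau m • vOuter m j := by
  have h1 : extProj m (toExt m (clMonomial m
      (Finset.Icc 1 (m + 1 - j) ∪ Finset.Icc (2 * m + 3 - j) (2 * m + 1)))) = vOuter m j := by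
    refine Subtype.ext ?_
    rw [coe_vOuter m j h2 hj, clMonomial, sort_outer m j h2 hj, wedgeList,
      ← extProj_toExt_list_prod, List.length_map, length_outerList m j h2 hj, List.map_map]
    rfl
  have h3 : ∀ I ∈ (Finset.Icc 1 (min (m + 1 - j) (j - 1))).ssubsets,
      extProj m (toExt m (clMonomial m
        (I ∪ midIdx m j ∪ I.image fun i => 2 * m + 2 - i))) = 0 := by
    intro I hI
    rw [Finset.mem_ssubsets] at hI
    refine extProj_toExt_of_mem_pow m _ _ (clMonomial_mem_pow m _) m (Or.inl ?_)
    have h := Finset.card_lt_card hI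
    rw [Nat.card_Icc] at h
    rw [card_nested m j h2 hj I hI.subset]
    omega
  rw [clDenom, map_smul, map_smul, map_add, map_add, map_smul, map_smul, h1, map_sum, map_sum,
    Finset.sum_eq_zero, add_zero, smul_smul, div_mul_cancel₀ _ two_ne_zero]
  · rfl
  · intro I hI
    rw [map_smul, map_smul]
    exact (congrArg _ (h3 I hI)).trans (smul_zero _)

theorem prWedge_denomElt (m j : ℕ) (h2 : 2 ≤ j) (hj : j ≤ m) :
    prWedge m (kappaInv m (m % 2) (symToEnd m (denomElt m j))) = tau m • vOuter m j := by
  rw [← spinRep_clDenom_eq m j h2 hj,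
    prWedge_kappaInv_spinRep m _ (clDenom_mem_evenOdd m j h2 hj), extProj_toExt_clDenom m j h2 hj]

/-! ### Contraction with the volume element -/

theorem ctr_list_prod_eq_zero {M : Type} [AddCommGroup M] [Module ℂ M] (φ : Module.Dual ℂ M)
    (L : List M) (h : ∀ v ∈ L, φ v = 0) : ctr φ (L.map (ExteriorAlgebra.ι ℂ)).prod = 0 := by
  induction L with
  | nil => rw [List.map_nil, List.prod_nil, ctr_one]
  | cons v L ih =>
    rw [List.map_cons, List.prod_cons, ctr_ι_mul, h v (by simp), zero_smul,
      ih fun w hw => h w (by simp [hw]), mul_zero, sub_zero]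

theorem ctr_list_prod {M : Type} [AddCommGroup M] [Module ℂ M] (φ : Module.Dual ℂ M) (a : M)
    (ha : φ a = 1) (L' : List M) (h' : ∀ v ∈ L', φ v = 0) (L : List M) (h : ∀ v ∈ L, φ v = 0) :
    ctr φ ((L ++ a :: L').map (ExteriorAlgebra.ι ℂ)).prod =
      (-1 : ℂ) ^ L.length • ((L ++ L').map (ExteriorAlgebra.ι ℂ)).prod := by
  induction L with
  | nil =>
    rw [List.nil_append, List.map_cons, List.prod_cons, ctr_ι_mul, ha,
      ctr_list_prod_eq_zero φ L' h']
    simp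
  | cons v L ih =>
    rw [List.cons_append, List.map_cons, List.prod_cons, ctr_ι_mul, h v (by simp), zero_smul,
      ih fun w hw => h w (by simp [hw]), zero_sub, List.cons_append, List.map_cons, List.prod_cons,
      List.length_cons, pow_succ, mul_smul_comm, mul_neg_one, neg_smul]

/-- The vector `ε(s) v̄_s`, dual to `v_s`. -/
def dualVec (m s : ℕ) : V m := (-1 : ℂ) ^ (m + 1 + s) • vec m (2 * m + 2 - s)

/-- The product of the vectors `ε(s) v̄_s`, `s ∈ L`, in the exterior algebra. -/
def dualWedgeList (m : ℕ) (L : List ℕ) : ExteriorAlgebra ℂ (V m) :=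
  ((L.map (dualVec m)).map (ExteriorAlgebra.ι ℂ)).prod

theorem bil_vec_bar (m i : ℕ) (h1 : 1 ≤ i) (h2 : i ≤ 2 * m + 1) :
    bil m (vec m i) (vec m (2 * m + 2 - i)) = (-1) ^ (m + 1 + i) := by
  rw [bil_apply, Finset.sum_eq_single (⟨i - 1, by omega⟩ : Fin (2 * m + 1))]
  · have e1 : i - 1 + 1 = i := by omega
    have e2 : 2 * m + 1 - i + 1 = 2 * m + 2 - i := by omega
    simp only [vec, Fin.val_rev, e1, if_true, mul_one, eps]
    rw [if_pos e2, mul_one]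
    exact neg_one_pow_congr (by omega)
  · intro k _ hk
    rw [Ne, Fin.ext_iff] at hk
    rw [vec, if_neg (by simp only at hk; omega), mul_zero, zero_mul]
  · exact fun h => absurd (Finset.mem_univ _) h

theorem bil_vec_dualVec (m i : ℕ) (h1 : 1 ≤ i) (h2 : i ≤ 2 * m + 1) :
    bil m (vec m i) (dualVec m i) = 1 := by
  rw [dualVec, map_smul, bil_vec_bar m i h1 h2, smul_eq_mul, neg_one_pow_mul_self]

theorem bil_vec_dualVec_of_ne (m i s : ℕ) (hs : s ≤ 2 * m + 1) (h : i ≠ s) :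
    bil m (vec m i) (dualVec m s) = 0 := by
  rw [dualVec, map_smul, bil_vec_eq_zero m _ _ (by omega), smul_zero]

/-- Contracting by v_a strikes out its dual vector, at the cost of passing L. The dual of v_{a+1}
then follows L directly, so each of the n steps costs the same sign. -/
theorem formContr_range' (m : ℕ) (L L' : List ℕ) (n : ℕ) : ∀ a, 1 ≤ a → a + n ≤ 2 * m + 2 →
    (∀ s ∈ L ++ L', s ≤ 2 * m + 1 ∧ (s < a ∨ a + n ≤ s)) →
    (formContr (bil m) (wedgeList m (List.range' a n))).unop
      (dualWedgeList m (L ++ List.range' a n ++ L')) =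
      (-1 : ℂ) ^ (n * L.length) • dualWedgeList m (L ++ L') := by
  induction n with
  | zero =>
    intro a _ _ _
    rw [List.range'_zero, List.append_nil, zero_mul, pow_zero, one_smul, wedgeList, List.map_nil,
      List.map_nil, List.prod_nil, map_one]
    rfl
  | succ n ih =>
    intro a h1 h2 h
    have h3 : wedgeList m (List.range' a (n + 1)) =
        ExteriorAlgebra.ι ℂ (vec m a) * wedgeList m (List.range' (a + 1) n) := by
      rw [List.range'_succ, wedgeList, List.map_cons, List.map_cons, List.prod_cons, wedgeList]
    have h4 : ctr (bil m (vec m a)) (dualWedgeList m (L ++ List.range' a (n + 1) ++ L')) =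
        (-1 : ℂ) ^ L.length • dualWedgeList m (L ++ List.range' (a + 1) n ++ L') := by
      have h5 := ctr_list_prod (bil m (vec m a)) (dualVec m a)
        (bil_vec_dualVec m a h1 (by omega)) ((List.range' (a + 1) n ++ L').map (dualVec m)) ?_
        (L.map (dualVec m)) ?_
      · rw [dualWedgeList, dualWedgeList, List.range'_succ]
        simpa only [List.map_append, List.map_cons, List.length_map, List.append_assoc,
          List.cons_append] using h5
      · intro v hv
        obtain ⟨s, hs, rfl⟩ := List.mem_map.1 hv
        rcases List.mem_append.1 hs with hs | hs
        · rw [List.mem_range'_1] at hs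
          exact bil_vec_dualVec_of_ne m a s (by omega) (by omega)
        · have := h s (List.mem_append_right _ hs)
          exact bil_vec_dualVec_of_ne m a s (by omega) (by omega)
      · intro v hv
        obtain ⟨s, hs, rfl⟩ := List.mem_map.1 hv
        have := h s (List.mem_append_left _ hs)
        exact bil_vec_dualVec_of_ne m a s (by omega) (by omega)
    rw [h3, formContr_ι_mul, h4, map_smul, ih (a + 1) (by omega) (by omega) fun s hs => by
      have := h s hs; omega, smul_smul, ← pow_add]
    congr 2
    ring

/-- The map s ↦ 2m + 2 - s reverses the interval. The sign collects the n factors ε(s) and the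
reordering into increasing indices. -/
theorem dualWedgeList_range' (m n : ℕ) : ∀ a, a + n ≤ 2 * m + 2 →
    dualWedgeList m (List.range' a n) =
      (-1 : ℂ) ^ (n * (m + a + n)) • wedgeList m (List.range' (2 * m + 3 - a - n) n) := by
  induction n with
  | zero => intro a _; simp [dualWedgeList, wedgeList]
  | succ n ih =>
    intro a ha
    have h1 : wedgeList m (List.range' (2 * m + 3 - a - (n + 1)) (n + 1)) =
        wedgeList m (List.range' (2 * m + 2 - a - n) n) *
          ExteriorAlgebra.ι ℂ (vec m (2 * m + 2 - a)) := by
      rw [show 2 * m + 3 - a - (n + 1) = 2 * m + 2 - a - n by omega, List.range'_1_concat,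
        wedgeList_append, show 2 * m + 2 - a - n + n = 2 * m + 2 - a by omega]
      simp only [wedgeList, List.map_cons, List.map_nil, List.prod_cons, List.prod_nil, mul_one]
    have h2 := list_prod_mul_ι ((List.range' (2 * m + 2 - a - n) n).map (vec m))
      (vec m (2 * m + 2 - a))
    rw [List.length_map, List.length_range'] at h2
    have h3 : dualWedgeList m (List.range' a (n + 1)) =
        ExteriorAlgebra.ι ℂ (dualVec m a) * dualWedgeList m (List.range' (a + 1) n) := by
      rw [List.range'_succ, dualWedgeList, List.map_cons, List.map_cons, List.prod_cons,
        dualWedgeList]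
    rw [h3, ih (a + 1) (by omega), h1, show 2 * m + 3 - (a + 1) - n = 2 * m + 2 - a - n by omega,
      wedgeList, h2, dualVec, map_smul, smul_mul_smul_comm, smul_smul, ← pow_add, ← pow_add]
    congr 1
    refine neg_one_pow_congr ?_
    rw [show (n + 1) * (m + a + (n + 1)) + n = m + 1 + a + n * (m + (a + 1) + n) + 2 * n by ring]
    omega

theorem sharp_proj (m : ℕ) (k : Fin (2 * m + 1)) :
    sharp m (LinearMap.proj k) = dualVec m (k + 1) := by
  have h : sharp m (LinearMap.proj k) = eps m k • Pi.single k.rev 1 := by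
    rw [sharp, LinearMap.sum_apply, Finset.sum_eq_single k]
    · simp
    · intro i _ hi
      simp [Pi.single_eq_of_ne (Ne.symm hi)]
    · exact fun h => absurd (Finset.mem_univ _) h
  rw [h, dualVec, eps, neg_one_pow_congr (show (m + 1 + (k + 1 : ℕ)) % 2 = (m + (k : ℕ)) % 2 by omega)]
  congr 1
  funext i
  simp only [vec, Pi.single_apply, Fin.ext_iff, Fin.val_rev]
  exact if_congr (by omega) rfl rfl

theorem coe_volElt (m : ℕ) : (volElt m : ExteriorAlgebra ℂ (V m)) =
    tau m • dualWedgeList m (List.range' 1 (2 * m + 1)) := by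
  rw [volElt, volForm, map_smul, exteriorPower.map_apply_ιMulti, Submodule.coe_smul, coe_ιMulti_eq,
    dualWedgeList, tau]
  congr 3
  refine List.ext_getElem (by simp) fun i h1 h2 => ?_
  simp [sharp_proj, add_comm]

/-- The normalizing sign of Ω cancels the sign in `prWedge_denomElt`. Striking out the duals of the
outer vectors leaves those with m + 2 - j ≤ s ≤ 2m + 2 - j, which are v_{j+m}, …, v_j up to sign. -/
theorem projection_denomElt (m j : ℕ) (h2 : 2 ≤ j) (hj : j ≤ m) :
    projection m (denomElt m j) = vWedge m j := by
  change dualityMap m (contraction m (prWedge m (kappaInv m (m % 2)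
    (symToEnd m (denomElt m j))))) = _
  refine Subtype.ext ?_
  rw [prWedge_denomElt m j h2 hj, coe_dualityMap_contraction, Submodule.coe_smul,
    coe_vOuter m j h2 hj, coe_vWedge, coe_volElt, map_smul, map_smul, MulOpposite.unop_smul,
    LinearMap.smul_apply, smul_smul, tau_mul_self, one_smul, outerList, wedgeList_append, map_mul,
    MulOpposite.unop_mul, Module.End.mul_apply]
  have e : List.range' 1 (2 * m + 1) = List.range' 1 (m + 1 - j) ++
      (List.range' (m + 2 - j) (m + 1) ++ List.range' (2 * m + 3 - j) (j - 1)) := by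
    rw [show m + 2 - j = 1 + 1 * (m + 1 - j) by omega,
      show 2 * m + 3 - j = 1 + 1 * (m + 1 - j) + 1 * (m + 1) by omega,
      List.range'_append, List.range'_append]
    congr 1
    omega
  have h3 := formContr_range' m [] (List.range' (m + 2 - j) (m + 1) ++
    List.range' (2 * m + 3 - j) (j - 1)) (m + 1 - j) 1 le_rfl (by omega) fun s hs => by
      simp only [List.nil_append, List.mem_append, List.mem_range'_1] at hs; omega
  have h4 := formContr_range' m (List.range' (m + 2 - j) (m + 1)) [] (j - 1) (2 * m + 3 - j)
    (by omega) (by omega) fun s hs => by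
      simp only [List.append_nil, List.mem_range'_1] at hs; omega
  rw [List.nil_append, List.length_nil, mul_zero, pow_zero, one_smul, List.nil_append] at h3
  rw [List.append_nil, List.append_nil, List.length_range'] at h4
  -- The first block is struck out without sign, the last one past m + 1 vectors; together with the
  -- reversal the exponent is even.
  rw [e, h3, h4, dualWedgeList_range' m (m + 1) (m + 2 - j) (by omega), smul_smul, ← pow_add,
    show 2 * m + 3 - (m + 2 - j) - (m + 1) = j by omega,
    show (j - 1) * (m + 1) + (m + 1) * (m + (m + 2 - j) + (m + 1)) = (m + 1) * (m + 2) + 2 * (m * (m + 1)) by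
      obtain ⟨i, rfl⟩ : ∃ i, j = i + 1 := ⟨j - 1, by omega⟩
      obtain ⟨n, rfl⟩ : ∃ n, m = i + 1 + n := ⟨m - (i + 1), by omega⟩
      rw [show i + 1 + n + 2 - (i + 1) = n + 2 by omega, Nat.add_sub_cancel]
      ring,
    ((Nat.even_mul_succ_self (m + 1)).add (even_two_mul _)).neg_one_pow, one_smul]

/-! ### The element `N_(j)` -/

/-- In general `soToCl` gives ½(ab - ba), which is ab when a and b anticommute. -/
theorem soToCl_rot (m : ℕ) (a b : V m) (h : bil m a b = 0) :
    soToCl m (rot m a b) = CliffordAlgebra.ι (quad m) a * CliffordAlgebra.ι (quad m) b := by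
  have h1 : ∀ z : V m, ∑ k, bil m z (Pi.single k 1) • (eps m k • (Pi.single k.rev 1 : V m)) = z := by
    intro z
    refine (Finset.sum_congr rfl fun k _ => ?_).trans
      ((Equiv.sum_comp Fin.revPerm fun k => z k • (Pi.single k 1 : V m)).trans ?_)
    · rw [bil_symm, bil_apply, Finset.sum_eq_single k, Pi.single_eq_same, smul_smul, mul_one,
        mul_right_comm, eps_mul_self, one_mul]
      · rfl
      · intro l _ hl; simp [Pi.single_eq_of_ne hl]
      · simp
    · funext l; simp [Finset.sum_apply, Pi.single_apply]
  have h2 := ι_anticomm m a b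
  rw [h, map_zero] at h2
  have h3 : ∀ k, CliffordAlgebra.ι (quad m) (rot m a b (Pi.single k 1)) *
      CliffordAlgebra.ι (quad m) (eps m k • Pi.single k.rev 1) =
      CliffordAlgebra.ι (quad m) a * CliffordAlgebra.ι (quad m)
        (bil m b (Pi.single k 1) • (eps m k • (Pi.single k.rev 1 : V m))) -
      CliffordAlgebra.ι (quad m) b * CliffordAlgebra.ι (quad m)
        (bil m a (Pi.single k 1) • (eps m k • (Pi.single k.rev 1 : V m))) := by
    intro k
    rw [rot_apply, map_sub, sub_mul, map_smul _ (bil m b _), map_smul _ (bil m a _),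
      map_smul _ (bil m b _), map_smul _ (bil m a _), smul_mul_assoc, smul_mul_assoc,
      mul_smul_comm, mul_smul_comm]
  rw [soToCl, Finset.sum_congr rfl fun k _ => h3 k, Finset.sum_sub_distrib, ← Finset.mul_sum,
    ← Finset.mul_sum, ← map_sum, ← map_sum, h1, h1, eq_neg_of_add_eq_zero_right h2,
    sub_neg_eq_add, ← two_smul ℂ, smul_smul, one_div_mul_cancel two_ne_zero, one_smul]

/-- The element of `so(V)` with `v_j ↦ v_{j-1}` that annihilates the other `v_i`, except for
`v̄_{j-1}`. -/
def lower (m j : ℕ) : Module.End ℂ (V m) :=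
  rot m ((-1 : ℂ) ^ (m + 1 + j) • vec m (j - 1)) (vec m (2 * m + 2 - j))

theorem lower_mem (m j : ℕ) : lower m j ∈ skewAdjointLieSubalgebra (bil m) :=
  (LinearMap.mem_skewAdjointSubmodule (B := bil m) _).2 fun u v => by
    rw [lower, rot_skew, Pi.neg_apply, map_neg]

/-- The operator moves an occupied j to an empty j - 1, that is, it lengthens a row of m + 1 - j
boxes by one. No sign arises: the two positions are adjacent, and the scalar in `lower` cancels
ε(j). -/
theorem spinRep_lower (m j : ℕ) (h2 : 2 ≤ j) (hj : j ≤ m) (C : Finset (Fin m)) :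
    spinRep m (soToCl m (lower m j)) (wBasis m C) =
      if (⟨j - 1, by omega⟩ : Fin m) ∈ C ∧ (⟨j - 2, by omega⟩ : Fin m) ∉ C then
        wBasis m (insert ⟨j - 2, by omega⟩ (C.erase ⟨j - 1, by omega⟩)) else 0 := by
  set p : Fin m := ⟨j - 1, by omega⟩ with hp
  set q : Fin m := ⟨j - 2, by omega⟩ with hq
  have hpq : q ≠ p := fun h => by have := Fin.ext_iff.1 h; simp only [hp, hq] at this; omega
  have e1 := gamma_vec_gt m p C
  rw [show 2 * m + 1 - (p : ℕ) = 2 * m + 2 - j by simp only [hp]; omega] at e1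
  have e2 := gamma_vec_lt m q (C.erase p)
  rw [show (q : ℕ) + 1 = j - 1 by simp only [hq]; omega] at e2
  rw [lower, soToCl_rot m _ _ (by
    rw [map_smul, LinearMap.smul_apply, bil_vec_eq_zero m _ _ (by omega), smul_zero]), map_mul,
    Module.End.mul_apply, spinRep_ι, spinRep_ι, e1, map_smul, LinearMap.smul_apply]
  by_cases hC : p ∈ C
  · rw [if_pos hC, map_smul, e2]
    by_cases hC' : q ∈ C
    · rw [if_pos (Finset.mem_erase.2 ⟨hpq, hC'⟩), if_neg fun h => h.2 hC', smul_zero, smul_zero]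
    · rw [if_neg fun h => hC' (Finset.mem_of_mem_erase h), if_pos ⟨hC, hC'⟩, smul_smul, smul_smul]
      have e3 : sgn q (C.erase p) = sgn p C := by
        rw [sgn, sgn]
        congr 2
        ext k
        simp only [Finset.mem_filter, Finset.mem_erase, Fin.lt_def]
        constructor
        · rintro ⟨⟨h1, h2⟩, h3⟩
          exact ⟨h2, by simp only [hp, hq] at h3 ⊢; omega⟩
        · rintro ⟨h1, h2⟩
          have h3 : k ≠ q := fun h => hC' (h ▸ h1)
          rw [Ne, Fin.ext_iff] at h3
          refine ⟨⟨fun h => ?_, h1⟩, ?_⟩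
          · rw [h] at h2; exact lt_irrefl _ h2
          · simp only [hp, hq] at h2 h3 ⊢; omega
      rw [e3, show (-1 : ℂ) ^ (m + 1 + j) * ((-1) ^ (m + (p : ℕ)) * sgn p C) * sgn p C = 1 by
        rw [mul_assoc, mul_assoc _ (sgn p C), sgn_mul_self, mul_one,
          neg_one_pow_congr (show (m + (p : ℕ)) % 2 = (m + 1 + j) % 2 by simp only [hp]; omega),
          neg_one_pow_mul_self], one_smul]
  · rw [if_neg hC, if_neg fun h => hC h.1, map_zero, smul_zero]

theorem rho_one_eq (l : ℕ) (J : Finset ℕ) (h : 1 ∈ J) : rho 1 l J = rho 0 l J := by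
  refine List.map_congr_left fun r hr => ?_
  have hr : r ∉ J := of_decide_eq_true (List.mem_filter.1 hr).2
  have : r ≠ 1 := fun e => hr (e ▸ h)
  rw [row, row, if_neg this, if_neg this]

theorem mu_one_eq (m l : ℕ) (J : Finset ℕ) (h : 1 ∉ J) : mu m 1 l J = mu m 0 l J := by
  rw [mu, mu]
  congr 1
  refine List.map_congr_left fun r hr => ?_
  have hr : r ∈ J := of_decide_eq_true (List.mem_filter.1 hr).2
  have : r ≠ 1 := fun e => h (e ▸ hr)
  rw [row, row, if_neg this, if_neg this]

theorem mem_rho_one {m j : ℕ} (hj : j ≤ m) (J : Finset ℕ) (h : 1 ∉ J) (i : Fin m) :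
    m - (i : ℕ) ∈ rho 1 (m + 1 - j) J ↔
      (i : ℕ) + 2 = j ∨ j < (i : ℕ) + 1 ∧ (i : ℕ) + 2 - j ∉ J := by
  simp only [mem_rho, row]
  constructor
  · rintro ⟨r, hr, hrJ, e⟩
    split_ifs at e with h1
    · left; omega
    · obtain rfl : r = (i : ℕ) + 2 - j := by omega
      exact Or.inr ⟨by omega, hrJ⟩
  · rintro (e | ⟨e, hJ⟩)
    · exact ⟨1, by omega, h, by rw [if_pos rfl]; omega⟩
    · exact ⟨_, by omega, hJ, by rw [if_neg (by omega)]; omega⟩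

theorem mem_mu_one {m j : ℕ} (hj : j ≤ m) (J : Finset ℕ) (h : 1 ∈ J) (i : Fin m) :
    m - (i : ℕ) ∈ mu m 1 (m + 1 - j) J ↔ (i : ℕ) + 1 ≤ m + 1 - j ∨
      (i : ℕ) + 2 = j ∨ j < (i : ℕ) + 1 ∧ (i : ℕ) + 2 - j ∈ J := by
  simp only [mem_mu, row]
  refine or_congr ⟨?_, fun h => ⟨(i : ℕ) + 1, by omega, by omega⟩⟩ ⟨?_, ?_⟩
  · rintro ⟨r, hr, h⟩; omega
  · rintro ⟨r, hr, hrJ, e⟩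
    split_ifs at e with h1
    · left; omega
    · obtain rfl : r = (i : ℕ) + 2 - j := by omega
      exact Or.inr ⟨by omega, hrJ⟩
  · rintro (e | ⟨e, hJ⟩)
    · exact ⟨1, by omega, h, by rw [if_pos rfl]; omega⟩
    · exact ⟨_, by omega, hJ, by rw [if_neg (by omega)]; omega⟩

theorem spinRep_lower_rho (m j : ℕ) (h2 : 2 ≤ j) (hj : j ≤ m) (J : Finset ℕ) :
    spinRep m (soToCl m (lower m j)) (wPart m (rho 0 (m + 1 - j) J)) =
      if 1 ∈ J then 0 else wPart m (rho 1 (m + 1 - j) J) := by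
  rw [wPart_rho, wPart_rho, spinRep_lower m j h2 hj]
  simp only [Finset.mem_filter, Finset.mem_univ, true_and, mem_rho_zero hj]
  by_cases h : 1 ∈ J
  · rw [if_pos h, if_neg fun h' => h'.1.2 (by rwa [show j - 1 + 2 - j = 1 by omega])]
  · rw [if_neg h, if_pos ⟨⟨by omega, by rwa [show j - 1 + 2 - j = 1 by omega]⟩, by omega⟩]
    congr 1
    ext i
    simp only [Finset.mem_insert, Finset.mem_erase, Finset.mem_filter, Finset.mem_univ, true_and,
      mem_rho_one hj J h, Fin.ext_iff, Ne]
    refine or_congr (by omega) ?_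
    rw [← and_assoc]
    exact and_congr_left' (by omega)

/-- If 1 ∉ J, then j can only be occupied through the upper rows, in which case j - 1 is occupied
too and the operator gives zero. If 1 ∈ J, the first staircase row is lengthened, unless this
destroys strictness. -/
theorem spinRep_lower_mu (m j : ℕ) (h2 : 2 ≤ j) (hj : j ≤ m) (J : Finset ℕ) :
    spinRep m (soToCl m (lower m j)) (wPart m (mu m 0 (m + 1 - j) J)) =
      if 1 ∈ J then wPart m (mu m 1 (m + 1 - j) J) else 0 := by
  have hl1 : 1 ≤ m + 1 - j := by omega
  have hlm : m + 1 - j ≤ m := by omega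
  by_cases hs : ∀ r ∈ J, 1 ≤ r → r ≤ m + 1 - j → row 0 (m + 1 - j) r < m + 1 - (m + 1 - j)
  · rw [wPart_mu m 0 _ hl1 hlm J hs, spinRep_lower m j h2 hj]
    simp only [Finset.mem_filter, Finset.mem_univ, true_and, mem_mu_zero hj]
    by_cases h : 1 ∈ J
    · rw [if_pos h]
      have h0 := hs 1 h le_rfl hl1
      rw [row, if_pos rfl] at h0
      by_cases h3 : m + 1 - j + 1 < j
      · rw [if_pos ⟨Or.inr ⟨by omega, by rwa [show j - 1 + 2 - j = 1 by omega]⟩, by omega⟩,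
          wPart_mu m 1 _ hl1 hlm J]
        · congr 1
          ext i
          simp only [Finset.mem_insert, Finset.mem_erase, Finset.mem_filter, Finset.mem_univ,
            true_and, mem_mu_one hj J h, Fin.ext_iff, Ne]
          clear hs h h0 hl1 hlm
          generalize m + 1 - j = l at h3 ⊢
          by_cases hi : (i : ℕ) + 2 - j ∈ J
          · simp only [hi, and_true]; omega
          · simp only [hi, and_false, or_false]; omega
        · intro r hr _ hr'
          rw [row]
          split_ifs <;> omega
      -- Here the lengthened row would equal the last upper row: the operator finds j - 1 occupied,
      -- and the new list is not strict, so both sides are zero.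
      · rw [if_neg fun h' => h'.2 (Or.inl (by omega)), wPart_mu_of_not m 1 _ hl1 hlm J]
        intro h'
        have := h' 1 h le_rfl hl1
        rw [row, if_pos rfl] at this
        omega
    · rw [if_neg h, if_neg]
      rintro ⟨h3 | h3, h4⟩
      · exact h4 (Or.inl (by omega))
      · exact h (by rw [show j - 1 + 2 - j = 1 by omega] at h3; exact h3.2)
  · rw [wPart_mu_of_not m 0 _ hl1 hlm J hs, map_zero]
    split_ifs with h
    · rw [wPart_mu_of_not m 1 _ hl1 hlm J]
      refine fun h' => hs fun r hr h1 h3 => lt_of_le_of_lt ?_ (h' r hr h1 h3)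
      rw [row, row]
      split_ifs <;> omega
    · rfl

/-- The first staircase row belongs to ρ^J if 1 ∉ J and is appended to μ^J if 1 ∈ J. In the Leibniz
rule only that factor survives, and its row gains the extra box; the other factor contributes zero.
-/
theorem symDer_lower_denomElt (m j : ℕ) (h2 : 2 ≤ j) (hj : j ≤ m) :
    symDer (spinRep m (soToCl m (lower m j))) (denomElt m j) = numerElt m j := by
  rw [denomElt, numerElt, quadElt, quadElt, map_sum]
  refine Finset.sum_congr rfl fun J _ => ?_
  rw [map_smul, symDer_symMul, spinRep_lower_rho m j h2 hj,
    spinRep_lower_mu m j h2 hj J]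
  by_cases h : 1 ∈ J
  · rw [if_pos h, if_pos h, zero_symMul, zero_add, rho_one_eq _ J h]
  · rw [if_neg h, if_neg h, symMul_zero, add_zero, mu_one_eq m _ J h]

theorem lower_vec_self (m j : ℕ) (h2 : 2 ≤ j) (hj : j ≤ m) :
    lower m j (vec m j) = vec m (j - 1) := by
  have h := bil_vec_bar m (2 * m + 2 - j) (by omega) (by omega)
  rw [show 2 * m + 2 - (2 * m + 2 - j) = j by omega,
    neg_one_pow_congr (show (m + 1 + (2 * m + 2 - j)) % 2 = (m + 1 + j) % 2 by omega)] at h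
  rw [lower, rot_apply, h, map_smul, LinearMap.smul_apply, bil_vec_eq_zero m _ _ (by omega),
    smul_zero, zero_smul, sub_zero, smul_smul, neg_one_pow_mul_self, one_smul]

theorem lower_vec_of_ne (m j s : ℕ) (h2 : 2 ≤ j) (hj : j ≤ m) (hs : s ≠ j)
    (hs' : s ≠ 2 * m + 3 - j) : lower m j (vec m s) = 0 := by
  rw [lower, rot_apply, map_smul, LinearMap.smul_apply, bil_vec_eq_zero m _ s (by omega),
    bil_vec_eq_zero m _ s (by omega), smul_zero, zero_smul, zero_smul, sub_zero]

theorem lower_vec_bar (m j : ℕ) (h2 : 2 ≤ j) (hj : j ≤ m) :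
    ∃ c : ℂ, lower m j (vec m (2 * m + 3 - j)) = c • vec m (2 * m + 2 - j) := by
  refine ⟨-bil m ((-1 : ℂ) ^ (m + 1 + j) • vec m (j - 1)) (vec m (2 * m + 3 - j)), ?_⟩
  rw [lower, rot_apply, bil_vec_eq_zero m (2 * m + 2 - j) _ (by omega), zero_smul, zero_sub,
    ← neg_smul]

/-- Besides v_j only v_{2m+3-j} can be moved, and it goes to a multiple of v_{2m+2-j}. -/
theorem extDer_lower_vWedge (m j : ℕ) (h2 : 2 ≤ j) (hj : j ≤ m) :
    extDer (m + 1) (lower m j) (vWedge m j) = vWedgePlus m j := by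
  rw [vWedge, extDer_ιMulti, Finset.sum_eq_single 0, vWedgePlus]
  · congr 1
    funext k
    by_cases hk : k = 0
    · subst hk
      rw [Function.update_self, if_pos (Fin.val_zero _)]
      exact lower_vec_self m j h2 hj
    · rw [Function.update_of_ne hk, if_neg fun h => hk (Fin.ext (h.trans (Fin.val_zero _).symm))]
  · intro i _ hi
    have hi0 : (i : ℕ) ≠ 0 := fun h => hi (Fin.ext h)
    by_cases h : j + (i : ℕ) = 2 * m + 3 - j
    · obtain ⟨c, hc⟩ := lower_vec_bar m j h2 hj
      rw [h, hc, AlternatingMap.map_update_smul]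
      have hi' := i.2
      -- The preceding factor of the wedge is v_{2m+2-j} itself, so this term has a repeated vector.
      have hne : (⟨i - 1, by omega⟩ : Fin (m + 1)) ≠ i := fun e => by
        have := Fin.ext_iff.1 e; simp only at this; omega
      rw [AlternatingMap.map_eq_zero_of_eq _ _ _ hne, smul_zero]
      rw [Function.update_self, Function.update_of_ne hne]
      congr 1
      simp only
      omega
    · rw [lower_vec_of_ne m j _ h2 hj (by omega) h]
      exact AlternatingMap.map_coord_zero _ i (Function.update_self _ _ _)
  · exact fun h => absurd (Finset.mem_univ _) h

theorem projection_numerElt (m j : ℕ) (h2 : 2 ≤ j) (hj : j ≤ m) :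
    projection m (numerElt m j) = vWedgePlus m j := by
  rw [← symDer_lower_denomElt m j h2 hj, projection_symDer m _ (lower_mem m j),
    projection_denomElt m j h2 hj, extDer_lower_vWedge m j h2 hj]

end SpinProj

end

open SpinProj
theorem mainTheorem2 (m : ℕ) (hm : 1 ≤ m) :
    -- the maps from which `π` is built are isomorphisms, respectively an embedding
    Function.Bijective (delta m) ∧
    Function.Injective (symToEnd m) ∧
    Function.Bijective (kappa m (m % 2)) ∧
    Function.Bijective (contraction m) ∧
    Function.Bijective (dualityMap m) ∧
    -- `π` is equivariant under `Spin(V)` and under `so(V)`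
    (∀ (g : spinGroup (quad m)) (s : Sym[ℂ]^2 (VSpin m)),
      projection m (symMap (spinRep m (g : Cl m)) s) =
        exteriorPower.map (m + 1) (vecRep m g) (projection m s)) ∧
    (∀ X ∈ skewAdjointLieSubalgebra (bil m), ∀ s : Sym[ℂ]^2 (VSpin m),
      projection m (symDer (spinRep m (soToCl m X)) s) = extDer (m + 1) X (projection m s)) ∧
    -- `π` is surjective
    Function.Surjective (projection m) ∧
    ∀ j : ℕ, 2 ≤ j → j ≤ m →
      -- the element of `Cl(V)` that corresponds to `D_(j)`, of the parity of `m`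
      (clDenom m j ∈ CliffordAlgebra.evenOdd (quad m) (m : ZMod 2) ∧
        spinRep m (clDenom m j) = symToEnd m (denomElt m j)) ∧
      -- its component in `⋀^m V`
      prWedge m (kappaInv m (m % 2) (symToEnd m (denomElt m j))) =
        ((-1 : ℂ) ^ (m * (m + 1) / 2)) • vOuter m j ∧
      -- the images under `π`
      projection m (denomElt m j) = vWedge m j ∧
      projection m (numerElt m j) = vWedgePlus m j := by
  refine ⟨delta_bijective m, symToEnd_injective m, kappa_bijective m _ (Nat.mod_lt _ two_pos),
    contraction_bijective m, dualityMap_bijective m, projection_symMap m, projection_symDer m,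
    projection_surjective m, fun j h2 hj => ?_⟩
  exact ⟨⟨clDenom_mem_evenOdd m j h2 hj, spinRep_clDenom_eq m j h2 hj⟩, prWedge_denomElt m j h2 hj,
    projection_denomElt m j h2 hj, projection_numerElt m j h2 hj⟩
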